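/- Let $G$ be a compact Lie group, $H\le G$ a closed subgroup and $X$ an $H$-space (any topological space with a continuous action $H\times X\to X$). Let $G\times_H X$ be the quotient of $G\times X$ by $(g,x)\sim(gh^{-1},hx)$, $h\in H$, with $G$ acting by left multiplication. For a compact Lie group $\Gamma$, $K^*_\Gamma$ denotes equivariant complex K-theory of arbitrary $\Gamma$-spaces, represented by Fredholm operators: $K^0_\Gamma(Y)$ is the abelian group generated by the triples $(E_0,E_1,F)$, where $E_0,E_1$ are separable unitary $\Gamma$-representations and $F=(F_y\colon E_0\to E_1)_{y\in Y}$ is a $\Gamma$-equivariant family of bounded operators such that $y\mapsto F_y$ and $y\mapsto F_y^*$ are strongly continuous and $F_y^*F_y-1$, $F_yF_y^*-1$ are compact and norm continuous in $y$; the relations are that direct sums (up to unitary isomorphism) are sums, that homotopic families (the two ends of a family over $Y\times[0,1]$) are equal, and that families of unitary operators are $0$. For compact Hausdorff $Y$ this is the Grothendieck group of complex $\Gamma$-vector bundles. For $k\ge 0$, $K^{-k}_\Gamma(Y)=\ker\big(K^0_\Gamma(Y\times S^k)\to K^0_\Gamma(Y)\big)$ (restriction to the base point of $S^k$), and $K^{k}_\Gamma=K^{k-2k}_\Gamma=K^{-k}_\Gamma$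 by Bott periodicity. For $g\in G$ of finite order, with centralizer $C_G(g)$, put $\Lambda_G(g)=(C_G(g)\times\mathbb R)/\langle(g,-1)\rangle$; it acts on the fixed point space $Y^g$ of a $G$-space $Y$ by $[a,t]\cdot y=a\cdot y$. The quasi-elliptic cohomology of a $G$-space $Y$ is $$QEll^n_G(Y)=\Big(\prod_{g\in G^{tors}}K^n_{\Lambda_G(g)}(Y^g)\Big)^G\qquad(n\in\mathbb Z),$$ where $G^{tors}$ is the set of elements of finite order and $G$ acts through the isomorphisms induced by $[a,t]\mapsto[hah^{-1},t]$, $\Lambda_G(g)\to\Lambda_G(hgh^{-1})$, and $y\mapsto hy$, $Y^g\to Y^{hgh^{-1}}$. (Equivalently, it is the product of the groups $K^n_{\Lambda_G(g)}(Y^g)$ over representatives $g$ of the conjugacy classes in $G^{tors}$.) The change-of-group map $\rho^G_H$ is the composite $$QEll^n_G(G\times_H X)\xrightarrow{\ \phi^*\ }QEll^n_H(G\times_H X)\xrightarrow{\ i^*\ }QEll^n_H(X),$$ where $\phi^*$ is the restriction along the inclusion $\phi\colon H\to G$, whose component at $\tau\in H^{tors}$ is the restriction $K^n_{\Lambda_G(\tau)}((G\times_HX)^\tau)\to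 K^n_{\Lambda_H(\tau)}((G\times_HX)^\tau)$ along $\Lambda_H(\tau)\to\Lambda_G(\tau)$, $[a,t]\mapsto[a,t]$, and $i^*$ is the pullback along the $H$-map $i\colon X\to G\times_H X$, $i(x)=[e,x]$. Proposition. For every $n\in\mathbb Z$ the homomorphism $\rho^G_H\colon QEll^n_G(G\times_H X)\to QEll^n_H(X)$ is an isomorphism of abelian groups. -/

import Mathlib

open scoped Manifold ContDiff InnerProductSpace

noncomputable section

/-! ## Equivariant complex K-theory

`K^0_Γ(X)` is built from equivariant families of Fredholm operators, parametrised by an arbitrary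
`Γ`-space `X` (the model of Kasparov and of Atiyah and Segal). For compact Hausdorff `X` and compact
`Γ` it is the Grothendieck group of complex `Γ`-vector bundles on `X`. -/

/-- A (strongly continuous) unitary representation of the topological group `Γ` on a separable
complex Hilbert space. -/
structure HilbRep (Γ : Type*) [Group Γ] [TopologicalSpace Γ] where
  V : Type
  [normed : NormedAddCommGroup V]
  [inner : InnerProductSpace ℂ V]
  [complete : CompleteSpace V]
  [separable : TopologicalSpace.SeparableSpace V]
  ρ : Γ →* (V ≃ₗᵢ[ℂ] V)
  continuous_apply : ∀ v : V, Continuous fun γ => ρ γ v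

attribute [instance] HilbRep.normed HilbRep.inner HilbRep.complete HilbRep.separable

/-- Restriction of a representation along a continuous homomorphism. -/
def HilbRep.res {Γ Γ' : Type*} [Group Γ] [TopologicalSpace Γ] [Group Γ'] [TopologicalSpace Γ']
    (E : HilbRep Γ) (φ : Γ' →ₜ* Γ) : HilbRep Γ' where
  V := E.V
  ρ := E.ρ.comp φ.toMonoidHom
  continuous_apply v := (E.continuous_apply v).comp φ.continuous_toFun

/-- A `Γ`-equivariant family, parametrised by the `Γ`-space `X`, of essentially unitary (hence
Fredholm) operators `F x : E₀ → E₁` between two unitary representations. As a function of `x`, the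
family and its adjoint are strongly continuous, and `F x * (F x)† - 1` and `(F x)† * F x - 1` are
compact and norm continuous. -/
structure FredholmFamily (Γ : Type*) [Group Γ] [TopologicalSpace Γ]
    (X : Type*) [TopologicalSpace X] [MulAction Γ X] where
  E₀ : HilbRep Γ
  E₁ : HilbRep Γ
  F : X → E₀.V →L[ℂ] E₁.V
  continuous_apply : ∀ v : E₀.V, Continuous fun x => F x v
  continuous_adjoint_apply : ∀ w : E₁.V, Continuous fun x => (F x).adjoint w
  isCompact_left : ∀ x, IsCompactOperator ((F x).adjoint ∘L F x - ContinuousLinearMap.id ℂ E₀.V)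
  isCompact_right : ∀ x, IsCompactOperator (F x ∘L (F x).adjoint - ContinuousLinearMap.id ℂ E₁.V)
  continuous_left : Continuous fun x => (F x).adjoint ∘L F x - ContinuousLinearMap.id ℂ E₀.V
  continuous_right : Continuous fun x => F x ∘L (F x).adjoint - ContinuousLinearMap.id ℂ E₁.V
  equivariant : ∀ (γ : Γ) (x : X) (v : E₀.V), F (γ • x) (E₀.ρ γ v) = E₁.ρ γ (F x v)

/-- The product of a `Γ`-space `X` with a space `Y` on which `Γ` acts trivially. -/
def TrivProd (X Y : Type*) : Type _ := X × Y

instance (X Y : Type*) [TopologicalSpace X] [TopologicalSpace Y] :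
    TopologicalSpace (TrivProd X Y) :=
  inferInstanceAs (TopologicalSpace (X × Y))

instance (Γ X Y : Type*) [Group Γ] [MulAction Γ X] : MulAction Γ (TrivProd X Y) where
  smul γ p := (γ • p.1, p.2)
  one_smul p := Prod.ext (one_smul Γ p.1) rfl
  mul_smul a b p := Prod.ext (mul_smul a b p.1) rfl

/-- The slice `x ↦ (x, y)`. -/
def TrivProd.slice (X : Type*) {Y : Type*} [TopologicalSpace X] [TopologicalSpace Y] (y : Y) :
    C(X, TrivProd X Y) where
  toFun x := (x, y)
  continuous_toFun := (Continuous.prodMk_left y : Continuous fun x : X => (x, y))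

/-- The map `(x, y) ↦ (f x, y)`. -/
def TrivProd.map {X X' : Type*} (Y : Type*) [TopologicalSpace X] [TopologicalSpace X']
    [TopologicalSpace Y] (f : C(X', X)) : C(TrivProd X' Y, TrivProd X Y) where
  toFun p := (f p.1, p.2)
  continuous_toFun := (f.continuous.prodMap continuous_id : Continuous (Prod.map f (id : Y → Y)))

theorem TrivProd.slice_smul (Γ : Type*) [Group Γ] [TopologicalSpace Γ] {X Y : Type*}
    [TopologicalSpace X] [TopologicalSpace Y] [MulAction Γ X] (y : Y) (γ : Γ) (x : X) :
    TrivProd.slice X y (γ • x) = ContinuousMonoidHom.id Γ γ • TrivProd.slice X y x := rfl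

theorem TrivProd.map_smul {Γ Γ' : Type*} [Group Γ] [TopologicalSpace Γ] [Group Γ']
    [TopologicalSpace Γ'] {X X' : Type*} (Y : Type*) [TopologicalSpace X] [TopologicalSpace X']
    [TopologicalSpace Y] [MulAction Γ X] [MulAction Γ' X'] (φ : Γ' →ₜ* Γ) (f : C(X', X))
    (hf : ∀ (γ : Γ') (x : X'), f (γ • x) = φ γ • f x) (γ : Γ') (p : TrivProd X' Y) :
    TrivProd.map Y f (γ • p) = φ γ • TrivProd.map Y f p :=
  Prod.ext (hf γ p.1) rfl

section FredholmFamily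

variable {Γ : Type*} [Group Γ] [TopologicalSpace Γ] {X : Type*} [TopologicalSpace X]
  [MulAction Γ X] {Γ' : Type*} [Group Γ'] [TopologicalSpace Γ'] {X' : Type*} [TopologicalSpace X']
  [MulAction Γ' X']

/-- Pullback of a family along a continuous map `f : X' → X` that is equivariant with respect to
a continuous homomorphism `φ : Γ' → Γ`. -/
def FredholmFamily.pullback (φ : Γ' →ₜ* Γ) (f : C(X', X))
    (hf : ∀ (γ : Γ') (x : X'), f (γ • x) = φ γ • f x) (c : FredholmFamily Γ X) :
    FredholmFamily Γ' X' where
  E₀ := c.E₀.res φ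
  E₁ := c.E₁.res φ
  F x := c.F (f x)
  continuous_apply v := (c.continuous_apply v).comp f.continuous
  continuous_adjoint_apply w := (c.continuous_adjoint_apply w).comp f.continuous
  isCompact_left x := c.isCompact_left (f x)
  isCompact_right x := c.isCompact_right (f x)
  continuous_left := c.continuous_left.comp f.continuous
  continuous_right := c.continuous_right.comp f.continuous
  equivariant γ x v := by
    rw [hf]
    exact c.equivariant (φ γ) (f x) v

/-- The family `c` is unitarily isomorphic to the orthogonal direct sum of `a` and `b`. -/
def FredholmFamily.IsDirectSum (a b c : FredholmFamily Γ X) : Prop :=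
  ∃ (u₀ : WithLp 2 (a.E₀.V × b.E₀.V) ≃ₗᵢ[ℂ] c.E₀.V) (u₁ : WithLp 2 (a.E₁.V × b.E₁.V) ≃ₗᵢ[ℂ] c.E₁.V),
    (∀ γ v w, u₀ (WithLp.toLp 2 (a.E₀.ρ γ v, b.E₀.ρ γ w)) = c.E₀.ρ γ (u₀ (WithLp.toLp 2 (v, w)))) ∧
    (∀ γ v w, u₁ (WithLp.toLp 2 (a.E₁.ρ γ v, b.E₁.ρ γ w)) = c.E₁.ρ γ (u₁ (WithLp.toLp 2 (v, w)))) ∧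
    ∀ x v w, c.F x (u₀ (WithLp.toLp 2 (v, w))) = u₁ (WithLp.toLp 2 (a.F x v, b.F x w))

/-- A family is degenerate if all its operators are unitary. -/
def FredholmFamily.IsDegenerate (c : FredholmFamily Γ X) : Prop :=
  ∀ x, (c.F x).adjoint ∘L c.F x = ContinuousLinearMap.id ℂ c.E₀.V ∧
    c.F x ∘L (c.F x).adjoint = ContinuousLinearMap.id ℂ c.E₁.V

/-- Two families are homotopic if they are the two ends of a family over `X × [0, 1]`. -/
def FredholmFamily.Homotopic (a b : FredholmFamily Γ X) : Prop :=
  ∃ h : FredholmFamily Γ (TrivProd X unitInterval),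
    a = h.pullback (ContinuousMonoidHom.id Γ) (TrivProd.slice X 0) (TrivProd.slice_smul Γ 0) ∧
    b = h.pullback (ContinuousMonoidHom.id Γ) (TrivProd.slice X 1) (TrivProd.slice_smul Γ 1)

variable (Γ X) in
/-- The relations that define `K^0_Γ(X)`: direct sums are sums (so isomorphic families are equal,
a summand being allowed to vanish), homotopic families are equal, degenerate families are zero. -/
def K0.relations : Set (FreeAbelianGroup (FredholmFamily Γ X)) :=
  {z | ∃ a b c : FredholmFamily Γ X, a.IsDirectSum b c ∧
    z = FreeAbelianGroup.of c - (FreeAbelianGroup.of a + FreeAbelianGroup.of b)} ∪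
  {z | ∃ a b : FredholmFamily Γ X, a.Homotopic b ∧
    z = FreeAbelianGroup.of a - FreeAbelianGroup.of b} ∪
  {z | ∃ a : FredholmFamily Γ X, a.IsDegenerate ∧ z = FreeAbelianGroup.of a}

variable (Γ X) in
/-- The equivariant K-group `K^0_Γ(X)`. -/
def K0 : Type _ :=
  FreeAbelianGroup (FredholmFamily Γ X) ⧸ AddSubgroup.closure (K0.relations Γ X)

instance : AddCommGroup (K0 Γ X) :=
  inferInstanceAs (AddCommGroup
    (FreeAbelianGroup (FredholmFamily Γ X) ⧸ AddSubgroup.closure (K0.relations Γ X)))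

/-- The class of a family in `K^0_Γ(X)`. -/
def K0.mk (c : FredholmFamily Γ X) : K0 Γ X :=
  QuotientAddGroup.mk (FreeAbelianGroup.of c)

theorem K0.hom_ext {A : Type*} [AddCommGroup A] {p q : K0 Γ X →+ A}
    (h : ∀ c, p (K0.mk c) = q (K0.mk c)) : p = q :=
  QuotientAddGroup.addMonoidHom_ext _ (FreeAbelianGroup.lift_ext _ _ h)

theorem K0.map_aux (φ : Γ' →ₜ* Γ) (f : C(X', X))
    (hf : ∀ (γ : Γ') (x : X'), f (γ • x) = φ γ • f x) :
    AddSubgroup.closure (K0.relations Γ X) ≤ (AddSubgroup.closure (K0.relations Γ' X')).comap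
      (FreeAbelianGroup.map (FredholmFamily.pullback φ f hf)) := by
  rw [AddSubgroup.closure_le]
  rintro z ((⟨a, b, c, ⟨u₀, u₁, h₀, h₁, h⟩, rfl⟩ | ⟨a, b, ⟨h, rfl, rfl⟩, rfl⟩) | ⟨a, ha, rfl⟩)
  · refine AddSubgroup.subset_closure (Or.inl (Or.inl
      ⟨a.pullback φ f hf, b.pullback φ f hf, c.pullback φ f hf, ?_, ?_⟩))
    · exact ⟨u₀, u₁, fun γ => h₀ (φ γ), fun γ => h₁ (φ γ), fun x => h (f x)⟩
    · simp [FreeAbelianGroup.map_of_apply]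
  · refine AddSubgroup.subset_closure (Or.inl (Or.inr
      ⟨_, _, ⟨h.pullback φ (TrivProd.map unitInterval f) (TrivProd.map_smul unitInterval φ f hf),
        rfl, rfl⟩, ?_⟩))
    · simp only [map_sub, FreeAbelianGroup.map_of_apply]
      rfl
  · refine AddSubgroup.subset_closure (Or.inr ⟨a.pullback φ f hf, fun x => ha (f x), ?_⟩)
    simp [FreeAbelianGroup.map_of_apply]

/-- The homomorphism `K^0_Γ(X) → K^0_Γ'(X')` induced by a continuous map `f : X' → X` that is
equivariant with respect to a continuous homomorphism `φ : Γ' → Γ`: restriction along `φ` followed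
by pullback along `f`. -/
def K0.map (φ : Γ' →ₜ* Γ) (f : C(X', X)) (hf : ∀ (γ : Γ') (x : X'), f (γ • x) = φ γ • f x) :
    K0 Γ X →+ K0 Γ' X' :=
  QuotientAddGroup.map _ _ (FreeAbelianGroup.map (FredholmFamily.pullback φ f hf))
    (K0.map_aux φ f hf)

theorem K0.map_mk (φ : Γ' →ₜ* Γ) (f : C(X', X))
    (hf : ∀ (γ : Γ') (x : X'), f (γ • x) = φ γ • f x) (c : FredholmFamily Γ X) :
    K0.map φ f hf (K0.mk c) = K0.mk (c.pullback φ f hf) := by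
  simp only [K0.map, K0.mk]
  exact congrArg _ (FreeAbelianGroup.map_of_apply c)

theorem K0.map_map {Γ'' : Type*} [Group Γ''] [TopologicalSpace Γ''] {X'' : Type*}
    [TopologicalSpace X''] [MulAction Γ'' X'']
    (φ : Γ' →ₜ* Γ) (f : C(X', X)) (hf : ∀ (γ : Γ') (x : X'), f (γ • x) = φ γ • f x)
    (φ' : Γ'' →ₜ* Γ') (f' : C(X'', X')) (hf' : ∀ (γ : Γ'') (x : X''), f' (γ • x) = φ' γ • f' x)
    (φ'' : Γ'' →ₜ* Γ) (f'' : C(X'', X)) (hf'' : ∀ (γ : Γ'') (x : X''), f'' (γ • x) = φ'' γ • f'' x)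
    (hφ : φ'' = φ.comp φ') (hff : f'' = f.comp f') (a : K0 Γ X) :
    K0.map φ' f' hf' (K0.map φ f hf a) = K0.map φ'' f'' hf'' a := by
  subst hφ hff
  refine DFunLike.congr_fun (f := (K0.map φ' f' hf').comp (K0.map φ f hf)) (K0.hom_ext fun c => ?_) a
  simp only [AddMonoidHom.comp_apply, K0.map_mk]
  rfl

/-- The sphere `S^k`. -/
abbrev Sph (k : ℕ) : Type := Metric.sphere (0 : EuclideanSpace ℝ (Fin (k + 1))) 1

/-- The base point of `S^k`. -/
def Sph.base (k : ℕ) : Sph k := ⟨EuclideanSpace.single 0 1, by simp⟩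

variable (Γ X) in
/-- The equivariant K-group `K^n_Γ(X)`, `n ∈ ℤ`. For `k ≥ 0`, `K^{-k}_Γ(X)` is the kernel of the
restriction `K^0_Γ(X × S^k) → K^0_Γ(X)` to the base point of `S^k`; by Bott periodicity K-theory is
extended 2-periodically to positive degrees, so that `K^k = K^{k-2k} = K^{-k}`. -/
def KGroup (n : ℤ) : Type _ :=
  (K0.map (ContinuousMonoidHom.id Γ) (TrivProd.slice X (Sph.base n.natAbs))
    (TrivProd.slice_smul Γ (Sph.base n.natAbs)) :
    K0 Γ (TrivProd X (Sph n.natAbs)) →+ K0 Γ X).ker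

instance (n : ℤ) : AddCommGroup (KGroup Γ X n) :=
  inferInstanceAs (AddCommGroup (K0.map (ContinuousMonoidHom.id Γ)
    (TrivProd.slice X (Sph.base n.natAbs))
    (TrivProd.slice_smul Γ (Sph.base n.natAbs)) :
    K0 Γ (TrivProd X (Sph n.natAbs)) →+ K0 Γ X).ker)

/-- The homomorphism `K^n_Γ(X) → K^n_Γ'(X')` induced by a continuous homomorphism `φ : Γ' → Γ` and
a `φ`-equivariant continuous map `f : X' → X`. -/
def KGroup.map (n : ℤ) (φ : Γ' →ₜ* Γ) (f : C(X', X))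
    (hf : ∀ (γ : Γ') (x : X'), f (γ • x) = φ γ • f x) : KGroup Γ X n →+ KGroup Γ' X' n :=
  ((K0.map φ (TrivProd.map (Sph n.natAbs) f) (TrivProd.map_smul (Sph n.natAbs) φ f hf)).comp
    (AddSubgroup.subtype _)).codRestrict _ (by
      rintro ⟨a, ha⟩
      rw [AddMonoidHom.mem_ker] at ha ⊢
      simp only [AddMonoidHom.comp_apply, AddSubgroup.subtype_apply]
      have h₁ := K0.map_map φ (TrivProd.map (Sph n.natAbs) f)
        (TrivProd.map_smul (Sph n.natAbs) φ f hf) (ContinuousMonoidHom.id Γ')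
        (TrivProd.slice X' (Sph.base n.natAbs)) (TrivProd.slice_smul Γ' (Sph.base n.natAbs))
        φ ((TrivProd.slice X (Sph.base n.natAbs)).comp f) (fun γ x => Prod.ext (hf γ x) rfl)
        rfl rfl a
      have h₂ := K0.map_map (ContinuousMonoidHom.id Γ) (TrivProd.slice X (Sph.base n.natAbs))
        (TrivProd.slice_smul Γ (Sph.base n.natAbs)) φ f hf
        φ ((TrivProd.slice X (Sph.base n.natAbs)).comp f) (fun γ x => Prod.ext (hf γ x) rfl)
        rfl rfl a
      exact h₁.trans (h₂.symm.trans ((congrArg _ ha).trans (map_zero _))))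

theorem KGroup.map_map {Γ'' : Type*} [Group Γ''] [TopologicalSpace Γ''] {X'' : Type*}
    [TopologicalSpace X''] [MulAction Γ'' X''] (n : ℤ)
    (φ : Γ' →ₜ* Γ) (f : C(X', X)) (hf : ∀ (γ : Γ') (x : X'), f (γ • x) = φ γ • f x)
    (φ' : Γ'' →ₜ* Γ') (f' : C(X'', X')) (hf' : ∀ (γ : Γ'') (x : X''), f' (γ • x) = φ' γ • f' x)
    (φ'' : Γ'' →ₜ* Γ) (f'' : C(X'', X)) (hf'' : ∀ (γ : Γ'') (x : X''), f'' (γ • x) = φ'' γ • f'' x)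
    (hφ : φ'' = φ.comp φ') (hff : f'' = f.comp f') (a : KGroup Γ X n) :
    KGroup.map n φ' f' hf' (KGroup.map n φ f hf a) = KGroup.map n φ'' f'' hf'' a := by
  refine Subtype.ext (K0.map_map _ _ _ _ _ _ _ _ _ hφ ?_ a.1)
  subst hff
  rfl

end FredholmFamily

/-! ## The groups `Λ_G(g)` -/

section Lam

variable {G : Type*} [Group G]

/-- The subgroup of `C_G(g) × ℝ` generated by `(g, -1)`. -/
def lamKernel (g : G) : Subgroup (Subgroup.centralizer ({g} : Set G) × Multiplicative ℝ) :=
  Subgroup.zpowers (⟨g, Subgroup.mem_centralizer_singleton_iff.2 rfl⟩, Multiplicative.ofAdd (-1))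

instance (g : G) : (lamKernel g).Normal := by
  refine ⟨fun n hn k => ?_⟩
  have hc : ∀ m ∈ lamKernel g, k * m = m * k := by
    intro m hm
    obtain ⟨j, rfl⟩ := Subgroup.mem_zpowers_iff.1 hm
    refine (Commute.zpow_right (Prod.ext (Subtype.ext ?_) (mul_comm _ _)) j : Commute k _)
    exact (Subgroup.mem_centralizer_singleton_iff.1 k.1.2)
  rw [hc n hn, mul_inv_cancel_right]
  exact hn

/-- `Λ_G(g) = (C_G(g) × ℝ) / ⟨(g, -1)⟩`. -/
abbrev Lam (g : G) : Type _ :=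
  (Subgroup.centralizer ({g} : Set G) × Multiplicative ℝ) ⧸ lamKernel g

variable {X : Type*} [MulAction G X]

/-- The action of `C_G(g) × ℝ` on `X^g` through the first factor. -/
@[reducible]
def fixedByAction (g : G) :
    MulAction (Subgroup.centralizer ({g} : Set G) × Multiplicative ℝ) (MulAction.fixedBy X g) where
  smul p x := ⟨(p.1 : G) • (x : X), by
    rw [MulAction.mem_fixedBy, ← mul_smul, ← Subgroup.mem_centralizer_singleton_iff.1 p.1.2,
      mul_smul, x.2]⟩
  one_smul x := Subtype.ext (one_smul G (x : X))
  mul_smul p q x := Subtype.ext (mul_smul (p.1 : G) (q.1 : G) (x : X))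

/-- The action `[a, t] • x = a • x` of `Λ_G(g)` on `X^g`, as a homomorphism. -/
def Lam.toPerm (g : G) : Lam g →* Equiv.Perm (MulAction.fixedBy X g) :=
  letI := fixedByAction (X := X) g
  QuotientGroup.lift (lamKernel g) (MulAction.toPermHom _ _) (by
    rw [lamKernel, Subgroup.zpowers_le, MonoidHom.mem_ker]
    exact Equiv.ext fun x => Subtype.ext x.2)

instance (g : G) : MulAction (Lam g) (MulAction.fixedBy X g) :=
  MulAction.compHom _ (Lam.toPerm (X := X) g)

theorem Lam.coe_mk_smul (g : G) (p : Subgroup.centralizer ({g} : Set G) × Multiplicative ℝ)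
    (x : MulAction.fixedBy X g) :
    (((QuotientGroup.mk p : Lam g) • x : MulAction.fixedBy X g) : X) = (p.1 : G) • (x : X) :=
  rfl

variable [TopologicalSpace G] [TopologicalSpace X] {G' : Type*} [Group G'] [TopologicalSpace G']
  {X' : Type*} [TopologicalSpace X'] [MulAction G' X']

/-- The homomorphism `Λ_G'(g') → Λ_G(g)`, `[a, t] ↦ [φ a, t]`, induced by a continuous homomorphism
`φ : G' → G` with `φ g' = g`. -/
def Lam.map (φ : G' →ₜ* G) {g' : G'} {g : G} (hg : φ g' = g) : Lam g' →ₜ* Lam g where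
  toMonoidHom := QuotientGroup.map _ _
    (MonoidHom.prodMap
      ((φ.toMonoidHom.comp (Subgroup.subtype _)).codRestrict (Subgroup.centralizer ({g} : Set G))
        (fun a => Subgroup.mem_centralizer_singleton_iff.2 (by
          subst hg
          have h := congrArg φ (Subgroup.mem_centralizer_singleton_iff.1 a.2)
          rw [map_mul, map_mul] at h
          exact h)))
      (MonoidHom.id (Multiplicative ℝ))) (by
    rw [lamKernel, Subgroup.zpowers_le, Subgroup.mem_comap]
    have h := Subgroup.mem_zpowers ((⟨g, Subgroup.mem_centralizer_singleton_iff.2 rfl⟩,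
      Multiplicative.ofAdd (-1)) : Subgroup.centralizer ({g} : Set G) × Multiplicative ℝ)
    subst hg
    exact h)
  continuous_toFun := continuous_quot_mk.comp (by
    refine Continuous.prodMk ?_ continuous_snd
    exact (φ.continuous_toFun.comp (continuous_subtype_val.comp continuous_fst)).subtype_mk _)
      |>.quotient_lift _

theorem Lam.map_mk (φ : G' →ₜ* G) {g' : G'} {g : G} (hg : φ g' = g)
    (p : Subgroup.centralizer ({g'} : Set G') × Multiplicative ℝ) :
    ∃ h, Lam.map φ hg (QuotientGroup.mk p) = QuotientGroup.mk (⟨φ p.1, h⟩, p.2) :=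
  ⟨_, rfl⟩

theorem mem_fixedBy_of_equivariant (φ : G' →ₜ* G) (f : C(X', X))
    (hf : ∀ (γ : G') (x : X'), f (γ • x) = φ γ • f x) {g' : G'} {g : G} (hg : φ g' = g)
    {x : X'} (hx : x ∈ MulAction.fixedBy X' g') : f x ∈ MulAction.fixedBy X g := by
  subst hg
  rw [MulAction.mem_fixedBy] at hx ⊢
  rw [← hf, hx]

/-- The map `X'^g' → X^g` given by a `φ`-equivariant continuous map `f : X' → X`. -/
def fixedByMap (φ : G' →ₜ* G) (f : C(X', X)) (hf : ∀ (γ : G') (x : X'), f (γ • x) = φ γ • f x)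
    {g' : G'} {g : G} (hg : φ g' = g) : C(MulAction.fixedBy X' g', MulAction.fixedBy X g) where
  toFun x := ⟨f x, mem_fixedBy_of_equivariant φ f hf hg x.2⟩
  continuous_toFun := (f.continuous.comp continuous_subtype_val).subtype_mk _

theorem fixedByMap_smul (φ : G' →ₜ* G) (f : C(X', X))
    (hf : ∀ (γ : G') (x : X'), f (γ • x) = φ γ • f x) {g' : G'} {g : G} (hg : φ g' = g)
    (γ : Lam g') (x : MulAction.fixedBy X' g') :
    fixedByMap φ f hf hg (γ • x) = Lam.map φ hg γ • fixedByMap φ f hf hg x := by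
  induction γ using QuotientGroup.induction_on with
  | H p => exact Subtype.ext (hf p.1 x)

/-- The homomorphism `K^n_{Λ_G(g)}(X^g) → K^n_{Λ_G'(g')}(X'^g')` induced by `φ : G' → G` and
`f : X' → X`, where `φ g' = g`. -/
def KLam.map (n : ℤ) (φ : G' →ₜ* G) (f : C(X', X))
    (hf : ∀ (γ : G') (x : X'), f (γ • x) = φ γ • f x) {g' : G'} {g : G} (hg : φ g' = g) :
    KGroup (Lam g) (MulAction.fixedBy X g) n →+ KGroup (Lam g') (MulAction.fixedBy X' g') n :=
  KGroup.map n (Lam.map φ hg) (fixedByMap φ f hf hg) (fixedByMap_smul φ f hf hg)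

theorem KLam.map_map {G'' : Type*} [Group G''] [TopologicalSpace G''] {X'' : Type*}
    [TopologicalSpace X''] [MulAction G'' X''] (n : ℤ)
    (φ : G' →ₜ* G) (f : C(X', X)) (hf : ∀ (γ : G') (x : X'), f (γ • x) = φ γ • f x)
    (φ' : G'' →ₜ* G') (f' : C(X'', X')) (hf' : ∀ (γ : G'') (x : X''), f' (γ • x) = φ' γ • f' x)
    (φ'' : G'' →ₜ* G) (f'' : C(X'', X)) (hf'' : ∀ (γ : G'') (x : X''), f'' (γ • x) = φ'' γ • f'' x)
    (hφ : φ'' = φ.comp φ') (hff : f'' = f.comp f') {g'' : G''} {g' : G'} {g : G}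
    (hg : φ g' = g) (hg' : φ' g'' = g') (hg'' : φ'' g'' = g)
    (a : KGroup (Lam g) (MulAction.fixedBy X g) n) :
    KLam.map n φ' f' hf' hg' (KLam.map n φ f hf hg a) = KLam.map n φ'' f'' hf'' hg'' a := by
  subst hφ hff
  refine KGroup.map_map _ _ _ _ _ _ _ _ _ _ ?_ ?_ a
  · ext γ
    induction γ using QuotientGroup.induction_on with
    | H p => rfl
  · rfl

end Lam

/-! ## Quasi-elliptic cohomology -/

section QEll

/-- Conjugation `a ↦ h * a * h⁻¹` as a continuous homomorphism. -/
def conjHom {G : Type*} [Group G] [TopologicalSpace G] [IsTopologicalGroup G] (h : G) :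
    G →ₜ* G where
  toMonoidHom := (MulAut.conj h).toMonoidHom
  continuous_toFun := IsTopologicalGroup.continuous_conj h

/-- Translation `x ↦ h • x`, which is equivariant with respect to conjugation by `h`. -/
def translateMap {G : Type*} [Group G] [TopologicalSpace G] (X : Type*) [TopologicalSpace X]
    [MulAction G X] [ContinuousSMul G X] (h : G) : C(X, X) where
  toFun x := h • x
  continuous_toFun := continuous_const_smul h

theorem translateMap_smul {G : Type*} [Group G] [TopologicalSpace G] [IsTopologicalGroup G]
    (X : Type*) [TopologicalSpace X] [MulAction G X] [ContinuousSMul G X] (h : G) (γ : G) (x : X) :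
    translateMap X h (γ • x) = conjHom h γ • translateMap X h x := by
  change h • γ • x = (h * γ * h⁻¹) • h • x
  simp [mul_smul]

/-- `QEll^n_G(X) = (∏_{g ∈ G^tors} K^n_{Λ_G(g)}(X^g))^G`: families `(a_g)` indexed by the elements
of finite order of `G` that are invariant under `G`, that is, such that the isomorphism
`K^n_{Λ_G(hgh⁻¹)}(X^{hgh⁻¹}) → K^n_{Λ_G(g)}(X^g)` induced by conjugation with `h` and by `x ↦ h • x`
takes `a_{hgh⁻¹}` to `a_g`. -/
def QEll (n : ℤ) (G : Type*) [Group G] [TopologicalSpace G] [IsTopologicalGroup G]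
    (X : Type*) [TopologicalSpace X] [MulAction G X] [ContinuousSMul G X] :
    AddSubgroup (∀ g : {g : G // IsOfFinOrder g},
      KGroup (Lam (g : G)) (MulAction.fixedBy X (g : G)) n) where
  carrier := {a | ∀ (h : G) (g g' : {g : G // IsOfFinOrder g}) (hg : conjHom h (g : G) = g'),
    KLam.map n (conjHom h) (translateMap X h) (translateMap_smul X h) hg (a g') = a g}
  zero_mem' h g g' hg := map_zero _
  add_mem' := by
    intro a b ha hb h g g' hg
    rw [Pi.add_apply, map_add, ha h g g' hg, hb h g g' hg, Pi.add_apply]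
  neg_mem' := by
    intro a ha h g g' hg
    rw [Pi.neg_apply, map_neg, ha h g g' hg, Pi.neg_apply]

variable {G : Type*} [Group G] [TopologicalSpace G] [IsTopologicalGroup G]
  {X : Type*} [TopologicalSpace X] [MulAction G X] [ContinuousSMul G X]
  {G' : Type*} [Group G'] [TopologicalSpace G'] [IsTopologicalGroup G']
  {X' : Type*} [TopologicalSpace X'] [MulAction G' X'] [ContinuousSMul G' X']

/-- The homomorphism `QEll^n_G(X) → QEll^n_G'(X')` induced by a continuous homomorphism
`φ : G' → G` and a `φ`-equivariant continuous map `f : X' → X`. Its component at `τ ∈ G'^tors` is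
the map `K^n_{Λ_G(φ τ)}(X^{φ τ}) → K^n_{Λ_G'(τ)}(X'^τ)` induced by `φ` and `f`. -/
def QEll.map (n : ℤ) (φ : G' →ₜ* G) (f : C(X', X))
    (hf : ∀ (γ : G') (x : X'), f (γ • x) = φ γ • f x) : QEll n G X →+ QEll n G' X' where
  toFun a := ⟨fun τ => KLam.map n φ f hf rfl
      (a.1 ⟨φ (τ : G'), φ.toMonoidHom.isOfFinOrder τ.2⟩), by
    intro h g g' hg
    have e : conjHom (φ h) (φ (g : G')) = φ (g' : G') := by
      rw [← hg]
      change φ h * φ g * (φ h)⁻¹ = φ (h * g * h⁻¹)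
      simp
    have key := a.2 (φ h) ⟨φ (g : G'), φ.toMonoidHom.isOfFinOrder g.2⟩
      ⟨φ (g' : G'), φ.toMonoidHom.isOfFinOrder g'.2⟩ e
    beta_reduce
    rw [← key, KLam.map_map n φ f hf (conjHom h) (translateMap X' h) (translateMap_smul X' h)
      (φ.comp (conjHom h)) (f.comp (translateMap X' h)) (fun γ x => by
        change f (translateMap X' h (γ • x)) = φ (conjHom h γ) • f (translateMap X' h x)
        rw [translateMap_smul, hf]) rfl rfl rfl hg (congrArg φ hg)]
    symm
    refine KLam.map_map n _ _ _ _ _ _ _ _ _ ?_ ?_ _ _ _ _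
    · ext γ
      change φ (h * γ * h⁻¹) = φ h * φ γ * (φ h)⁻¹
      simp
    · ext x
      exact hf h x⟩
  map_zero' := Subtype.ext (funext fun τ => map_zero _)
  map_add' a b := Subtype.ext (funext fun τ => map_add _ _ _)

end QEll

/-! ## Induced spaces and the change-of-group map -/

section Induced

variable {G : Type*} [Group G] (H : Subgroup G) (X : Type*) [MulAction H X]

/-- The equivalence relation `(g, x) ∼ (g * h⁻¹, h • x)`, `h ∈ H`, on `G × X`. -/
def inducedSetoid : Setoid (G × X) where
  r p q := ∃ h : H, q = (p.1 * (h : G)⁻¹, h • p.2)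
  iseqv :=
    { refl := fun p => ⟨1, by simp⟩
      symm := by
        rintro p q ⟨h, rfl⟩
        exact ⟨h⁻¹, by simp⟩
      trans := by
        rintro p q r ⟨h, rfl⟩ ⟨k, rfl⟩
        exact ⟨k * h, by simp [mul_assoc, mul_smul]⟩ }

/-- The induced `G`-space `G ×_H X`. -/
def Induced : Type _ := Quotient (inducedSetoid H X)

variable {X} in
/-- The point `[g, x]` of `G ×_H X`. -/
def Induced.mk (g : G) (x : X) : Induced H X := Quotient.mk (inducedSetoid H X) (g, x)

instance : MulAction G (Induced H X) where
  smul a := Quotient.map (sa := inducedSetoid H X) (sb := inducedSetoid H X)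
    (fun p => (a * p.1, p.2)) (by
      rintro p q ⟨h, rfl⟩
      exact ⟨h, by simp [mul_assoc]⟩)
  one_smul := by
    rintro ⟨p⟩
    exact congrArg (Quotient.mk (inducedSetoid H X)) (Prod.ext (one_mul p.1) rfl)
  mul_smul a b := by
    rintro ⟨p⟩
    exact congrArg (Quotient.mk (inducedSetoid H X)) (Prod.ext (mul_assoc a b p.1) rfl)

theorem Induced.smul_mk (a g : G) (x : X) : a • Induced.mk H g x = Induced.mk H (a * g) x := rfl

theorem Induced.mk_mul (g : G) (h : H) (x : X) :
    Induced.mk H (g * h) x = Induced.mk H g (h • x) :=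
  Quotient.sound (s := inducedSetoid H X) ⟨h, by simp⟩

variable [TopologicalSpace G] [TopologicalSpace X]

instance : TopologicalSpace (Induced H X) :=
  inferInstanceAs (TopologicalSpace (Quotient (inducedSetoid H X)))

theorem Induced.isOpenQuotientMap [IsTopologicalGroup G] [ContinuousSMul H X] :
    IsOpenQuotientMap (Quotient.mk (inducedSetoid H X) : G × X → Induced H X) where
  surjective := Quotient.mk_surjective
  continuous := continuous_quotient_mk'
  isOpenMap := by
    intro U hU
    change IsOpen (Quotient.mk (inducedSetoid H X) ⁻¹' _)
    have : Quotient.mk (inducedSetoid H X) ⁻¹' (Quotient.mk (inducedSetoid H X) '' U) =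
        ⋃ h : H, (fun p : G × X => (p.1 * (h : G)⁻¹, h • p.2)) ⁻¹' U := by
      ext p
      simp only [Set.mem_preimage, Set.mem_image, Set.mem_iUnion]
      constructor
      · rintro ⟨q, hq, hqp⟩
        obtain ⟨h, rfl⟩ := Quotient.exact hqp.symm
        exact ⟨h, hq⟩
      · rintro ⟨h, hq⟩
        exact ⟨_, hq, (Quotient.sound (s := inducedSetoid H X) ⟨h, rfl⟩).symm⟩
    rw [this]
    refine isOpen_iUnion fun h => hU.preimage ?_
    fun_prop

instance [IsTopologicalGroup G] [ContinuousSMul H X] : ContinuousSMul G (Induced H X) where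
  continuous_smul := by
    have h : IsOpenQuotientMap
        (Prod.map id (Quotient.mk (inducedSetoid H X)) : G × (G × X) → G × Induced H X) :=
      IsOpenQuotientMap.id.prodMap (Induced.isOpenQuotientMap H X)
    rw [h.isQuotientMap.continuous_iff]
    change Continuous fun p : G × (G × X) => Quotient.mk (inducedSetoid H X) (p.1 * p.2.1, p.2.2)
    exact continuous_quotient_mk'.comp (by fun_prop)

/-- The `H`-map `i : X → G ×_H X`, `x ↦ [e, x]`. -/
def Induced.incl : C(X, Induced H X) where
  toFun x := Induced.mk H 1 x
  continuous_toFun := continuous_quotient_mk'.comp (by fun_prop : Continuous fun x : X => ((1 : G), x))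

theorem Induced.incl_smul (h : H) (x : X) :
    Induced.incl H X (h • x) = h • Induced.incl H X x := by
  change Induced.mk H 1 (h • x) = (h : G) • Induced.mk H 1 x
  rw [Induced.smul_mk, ← Induced.mk_mul, mul_one, one_mul]

/-- The inclusion `H → G` as a continuous homomorphism. -/
def inclHom : H →ₜ* G where
  toMonoidHom := H.subtype
  continuous_toFun := continuous_subtype_val

/-- The change-of-group map `ρ^G_H : QEll^n_G(G ×_H X) → QEll^n_H(X)`: the restriction
`φ^* : QEll^n_G(G ×_H X) → QEll^n_H(G ×_H X)` along the inclusion `φ : H → G`, followed by the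
pullback `i^* : QEll^n_H(G ×_H X) → QEll^n_H(X)` along the `H`-map `i : x ↦ [e, x]`. -/
def changeOfGroup [IsTopologicalGroup G] [ContinuousSMul H X] (n : ℤ) :
    QEll n G (Induced H X) →+ QEll n H X :=
  (QEll.map n (ContinuousMonoidHom.id H) (Induced.incl H X) (Induced.incl_smul H X)).comp
    (QEll.map n (inclHom H) (ContinuousMap.id (Induced H X)) (fun _ _ => rfl))

end Induced

end

/-!
Fix `g : G` of finite order. A point `[k, x]` of `G ×_H X` is fixed by `g` exactly if
`τ = k⁻¹ * g * k` lies in `H` and `x ∈ X^τ`. Hence `(G ×_H X)^g` is, as a `Λ_G(g)`-space, the disjoint union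
over the double cosets `C_G(g) k H` with `k⁻¹ * g * k ∈ H` of the spaces induced from the
`Λ_H(τ)`-spaces `X^τ` along the injective homomorphisms `[h, t] ↦ [k * h * k⁻¹, t]`. So
`K^n_{Λ_G(g)}((G ×_H X)^g)` should be the product of the groups `K^n_{Λ_H(τ)}(X^τ)`
(`Rigid.bijective_components`). A `G`-invariant family of classes on the left then corresponds to
an `H`-invariant family of classes on the right (`Rigid.bijective_changeOfGroup`), as inner
automorphisms act trivially on K-theory (`K0.map_inner`). Three facts have to be supplied.

The pieces are open, and there are finitely many of them. Both follow from rigidity: an element of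
`H` of order dividing `n` that is close to `σ`, where `σ ^ n = 1`, is conjugate to `σ` by an
element of `H` close to `1` (`GroupChart.exists_nhds_conj_nhds`). As `H` is only a closed subgroup,
and the exponential map is not at hand, this is proved by an extremal argument in a chart of `G`.
Let `v k * σ → σ` be a sequence of counterexamples, each closest to `σ` in its class, and pass to a
subsequence for which the coordinates of `v k` have a limiting direction. Suitable powers of later
`v m` realize fixed fractions of the coordinates of `v k`, to first order, and a product of powers
of their conjugates by `σ ^ j`, as in the averaging proof of Hilbert 90, conjugates `v k * σ` to an
element still closer to `σ`.

Every representation of `Λ_H(τ)` is absorbed by the restriction of a representation of `Λ_G(g)`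
(`hasAbsorption_of_injective`). Averaging rank one operators over a compact group gives enough
intertwining operators into the regular representation of the larger group; these combine into an
injective operator to a multiple of it, whose polar part is an equivariant isometry. An Eilenberg
swindle does the rest.

K-theory is additive over induced clopen pieces, for families over arbitrary spaces
(`KGroup.bijective_restrictions`). By absorption, a family on `X'`, with a degenerate summand
added, lives on representations of the larger group, so it extends to the induced space by
equivariance and by a unitary family elsewhere. That the class of the extension is well defined,
and that the sum of the extended restrictions is the given class, rests on one construction
(`FredholmFamily.exists_mk_add_mk_adj`): if `C` and `C'` have the same restriction up to degenerate
families, then the rotation homotopy of `c ⊕ c†` to a unitary family, glued in over the induced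
space, turns `C ⊕ C'†` into a family that is unitary there. The defects of the glued families are
norm continuous because they are compact and self-adjoint (`HilbRep.continuous_conj`).
-/

noncomputable section

/-! ### Block diagonal operators -/

section Blocks

variable {A B A' B' : Type*} [NormedAddCommGroup A] [InnerProductSpace ℂ A]
  [NormedAddCommGroup B] [InnerProductSpace ℂ B]
  [NormedAddCommGroup A'] [InnerProductSpace ℂ A']
  [NormedAddCommGroup B'] [InnerProductSpace ℂ B']

/-- The block diagonal operator `S ⊕ T` between orthogonal direct sums. -/
def blockDiag (S : A →L[ℂ] A') (T : B →L[ℂ] B') :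
    WithLp 2 (A × B) →L[ℂ] WithLp 2 (A' × B') :=
  (WithLp.prodContinuousLinearEquiv 2 ℂ A' B').symm.toContinuousLinearMap ∘L
    (S.prodMap T) ∘L (WithLp.prodContinuousLinearEquiv 2 ℂ A B).toContinuousLinearMap

theorem IsCompactOperator.blockDiag {S : A →L[ℂ] A'} {T : B →L[ℂ] B'}
    (hS : IsCompactOperator S) (hT : IsCompactOperator T) :
    IsCompactOperator (blockDiag S T) := by
  have h1 := (hS.comp_clm (WithLp.fstL 2 ℂ A B)).clm_comp
    ((WithLp.prodContinuousLinearEquiv 2 ℂ A' B').symm.toContinuousLinearMap ∘L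
      ContinuousLinearMap.inl ℂ A' B')
  have h2 := (hT.comp_clm (WithLp.sndL 2 ℂ A B)).clm_comp
    ((WithLp.prodContinuousLinearEquiv 2 ℂ A' B').symm.toContinuousLinearMap ∘L
      ContinuousLinearMap.inr ℂ A' B')
  have e : ⇑(_root_.blockDiag S T) =
      ((WithLp.prodContinuousLinearEquiv 2 ℂ A' B').symm.toContinuousLinearMap ∘L
        ContinuousLinearMap.inl ℂ A' B') ∘ S ∘ (WithLp.fstL 2 ℂ A B) +
      ((WithLp.prodContinuousLinearEquiv 2 ℂ A' B').symm.toContinuousLinearMap ∘L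
        ContinuousLinearMap.inr ℂ A' B') ∘ T ∘ (WithLp.sndL 2 ℂ A B) :=
    funext fun v => congrArg (WithLp.toLp 2) (Prod.ext (add_zero _).symm (zero_add _).symm)
  rw [e]
  exact h1.add h2

theorem Continuous.blockDiag {Z : Type*} [TopologicalSpace Z] {S : Z → A →L[ℂ] A'}
    {T : Z → B →L[ℂ] B'} (hS : Continuous S) (hT : Continuous T) :
    Continuous fun z => blockDiag (S z) (T z) := by
  have h := (ContinuousLinearMap.prodMapL ℂ A A' B B').continuous.comp (hS.prodMk hT)
  exact (continuous_const.clm_comp (h.clm_comp continuous_const))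

/-- The isometry `(A ⊕ A') ⊕ (B ⊕ B') ≃ (A ⊕ B) ⊕ (A' ⊕ B')`. -/
def prodShuffle : WithLp 2 (WithLp 2 (A × A') × WithLp 2 (B × B')) ≃ₗᵢ[ℂ]
    WithLp 2 (WithLp 2 (A × B) × WithLp 2 (A' × B')) where
  toFun v := WithLp.toLp 2 (WithLp.toLp 2 (v.fst.fst, v.snd.fst),
    WithLp.toLp 2 (v.fst.snd, v.snd.snd))
  invFun v := WithLp.toLp 2 (WithLp.toLp 2 (v.fst.fst, v.snd.fst),
    WithLp.toLp 2 (v.fst.snd, v.snd.snd))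
  left_inv _ := rfl
  right_inv _ := rfl
  map_add' _ _ := rfl
  map_smul' _ _ := rfl
  norm_map' v := by
    rw [← sq_eq_sq₀ (norm_nonneg _) (norm_nonneg _)]
    simp only [WithLp.prod_norm_sq_eq_of_L2]
    change ‖v.fst.fst‖ ^ 2 + ‖v.snd.fst‖ ^ 2 + (‖v.fst.snd‖ ^ 2 + ‖v.snd.snd‖ ^ 2) = _
    ring

end Blocks

/-! ### Operations on Fredholm families -/

section Ops

variable {Γ : Type*} [Group Γ] [TopologicalSpace Γ] {X : Type*} [TopologicalSpace X]
  [MulAction Γ X] {Γ' : Type*} [Group Γ'] [TopologicalSpace Γ'] {X' : Type*} [TopologicalSpace X']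
  [MulAction Γ' X']

theorem HilbRep.ρ_mul (E : HilbRep Γ) (a b : Γ) (v : E.V) : E.ρ (a * b) v = E.ρ a (E.ρ b v) := by
  rw [map_mul]; rfl

theorem HilbRep.ρ_one (E : HilbRep Γ) (v : E.V) : E.ρ 1 v = v := by
  rw [map_one]; rfl

theorem HilbRep.ρ_inv_apply_self (E : HilbRep Γ) (a : Γ) (v : E.V) : E.ρ a⁻¹ (E.ρ a v) = v := by
  rw [← E.ρ_mul, inv_mul_cancel, E.ρ_one]

theorem HilbRep.ρ_apply_inv_self (E : HilbRep Γ) (a : Γ) (v : E.V) : E.ρ a (E.ρ a⁻¹ v) = v := by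
  rw [← E.ρ_mul, mul_inv_cancel, E.ρ_one]

theorem HilbRep.inner_ρ_left (E : HilbRep Γ) (a : Γ) (v w : E.V) :
    ⟪E.ρ a v, w⟫_ℂ = ⟪v, E.ρ a⁻¹ w⟫_ℂ := by
  rw [← (E.ρ a).inner_map_map v, E.ρ_apply_inv_self]

/-- The orthogonal direct sum of two representations. -/
def HilbRep.dsum (E E' : HilbRep Γ) : HilbRep Γ where
  V := WithLp 2 (E.V × E'.V)
  separable := (WithLp.homeomorphProd 2 E.V E'.V).symm.surjective.denseRange.separableSpace
    (WithLp.homeomorphProd 2 E.V E'.V).symm.continuous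
  ρ :=
    { toFun := fun γ => LinearIsometryEquiv.withLpProdCongr 2 (E.ρ γ) (E'.ρ γ)
      map_one' := by
        ext v
        exact congrArg (WithLp.toLp 2) (Prod.ext (E.ρ_one _) (E'.ρ_one _))
      map_mul' := fun a b => by
        ext v
        exact congrArg (WithLp.toLp 2) (Prod.ext (E.ρ_mul _ _ _) (E'.ρ_mul _ _ _)) }
  continuous_apply v := (WithLp.prod_continuous_toLp 2 _ _).comp
    ((E.continuous_apply v.fst).prodMk (E'.continuous_apply v.snd))

/-- An essentially unitary family given together with its adjoint family `Fs` and with the defects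
`L = Fs * F - 1` and `R = F * Fs - 1`. -/
def FredholmFamily.ofAdjoint (E₀ E₁ : HilbRep Γ) (F : X → E₀.V →L[ℂ] E₁.V)
    (Fs : X → E₁.V →L[ℂ] E₀.V) (L : X → E₀.V →L[ℂ] E₀.V) (R : X → E₁.V →L[ℂ] E₁.V)
    (hadj : ∀ x v w, ⟪F x v, w⟫_ℂ = ⟪v, Fs x w⟫_ℂ)
    (hF : ∀ v, Continuous fun x => F x v) (hFs : ∀ w, Continuous fun x => Fs x w)
    (hL : ∀ x v, Fs x (F x v) = v + L x v) (hR : ∀ x w, F x (Fs x w) = w + R x w)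
    (hLc : ∀ x, IsCompactOperator (L x)) (hRc : ∀ x, IsCompactOperator (R x))
    (hLn : Continuous L) (hRn : Continuous R)
    (hequi : ∀ (γ : Γ) (x : X) (v : E₀.V), F (γ • x) (E₀.ρ γ v) = E₁.ρ γ (F x v)) :
    FredholmFamily Γ X :=
  have e : ∀ x, (F x).adjoint = Fs x := fun x =>
    ((ContinuousLinearMap.eq_adjoint_iff _ _).2 fun w v => by
      rw [← inner_conj_symm, ← hadj, inner_conj_symm]).symm
  have eL : ∀ x, (F x).adjoint ∘L F x - ContinuousLinearMap.id ℂ E₀.V = L x := fun x => by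
    ext v; simp [e, hL]
  have eR : ∀ x, F x ∘L (F x).adjoint - ContinuousLinearMap.id ℂ E₁.V = R x := fun x => by
    ext v; simp [e, hR]
  { E₀ := E₀
    E₁ := E₁
    F := F
    continuous_apply := hF
    continuous_adjoint_apply := by simpa only [e] using hFs
    isCompact_left := by simpa only [eL] using hLc
    isCompact_right := by simpa only [eR] using hRc
    continuous_left := by simpa only [eL] using hLn
    continuous_right := by simpa only [eR] using hRn
    equivariant := hequi }

/-- The defect `F† * F - 1`. -/
def FredholmFamily.defectLeft (c : FredholmFamily Γ X) (x : X) : c.E₀.V →L[ℂ] c.E₀.V :=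
  (c.F x).adjoint ∘L c.F x - ContinuousLinearMap.id ℂ c.E₀.V

/-- The defect `F * F† - 1`. -/
def FredholmFamily.defectRight (c : FredholmFamily Γ X) (x : X) : c.E₁.V →L[ℂ] c.E₁.V :=
  c.F x ∘L (c.F x).adjoint - ContinuousLinearMap.id ℂ c.E₁.V

theorem FredholmFamily.adjoint_apply_apply (c : FredholmFamily Γ X) (x : X) (v : c.E₀.V) :
    (c.F x).adjoint (c.F x v) = v + c.defectLeft x v := by
  simp [defectLeft]

theorem FredholmFamily.apply_adjoint_apply (c : FredholmFamily Γ X) (x : X) (v : c.E₁.V) :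
    c.F x ((c.F x).adjoint v) = v + c.defectRight x v := by
  simp [defectRight]

/-- The operator of the family at the point `x` is unitary. -/
def FredholmFamily.UnitaryAt (c : FredholmFamily Γ X) (x : X) : Prop :=
  (∀ v, (c.F x).adjoint (c.F x v) = v) ∧ ∀ w, c.F x ((c.F x).adjoint w) = w

theorem FredholmFamily.isDegenerate_iff (c : FredholmFamily Γ X) :
    c.IsDegenerate ↔ ∀ x, c.UnitaryAt x := by
  simp only [IsDegenerate, UnitaryAt, ContinuousLinearMap.ext_iff]
  rfl

/-- Unitarity may be tested with any candidate for the adjoint. -/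
theorem FredholmFamily.unitaryAt_of_inverse (c : FredholmFamily Γ X) (x : X)
    (S : c.E₁.V → c.E₀.V) (hadj : ∀ v w, ⟪c.F x v, w⟫_ℂ = ⟪v, S w⟫_ℂ)
    (h₁ : ∀ v, S (c.F x v) = v) (h₂ : ∀ w, c.F x (S w) = w) : c.UnitaryAt x := by
  have e : ∀ w, (c.F x).adjoint w = S w := fun w => ext_inner_left ℂ fun v => by
    rw [ContinuousLinearMap.adjoint_inner_right, hadj]
  exact ⟨fun v => by rw [e, h₁], fun w => by rw [e, h₂]⟩

theorem FredholmFamily.adjoint_equivariant (c : FredholmFamily Γ X) (γ : Γ) (x : X) (w : c.E₁.V) :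
    (c.F (γ • x)).adjoint (c.E₁.ρ γ w) = c.E₀.ρ γ ((c.F x).adjoint w) := by
  refine ext_inner_left ℂ fun v => ?_
  rw [ContinuousLinearMap.adjoint_inner_right, ← inner_conj_symm, c.E₁.inner_ρ_left,
    inner_conj_symm]
  have h := c.equivariant γ⁻¹ (γ • x) v
  rw [inv_smul_smul] at h
  rw [← h, ← inner_conj_symm v, c.E₀.inner_ρ_left, inner_conj_symm,
    ContinuousLinearMap.adjoint_inner_right]

/-- The family of adjoint operators. It represents the negative of the class of the family. -/
def FredholmFamily.adj (c : FredholmFamily Γ X) : FredholmFamily Γ X :=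
  .ofAdjoint c.E₁ c.E₀ (fun x => (c.F x).adjoint) c.F c.defectRight c.defectLeft
    (fun x v w => by rw [ContinuousLinearMap.adjoint_inner_left])
    c.continuous_adjoint_apply c.continuous_apply
    c.apply_adjoint_apply c.adjoint_apply_apply
    c.isCompact_right c.isCompact_left c.continuous_right c.continuous_left
    c.adjoint_equivariant

/-- The orthogonal direct sum of two families. -/
def FredholmFamily.dsum (a b : FredholmFamily Γ X) : FredholmFamily Γ X :=
  .ofAdjoint (a.E₀.dsum b.E₀) (a.E₁.dsum b.E₁) (fun x => blockDiag (a.F x) (b.F x))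
    (fun x => blockDiag (a.F x).adjoint (b.F x).adjoint)
    (fun x => blockDiag (a.defectLeft x) (b.defectLeft x))
    (fun x => blockDiag (a.defectRight x) (b.defectRight x))
    (fun x v w => by
      refine (WithLp.prod_inner_apply (𝕜 := ℂ) _ _).trans
        (Eq.trans ?_ (WithLp.prod_inner_apply (𝕜 := ℂ) _ _).symm)
      exact congrArg₂ _ (ContinuousLinearMap.adjoint_inner_right _ _ _).symm
        (ContinuousLinearMap.adjoint_inner_right _ _ _).symm)
    (fun v => (WithLp.prod_continuous_toLp 2 _ _).comp
      ((a.continuous_apply _).prodMk (b.continuous_apply _)))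
    (fun v => (WithLp.prod_continuous_toLp 2 _ _).comp
      ((a.continuous_adjoint_apply _).prodMk (b.continuous_adjoint_apply _)))
    (fun x v => congrArg (WithLp.toLp 2)
      (Prod.ext (a.adjoint_apply_apply x _) (b.adjoint_apply_apply x _)))
    (fun x v => congrArg (WithLp.toLp 2)
      (Prod.ext (a.apply_adjoint_apply x _) (b.apply_adjoint_apply x _)))
    (fun x => (a.isCompact_left x).blockDiag (b.isCompact_left x))
    (fun x => (a.isCompact_right x).blockDiag (b.isCompact_right x))
    (a.continuous_left.blockDiag b.continuous_left)
    (a.continuous_right.blockDiag b.continuous_right)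
    (fun γ x v => congrArg (WithLp.toLp 2)
      (Prod.ext (a.equivariant γ x _) (b.equivariant γ x _)))

theorem FredholmFamily.isDirectSum_dsum (a b : FredholmFamily Γ X) : a.IsDirectSum b (a.dsum b) :=
  ⟨LinearIsometryEquiv.refl ℂ _, LinearIsometryEquiv.refl ℂ _, fun _ _ _ => rfl, fun _ _ _ => rfl,
    fun _ _ _ => rfl⟩

theorem FredholmFamily.IsDirectSum.dsum {a b c a' b' c' : FredholmFamily Γ X}
    (h : a.IsDirectSum b c) (h' : a'.IsDirectSum b' c') :
    (a.dsum a').IsDirectSum (b.dsum b') (c.dsum c') := by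
  obtain ⟨u₀, u₁, e₀, e₁, e⟩ := h
  obtain ⟨u₀', u₁', e₀', e₁', e'⟩ := h'
  refine ⟨prodShuffle.trans (LinearIsometryEquiv.withLpProdCongr 2 u₀ u₀'),
    prodShuffle.trans (LinearIsometryEquiv.withLpProdCongr 2 u₁ u₁'), ?_, ?_, ?_⟩
  · exact fun γ v w => congrArg (WithLp.toLp 2) (Prod.ext (e₀ γ v.fst w.fst) (e₀' γ v.snd w.snd))
  · exact fun γ v w => congrArg (WithLp.toLp 2) (Prod.ext (e₁ γ v.fst w.fst) (e₁' γ v.snd w.snd))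
  · exact fun x v w => congrArg (WithLp.toLp 2) (Prod.ext (e x v.fst w.fst) (e' x v.snd w.snd))

/-- Direct sums of two families are unique up to isomorphism. -/
theorem FredholmFamily.IsDirectSum.congr_left {a b c d e : FredholmFamily Γ X}
    (h : a.IsDirectSum b c) (h' : (a.dsum b).IsDirectSum d e) : c.IsDirectSum d e := by
  obtain ⟨u₀, u₁, e₀, e₁, eF⟩ := h
  obtain ⟨v₀, v₁, e₀', e₁', eF'⟩ := h'
  have s₀ : ∀ γ z, u₀.symm (c.E₀.ρ γ z) = (a.dsum b).E₀.ρ γ (u₀.symm z) := fun γ z =>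
    u₀.injective (by
      rw [u₀.apply_symm_apply]
      exact (congrArg (c.E₀.ρ γ) (u₀.apply_symm_apply z).symm).trans (e₀ γ _ _).symm)
  have s₁ : ∀ γ z, u₁.symm (c.E₁.ρ γ z) = (a.dsum b).E₁.ρ γ (u₁.symm z) := fun γ z =>
    u₁.injective (by
      rw [u₁.apply_symm_apply]
      exact (congrArg (c.E₁.ρ γ) (u₁.apply_symm_apply z).symm).trans (e₁ γ _ _).symm)
  have sF : ∀ x z, u₁.symm (c.F x z) = (a.dsum b).F x (u₀.symm z) := fun x z =>
    u₁.injective (by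
      rw [u₁.apply_symm_apply]
      exact (congrArg (c.F x) (u₀.apply_symm_apply z).symm).trans (eF x _ _))
  refine ⟨(LinearIsometryEquiv.withLpProdCongr 2 u₀.symm (.refl ℂ _)).trans v₀,
    (LinearIsometryEquiv.withLpProdCongr 2 u₁.symm (.refl ℂ _)).trans v₁, ?_, ?_, ?_⟩
  · intro γ v w
    change v₀ (WithLp.toLp 2 (u₀.symm (c.E₀.ρ γ v), d.E₀.ρ γ w)) = _
    rw [s₀]
    exact e₀' γ _ w
  · intro γ v w
    change v₁ (WithLp.toLp 2 (u₁.symm (c.E₁.ρ γ v), d.E₁.ρ γ w)) = _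
    rw [s₁]
    exact e₁' γ _ w
  · intro γ v w
    change _ = v₁ (WithLp.toLp 2 (u₁.symm (c.F γ v), d.F γ w))
    rw [sF]
    exact eF' γ _ w

theorem FredholmFamily.IsDirectSum.adj {a b c : FredholmFamily Γ X}
    (h : a.IsDirectSum b c) : a.adj.IsDirectSum b.adj c.adj := by
  obtain ⟨u₀, u₁, e₀, e₁, e⟩ := h
  have key : ∀ x (v : a.E₁.V) (w : b.E₁.V), (c.F x).adjoint (u₁ (WithLp.toLp 2 (v, w))) =
      u₀ (WithLp.toLp 2 ((a.F x).adjoint v, (b.F x).adjoint w)) := by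
    intro x v w
    refine ext_inner_left ℂ fun z => ?_
    obtain ⟨⟨z₁, z₂⟩, rfl⟩ := u₀.surjective z
    rw [ContinuousLinearMap.adjoint_inner_right, e, u₁.inner_map_map, u₀.inner_map_map]
    simp [WithLp.prod_inner_apply, ContinuousLinearMap.adjoint_inner_right]
  exact ⟨u₁, u₀, e₁, e₀, key⟩

theorem FredholmFamily.IsDirectSum.pullback {a b c : FredholmFamily Γ X} (h : a.IsDirectSum b c)
    (φ : Γ' →ₜ* Γ) (f : C(X', X)) (hf : ∀ (γ : Γ') (x : X'), f (γ • x) = φ γ • f x) :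
    (a.pullback φ f hf).IsDirectSum (b.pullback φ f hf) (c.pullback φ f hf) := by
  obtain ⟨u₀, u₁, e₀, e₁, e⟩ := h
  exact ⟨u₀, u₁, fun γ => e₀ (φ γ), fun γ => e₁ (φ γ), fun x => e (f x)⟩

theorem FredholmFamily.UnitaryAt.dsum {a b : FredholmFamily Γ X} {x : X} (ha : a.UnitaryAt x)
    (hb : b.UnitaryAt x) : (a.dsum b).UnitaryAt x := by
  refine unitaryAt_of_inverse _ x (blockDiag (a.F x).adjoint (b.F x).adjoint) ?_ ?_ ?_
  · intro v w
    refine (WithLp.prod_inner_apply (𝕜 := ℂ) _ _).trans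
        (Eq.trans ?_ (WithLp.prod_inner_apply (𝕜 := ℂ) _ _).symm)
    exact congrArg₂ _ (ContinuousLinearMap.adjoint_inner_right _ _ _).symm
        (ContinuousLinearMap.adjoint_inner_right _ _ _).symm
  · exact fun v => congrArg (WithLp.toLp 2) (Prod.ext (ha.1 _) (hb.1 _))
  · exact fun v => congrArg (WithLp.toLp 2) (Prod.ext (ha.2 _) (hb.2 _))

theorem FredholmFamily.UnitaryAt.adj {a : FredholmFamily Γ X} {x : X} (ha : a.UnitaryAt x) :
    a.adj.UnitaryAt x :=
  unitaryAt_of_inverse a.adj x (a.F x)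
    (fun v w => ContinuousLinearMap.adjoint_inner_left (a.F x) w v) ha.2 ha.1

theorem FredholmFamily.UnitaryAt.of_isDirectSum {a b c : FredholmFamily Γ X}
    (h : a.IsDirectSum b c) {x : X} (ha : a.UnitaryAt x) (hb : b.UnitaryAt x) : c.UnitaryAt x := by
  have h' := h.adj
  obtain ⟨u₀, u₁, e₀, e₁, e⟩ := h
  refine unitaryAt_of_inverse _ x
    (fun w => u₀ (WithLp.toLp 2 ((a.F x).adjoint (u₁.symm w).fst, (b.F x).adjoint (u₁.symm w).snd)))
    ?_ ?_ ?_
  · intro v w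
    obtain ⟨⟨v₁, v₂⟩, rfl⟩ := u₀.surjective v
    obtain ⟨⟨w₁, w₂⟩, rfl⟩ := u₁.surjective w
    rw [e, u₁.inner_map_map, u₀.inner_map_map]
    simp [WithLp.prod_inner_apply, ContinuousLinearMap.adjoint_inner_right]
  · intro v
    obtain ⟨⟨v₁, v₂⟩, rfl⟩ := u₀.surjective v
    rw [e]
    simp [ha.1, hb.1]
  · intro w
    obtain ⟨⟨w₁, w₂⟩, rfl⟩ := u₁.surjective w
    rw [e]
    simp [ha.2, hb.2]

/-- Unitarity propagates along orbits. -/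
theorem FredholmFamily.UnitaryAt.smul {a : FredholmFamily Γ X} {x : X} (ha : a.UnitaryAt x)
    (γ : Γ) : a.UnitaryAt (γ • x) := by
  constructor
  · intro v
    obtain ⟨v, rfl⟩ := (a.E₀.ρ γ).surjective v
    rw [a.equivariant, a.adjoint_equivariant, ha.1]
  · intro v
    obtain ⟨v, rfl⟩ := (a.E₁.ρ γ).surjective v
    rw [a.adjoint_equivariant, a.equivariant, ha.2]

theorem FredholmFamily.IsDegenerate.pullback {a : FredholmFamily Γ X} (h : a.IsDegenerate)
    (φ : Γ' →ₜ* Γ) (f : C(X', X)) (hf : ∀ (γ : Γ') (x : X'), f (γ • x) = φ γ • f x) :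
    (a.pullback φ f hf).IsDegenerate := fun x => h (f x)

/-- The identity operator of a representation as a constant family. -/
def FredholmFamily.const (X : Type*) [TopologicalSpace X] [MulAction Γ X] (U : HilbRep Γ) :
    FredholmFamily Γ X :=
  .ofAdjoint U U (fun _ => ContinuousLinearMap.id ℂ _) (fun _ => ContinuousLinearMap.id ℂ _)
    (fun _ => 0) (fun _ => 0) (fun _ _ _ => rfl) (fun _ => continuous_const)
    (fun _ => continuous_const) (fun _ v => (add_zero v).symm) (fun _ v => (add_zero v).symm)
    (fun _ => isCompactOperator_zero) (fun _ => isCompactOperator_zero) continuous_const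
    continuous_const (fun _ _ _ => rfl)

theorem FredholmFamily.const_unitaryAt (U : HilbRep Γ) (x : X) : (const X U).UnitaryAt x :=
  unitaryAt_of_inverse _ x id (fun _ _ => rfl) (fun _ => rfl) (fun _ => rfl)

/-- The projection `(x, y) ↦ x`. -/
def TrivProd.proj (X Y : Type*) [TopologicalSpace X] [TopologicalSpace Y] :
    C(TrivProd X Y, X) where
  toFun p := p.1
  continuous_toFun := (continuous_fst : Continuous (Prod.fst : X × Y → X))

/-- The quarter turn `(v, w) ↦ (-w, v)`. -/
def quarterTurn (A B : Type*) [NormedAddCommGroup A] [InnerProductSpace ℂ A]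
    [NormedAddCommGroup B] [InnerProductSpace ℂ B] : WithLp 2 (A × B) →L[ℂ] WithLp 2 (B × A) :=
  (WithLp.prodContinuousLinearEquiv 2 ℂ B A).symm.toContinuousLinearMap ∘L
    ((-WithLp.sndL 2 ℂ A B).prod (WithLp.fstL 2 ℂ A B))

/-- The angle `π t / 2`, as a function on the unit interval. -/
def angle (t : unitInterval) : ℝ := Real.pi / 2 * t

theorem continuous_angle : Continuous angle := by unfold angle; fun_prop

/-- The rotation homotopy from `F ⊕ F†` to a family of unitary operators. At angle `θ` it is the
matrix with rows `(cos θ • F, - sin θ)` and `(sin θ, cos θ • F†)`. -/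
def FredholmFamily.rot (c : FredholmFamily Γ X) : FredholmFamily Γ (TrivProd X unitInterval) :=
  have hcos : Continuous fun p : TrivProd X unitInterval => (Real.cos (angle p.2) : ℂ) :=
    (Complex.continuous_ofReal.comp (Real.continuous_cos.comp continuous_angle)).comp
      (continuous_snd : Continuous (Prod.snd : X × unitInterval → _))
  have hsin : Continuous fun p : TrivProd X unitInterval => (Real.sin (angle p.2) : ℂ) :=
    (Complex.continuous_ofReal.comp (Real.continuous_sin.comp continuous_angle)).comp
      (continuous_snd : Continuous (Prod.snd : X × unitInterval → _))
  have hproj : Continuous fun p : TrivProd X unitInterval => p.1 :=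
    (TrivProd.proj X unitInterval).continuous
  have hsq : ∀ t, (Real.cos t : ℂ) * Real.cos t + (Real.sin t : ℂ) * Real.sin t = 1 := fun t => by
    norm_cast; nlinarith [Real.cos_sq_add_sin_sq t]
  .ofAdjoint (c.E₀.dsum c.E₁) (c.E₁.dsum c.E₀)
    (fun p => (Real.cos (angle p.2) : ℂ) • blockDiag (c.F p.1) (c.F p.1).adjoint +
      (Real.sin (angle p.2) : ℂ) • quarterTurn c.E₀.V c.E₁.V)
    (fun p => (Real.cos (angle p.2) : ℂ) • blockDiag (c.F p.1).adjoint (c.F p.1) -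
      (Real.sin (angle p.2) : ℂ) • quarterTurn c.E₁.V c.E₀.V)
    (fun p => ((Real.cos (angle p.2) : ℂ) * Real.cos (angle p.2)) •
      blockDiag (c.defectLeft p.1) (c.defectRight p.1))
    (fun p => ((Real.cos (angle p.2) : ℂ) * Real.cos (angle p.2)) •
      blockDiag (c.defectRight p.1) (c.defectLeft p.1))
    (fun p v w => by
      refine (WithLp.prod_inner_apply (𝕜 := ℂ) _ _).trans
        (Eq.trans ?_ (WithLp.prod_inner_apply (𝕜 := ℂ) _ _).symm)
      change ⟪(Real.cos (angle p.2) : ℂ) • c.F p.1 v.fst + (Real.sin (angle p.2) : ℂ) • -v.snd,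
          w.fst⟫_ℂ + ⟪(Real.cos (angle p.2) : ℂ) • (c.F p.1).adjoint v.snd +
            (Real.sin (angle p.2) : ℂ) • v.fst, w.snd⟫_ℂ =
        ⟪v.fst, (Real.cos (angle p.2) : ℂ) • (c.F p.1).adjoint w.fst -
          (Real.sin (angle p.2) : ℂ) • -w.snd⟫_ℂ +
        ⟪v.snd, (Real.cos (angle p.2) : ℂ) • c.F p.1 w.snd -
          (Real.sin (angle p.2) : ℂ) • w.fst⟫_ℂ
      simp only [inner_add_left, inner_sub_right, inner_smul_left, inner_smul_right,
        Complex.conj_ofReal, inner_neg_left, inner_neg_right,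
        ContinuousLinearMap.adjoint_inner_right, ContinuousLinearMap.adjoint_inner_left]
      ring)
    (fun v => (hcos.smul ((WithLp.prod_continuous_toLp 2 _ _).comp
      (((c.continuous_apply _).comp hproj).prodMk
        ((c.continuous_adjoint_apply _).comp hproj)))).add (hsin.smul continuous_const))
    (fun v => (hcos.smul ((WithLp.prod_continuous_toLp 2 _ _).comp
      (((c.continuous_adjoint_apply _).comp hproj).prodMk
        ((c.continuous_apply _).comp hproj)))).sub (hsin.smul continuous_const))
    (fun p v => by
      refine congrArg (WithLp.toLp 2) (Prod.ext ?_ ?_)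
      · change (Real.cos (angle p.2) : ℂ) • (c.F p.1).adjoint ((Real.cos (angle p.2) : ℂ) •
            c.F p.1 v.fst + (Real.sin (angle p.2) : ℂ) • -v.snd) - (Real.sin (angle p.2) : ℂ) •
            -((Real.cos (angle p.2) : ℂ) • (c.F p.1).adjoint v.snd +
            (Real.sin (angle p.2) : ℂ) • v.fst) =
          v.fst + ((Real.cos (angle p.2) : ℂ) * Real.cos (angle p.2)) • c.defectLeft p.1 v.fst
        simp only [map_add, map_smul, c.adjoint_apply_apply, map_neg]
        linear_combination (norm := module) (hsq (angle p.2)) • v.fst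
      · change (Real.cos (angle p.2) : ℂ) • c.F p.1 ((Real.cos (angle p.2) : ℂ) •
            (c.F p.1).adjoint v.snd + (Real.sin (angle p.2) : ℂ) • v.fst) -
            (Real.sin (angle p.2) : ℂ) •
            ((Real.cos (angle p.2) : ℂ) • c.F p.1 v.fst +
            (Real.sin (angle p.2) : ℂ) • -v.snd) =
          v.snd + ((Real.cos (angle p.2) : ℂ) * Real.cos (angle p.2)) • c.defectRight p.1 v.snd
        simp only [map_add, map_smul, c.apply_adjoint_apply]
        linear_combination (norm := module) (hsq (angle p.2)) • v.snd)
    (fun p v => by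
      refine congrArg (WithLp.toLp 2) (Prod.ext ?_ ?_)
      · change (Real.cos (angle p.2) : ℂ) • c.F p.1 ((Real.cos (angle p.2) : ℂ) •
            (c.F p.1).adjoint v.fst - (Real.sin (angle p.2) : ℂ) • -v.snd) +
            (Real.sin (angle p.2) : ℂ) •
            -((Real.cos (angle p.2) : ℂ) • c.F p.1 v.snd -
            (Real.sin (angle p.2) : ℂ) • v.fst) =
          v.fst + ((Real.cos (angle p.2) : ℂ) * Real.cos (angle p.2)) • c.defectRight p.1 v.fst
        simp only [map_sub, map_smul, c.apply_adjoint_apply, map_neg]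
        linear_combination (norm := module) (hsq (angle p.2)) • v.fst
      · change (Real.cos (angle p.2) : ℂ) • (c.F p.1).adjoint ((Real.cos (angle p.2) : ℂ) •
            c.F p.1 v.snd - (Real.sin (angle p.2) : ℂ) • v.fst) + (Real.sin (angle p.2) : ℂ) •
            ((Real.cos (angle p.2) : ℂ) • (c.F p.1).adjoint v.fst -
            (Real.sin (angle p.2) : ℂ) • -v.snd) =
          v.snd + ((Real.cos (angle p.2) : ℂ) * Real.cos (angle p.2)) • c.defectLeft p.1 v.snd
        simp only [map_sub, map_smul, c.adjoint_apply_apply]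
        linear_combination (norm := module) (hsq (angle p.2)) • v.snd)
    (fun p => (IsCompactOperator.blockDiag (c.isCompact_left p.1) (c.isCompact_right p.1)).smul ((Real.cos (angle p.2) : ℂ) * Real.cos (angle p.2)))
    (fun p => (IsCompactOperator.blockDiag (c.isCompact_right p.1) (c.isCompact_left p.1)).smul ((Real.cos (angle p.2) : ℂ) * Real.cos (angle p.2)))
    ((hcos.mul hcos).smul
      ((c.continuous_left.comp hproj).blockDiag (c.continuous_right.comp hproj)))
    ((hcos.mul hcos).smul
      ((c.continuous_right.comp hproj).blockDiag (c.continuous_left.comp hproj)))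
    (fun γ p v => by
      refine congrArg (WithLp.toLp 2) (Prod.ext ?_ ?_)
      · change (Real.cos (angle p.2) : ℂ) • c.F (γ • p.1) (c.E₀.ρ γ v.fst) +
            (Real.sin (angle p.2) : ℂ) • -(c.E₁.ρ γ v.snd) =
          c.E₁.ρ γ ((Real.cos (angle p.2) : ℂ) • c.F p.1 v.fst +
            (Real.sin (angle p.2) : ℂ) • -v.snd)
        simp only [map_add, map_smul, map_neg, c.equivariant]
      · change (Real.cos (angle p.2) : ℂ) • (c.F (γ • p.1)).adjoint (c.E₁.ρ γ v.snd) +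
            (Real.sin (angle p.2) : ℂ) • (c.E₀.ρ γ v.fst) =
          c.E₀.ρ γ ((Real.cos (angle p.2) : ℂ) • (c.F p.1).adjoint v.snd +
            (Real.sin (angle p.2) : ℂ) • v.fst)
        simp only [map_add, map_smul, c.adjoint_equivariant])

theorem FredholmFamily.rot_zero (c : FredholmFamily Γ X) (x : X) (v : (c.rot).E₀.V) :
    c.rot.F (x, 0) v = (c.dsum c.adj).F x v := by
  change (Real.cos (angle 0) : ℂ) • blockDiag (c.F x) (c.F x).adjoint v +
      (Real.sin (angle 0) : ℂ) • quarterTurn c.E₀.V c.E₁.V v =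
    blockDiag (c.F x) (c.F x).adjoint v
  simp [angle]

theorem FredholmFamily.rot_one (c : FredholmFamily Γ X) (x : X) : c.rot.UnitaryAt (x, 1) := by
  have e : ∀ v, c.rot.F (x, 1) v = quarterTurn c.E₀.V c.E₁.V v := fun v => by
    change (Real.cos (angle 1) : ℂ) • blockDiag (c.F x) (c.F x).adjoint v +
      (Real.sin (angle 1) : ℂ) • quarterTurn c.E₀.V c.E₁.V v = _
    simp [angle]
  refine unitaryAt_of_inverse _ _ (fun w => -quarterTurn c.E₁.V c.E₀.V w) ?_ ?_ ?_
  · intro v w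
    rw [e]
    refine (WithLp.prod_inner_apply (𝕜 := ℂ) _ _).trans
        (Eq.trans ?_ (WithLp.prod_inner_apply (𝕜 := ℂ) _ _).symm)
    change ⟪-v.snd, w.fst⟫_ℂ + ⟪v.fst, w.snd⟫_ℂ = ⟪v.fst, -(-w.snd)⟫_ℂ + ⟪v.snd, -w.fst⟫_ℂ
    simp [add_comm]
  · intro v
    rw [e]
    exact congrArg (WithLp.toLp 2) (Prod.ext (neg_neg _) (neg_neg _))
  · intro v
    refine (e _).trans ?_
    exact congrArg (WithLp.toLp 2) (Prod.ext (neg_neg _) (neg_neg _))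

theorem K0.mk_isDirectSum {a b c : FredholmFamily Γ X} (h : a.IsDirectSum b c) :
    K0.mk c = K0.mk a + K0.mk b := by
  have := AddSubgroup.subset_closure
    (show _ ∈ K0.relations Γ X from Or.inl (Or.inl ⟨a, b, c, h, rfl⟩))
  exact (QuotientAddGroup.eq_iff_sub_mem (N := AddSubgroup.closure (K0.relations Γ X))).2 this

theorem K0.mk_homotopic {a b : FredholmFamily Γ X} (h : a.Homotopic b) : K0.mk a = K0.mk b := by
  have := AddSubgroup.subset_closure
    (show _ ∈ K0.relations Γ X from Or.inl (Or.inr ⟨a, b, h, rfl⟩))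
  exact (QuotientAddGroup.eq_iff_sub_mem (N := AddSubgroup.closure (K0.relations Γ X))).2 this

theorem K0.mk_degenerate {a : FredholmFamily Γ X} (h : a.IsDegenerate) : K0.mk a = 0 :=
  (QuotientAddGroup.eq_zero_iff (N := AddSubgroup.closure (K0.relations Γ X)) _).2
    (AddSubgroup.subset_closure (Or.inr ⟨a, h, rfl⟩))

theorem K0.mk_dsum (a b : FredholmFamily Γ X) : K0.mk (a.dsum b) = K0.mk a + K0.mk b :=
  K0.mk_isDirectSum (a.isDirectSum_dsum b)

/-- Unitarily isomorphic families have the same class. -/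
theorem K0.mk_congr {a b : FredholmFamily Γ X} (u₀ : a.E₀.V ≃ₗᵢ[ℂ] b.E₀.V)
    (u₁ : a.E₁.V ≃ₗᵢ[ℂ] b.E₁.V) (h₀ : ∀ γ v, u₀ (a.E₀.ρ γ v) = b.E₀.ρ γ (u₀ v))
    (h₁ : ∀ γ v, u₁ (a.E₁.ρ γ v) = b.E₁.ρ γ (u₁ v)) (h : ∀ x v, b.F x (u₀ v) = u₁ (a.F x v)) :
    K0.mk a = K0.mk b := by
  -- `b ⊕ a` is a direct sum both of `b` and `a` and of `a` and `a`
  have : a.IsDirectSum a (b.dsum a) :=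
    ⟨LinearIsometryEquiv.withLpProdCongr 2 u₀ (.refl ℂ _),
      LinearIsometryEquiv.withLpProdCongr 2 u₁ (.refl ℂ _),
      fun γ v w => congrArg (WithLp.toLp 2) (Prod.ext (h₀ γ v) rfl),
      fun γ v w => congrArg (WithLp.toLp 2) (Prod.ext (h₁ γ v) rfl),
      fun x v w => congrArg (WithLp.toLp 2) (Prod.ext (h x v) rfl)⟩
  exact add_right_cancel ((K0.mk_isDirectSum this).symm.trans (K0.mk_dsum b a))

end Ops

/-! ### Norm continuity of conjugation -/

section Rep

variable {Γ : Type*} [Group Γ] [TopologicalSpace Γ]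

/-- The operator by which a group element acts. -/
def HilbRep.op (E : HilbRep Γ) (γ : Γ) : E.V →L[ℂ] E.V :=
  (E.ρ γ).toContinuousLinearEquiv.toContinuousLinearMap

theorem HilbRep.op_apply (E : HilbRep Γ) (γ : Γ) (v : E.V) : E.op γ v = E.ρ γ v := rfl

theorem HilbRep.norm_op_comp_le (E : HilbRep Γ) {V : Type*} [NormedAddCommGroup V]
    [NormedSpace ℂ V] (γ : Γ) (K : V →L[ℂ] E.V) : ‖E.op γ ∘L K‖ ≤ ‖K‖ :=
  ContinuousLinearMap.opNorm_le_bound _ (norm_nonneg _) fun v => by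
    rw [ContinuousLinearMap.comp_apply, E.op_apply, LinearIsometryEquiv.norm_map]
    exact K.le_opNorm v

theorem HilbRep.norm_comp_op_le (E : HilbRep Γ) {V : Type*} [NormedAddCommGroup V]
    [NormedSpace ℂ V] (γ : Γ) (K : E.V →L[ℂ] V) : ‖K ∘L E.op γ‖ ≤ ‖K‖ :=
  ContinuousLinearMap.opNorm_le_bound _ (norm_nonneg _) fun v => by
    refine (K.le_opNorm (E.ρ γ v)).trans ?_
    rw [LinearIsometryEquiv.norm_map]

theorem HilbRep.adjoint_op (E : HilbRep Γ) (γ : Γ) : (E.op γ).adjoint = E.op γ⁻¹ := by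
  symm
  rw [ContinuousLinearMap.eq_adjoint_iff]
  intro v w
  rw [E.op_apply, E.inner_ρ_left, inv_inv, E.op_apply]

theorem HilbRep.continuous_ρ (E : HilbRep Γ) {Z : Type*} [TopologicalSpace Z] {g : Z → Γ}
    {v : Z → E.V} (hg : Continuous g) (hv : Continuous v) :
    Continuous fun z => E.ρ (g z) (v z) := by
  rw [continuous_iff_continuousAt]
  intro z₀
  have h₁ : Continuous fun z => ‖v z - v z₀‖ + ‖E.ρ (g z) (v z₀) - E.ρ (g z₀) (v z₀)‖ :=
    (hv.sub continuous_const).norm.add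
      (((E.continuous_apply (v z₀)).comp hg).sub continuous_const).norm
  have h₂ := h₁.tendsto z₀
  simp only [sub_self, norm_zero, add_zero] at h₂
  refine tendsto_iff_norm_sub_tendsto_zero.2 (squeeze_zero (fun _ => norm_nonneg _) (fun z => ?_) h₂)
  calc ‖E.ρ (g z) (v z) - E.ρ (g z₀) (v z₀)‖
      = ‖E.ρ (g z) (v z - v z₀) + (E.ρ (g z) (v z₀) - E.ρ (g z₀) (v z₀))‖ := by
        rw [map_sub]; congr 1; abel
    _ ≤ _ := (norm_add_le _ _).trans (by rw [LinearIsometryEquiv.norm_map])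

/-- A strongly continuous representation becomes norm continuous after composition with a compact
operator: strong convergence is uniform on relatively compact sets. -/
theorem HilbRep.continuous_op_comp (E : HilbRep Γ) {V : Type*} [NormedAddCommGroup V]
    [NormedSpace ℂ V] {K : V →L[ℂ] E.V} (hK : IsCompactOperator K) :
    Continuous fun γ => E.op γ ∘L K := by
  rw [continuous_iff_continuousAt]
  intro γ₀
  rw [ContinuousAt, Metric.tendsto_nhds]
  intro ε hε
  have hc := (hK.isCompact_closure_image_closedBall (f := K.toLinearMap) 1).totallyBounded
  obtain ⟨t, ht, hcov⟩ := Metric.totallyBounded_iff.1 hc (ε / 4) (by positivity)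
  have hev : ∀ᶠ γ in nhds γ₀, ∀ w ∈ t, ‖E.ρ γ w - E.ρ γ₀ w‖ < ε / 4 := by
    rw [Filter.eventually_all_finite ht]
    intro w _
    have := ((E.continuous_apply w).tendsto γ₀)
    rw [tendsto_iff_norm_sub_tendsto_zero] at this
    exact this.eventually_lt_const (by positivity)
  filter_upwards [hev] with γ hγ
  rw [dist_eq_norm]
  refine lt_of_le_of_lt (?_ : _ ≤ 3 * (ε / 4)) (by linarith)
  refine ContinuousLinearMap.opNorm_le_of_unit_norm (by positivity) fun x hx => ?_
  have hx' : K x ∈ ⋃ w ∈ t, Metric.ball w (ε / 4) :=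
    hcov (subset_closure ⟨x, by simp [hx], rfl⟩)
  obtain ⟨w, hw, hxw⟩ := Set.mem_iUnion₂.1 hx'
  rw [Metric.mem_ball, dist_eq_norm] at hxw
  have e : (E.op γ ∘L K - E.op γ₀ ∘L K) x =
      E.ρ γ (K x - w) + (E.ρ γ w - E.ρ γ₀ w) - E.ρ γ₀ (K x - w) := by
    simp only [sub_apply, ContinuousLinearMap.comp_apply, E.op_apply, map_sub]
    abel
  rw [e]
  refine (norm_sub_le _ _).trans ((add_le_add_left (norm_add_le _ _) _).trans ?_)
  rw [LinearIsometryEquiv.norm_map, LinearIsometryEquiv.norm_map]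
  have := hγ w hw
  linarith

theorem HilbRep.continuous_comp_op (E : HilbRep Γ) {K : E.V →L[ℂ] E.V}
    (hK : IsCompactOperator K) (hsa : K.adjoint = K) : Continuous fun γ => K ∘L E.op γ⁻¹ := by
  have h := (ContinuousLinearMap.adjoint (𝕜 := ℂ) (E := E.V) (F := E.V)).continuous.comp
    (E.continuous_op_comp hK)
  refine h.congr fun γ => ?_
  rw [Function.comp_apply, ContinuousLinearMap.adjoint_comp, hsa, E.adjoint_op]

/-- Conjugating a norm continuous family of compact self-adjoint operators by a strongly continuous
representation gives a norm continuous family. -/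
theorem HilbRep.continuous_conj (E : HilbRep Γ) {Z : Type*} [TopologicalSpace Z] {g : Z → Γ}
    {K : Z → E.V →L[ℂ] E.V} (hg : Continuous g) (hKn : Continuous K)
    (hK : ∀ z, IsCompactOperator (K z)) (hsa : ∀ z, (K z).adjoint = K z) :
    Continuous fun z => E.op (g z) ∘L K z ∘L E.op (g z)⁻¹ := by
  rw [continuous_iff_continuousAt]
  intro z₀
  have h₁ : Continuous fun z => ‖K z - K z₀‖ + (‖E.op (g z) ∘L K z₀ - E.op (g z₀) ∘L K z₀‖ +
      ‖K z₀ ∘L E.op (g z)⁻¹ - K z₀ ∘L E.op (g z₀)⁻¹‖) :=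
    (hKn.sub continuous_const).norm.add
      ((((E.continuous_op_comp (hK z₀)).comp hg).sub continuous_const).norm.add
        (((E.continuous_comp_op (hK z₀) (hsa z₀)).comp hg).sub continuous_const).norm)
  have h₂ := h₁.tendsto z₀
  simp only [sub_self, norm_zero, add_zero] at h₂
  refine tendsto_iff_norm_sub_tendsto_zero.2 (squeeze_zero (fun _ => norm_nonneg _) (fun z => ?_) h₂)
  have e : E.op (g z) ∘L K z ∘L E.op (g z)⁻¹ - E.op (g z₀) ∘L K z₀ ∘L E.op (g z₀)⁻¹ =
      E.op (g z) ∘L (K z - K z₀) ∘L E.op (g z)⁻¹ +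
        ((E.op (g z) ∘L K z₀ - E.op (g z₀) ∘L K z₀) ∘L E.op (g z)⁻¹ +
          E.op (g z₀) ∘L (K z₀ ∘L E.op (g z)⁻¹ - K z₀ ∘L E.op (g z₀)⁻¹)) := by
    ext v
    simp
  rw [e]
  refine (norm_add_le _ _).trans (add_le_add ?_ ((norm_add_le _ _).trans (add_le_add ?_ ?_)))
  · exact (E.norm_op_comp_le _ _).trans (E.norm_comp_op_le _ _)
  · exact E.norm_comp_op_le _ _
  · exact E.norm_op_comp_le _ _

end Rep

/-! ### Joint continuity -/

section Family

variable {Γ : Type*} [Group Γ] [TopologicalSpace Γ] {X : Type*} [TopologicalSpace X]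
  [MulAction Γ X]

/-- An essentially unitary family is jointly continuous in the point and the vector. -/
theorem FredholmFamily.continuous_apply_apply (c : FredholmFamily Γ X) {Z : Type*}
    [TopologicalSpace Z] {x : Z → X} {v : Z → c.E₀.V} (hx : Continuous x) (hv : Continuous v) :
    Continuous fun z => c.F (x z) (v z) := by
  rw [continuous_iff_continuousAt]
  intro z₀
  have hL : Continuous fun z => c.defectLeft (x z) := c.continuous_left.comp hx
  have hd : Continuous fun z => v z - v z₀ := hv.sub continuous_const
  -- `‖F u‖ ^ 2 = ⟪u + L u, u⟫` is small for small `u`, as the defect `L` is norm continuous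
  have h₁ : Continuous fun z =>
      √(RCLike.re ⟪v z - v z₀ + c.defectLeft (x z) (v z - v z₀), v z - v z₀⟫_ℂ) +
        ‖c.F (x z) (v z₀) - c.F (x z₀) (v z₀)‖ :=
    (Real.continuous_sqrt.comp (RCLike.continuous_re.comp
      ((hd.add (hL.clm_apply hd)).inner hd))).add
      (((c.continuous_apply _).comp hx).sub continuous_const).norm
  have h₂ := h₁.tendsto z₀
  simp only [sub_self, norm_zero, add_zero, map_zero, inner_zero_right, Real.sqrt_zero] at h₂
  refine tendsto_iff_norm_sub_tendsto_zero.2 (squeeze_zero (fun _ => norm_nonneg _) (fun z => ?_) h₂)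
  rw [← c.adjoint_apply_apply, ContinuousLinearMap.adjoint_inner_left, inner_self_eq_norm_sq,
    Real.sqrt_sq (norm_nonneg _), map_sub]
  refine (le_of_eq ?_).trans (norm_add_le _ _)
  congr 1
  abel

theorem FredholmFamily.defectLeft_equivariant (c : FredholmFamily Γ X) (γ : Γ) (x : X)
    (v : c.E₀.V) : c.defectLeft (γ • x) (c.E₀.ρ γ v) = c.E₀.ρ γ (c.defectLeft x v) := by
  have h := c.adjoint_apply_apply (γ • x) (c.E₀.ρ γ v)
  rw [c.equivariant, c.adjoint_equivariant, c.adjoint_apply_apply, map_add] at h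
  exact (add_left_cancel h).symm

theorem FredholmFamily.adj_defectLeft (c : FredholmFamily Γ X) :
    c.adj.defectLeft = c.defectRight := by
  funext x
  change (c.F x).adjoint.adjoint ∘L (c.F x).adjoint - _ = _
  rw [ContinuousLinearMap.adjoint_adjoint]
  rfl

theorem FredholmFamily.defectRight_equivariant (c : FredholmFamily Γ X) (γ : Γ) (x : X)
    (v : c.E₁.V) : c.defectRight (γ • x) (c.E₁.ρ γ v) = c.E₁.ρ γ (c.defectRight x v) := by
  rw [← c.adj_defectLeft]
  exact c.adj.defectLeft_equivariant γ x v

theorem FredholmFamily.adjoint_defectLeft (c : FredholmFamily Γ X) (x : X) :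
    (c.defectLeft x).adjoint = c.defectLeft x := by
  rw [defectLeft, map_sub, ContinuousLinearMap.adjoint_comp, ContinuousLinearMap.adjoint_adjoint,
    ContinuousLinearMap.adjoint_id]

end Family

/-! ### Gluing along induced spaces -/

section Induction

variable {Γ : Type*} [Group Γ] [TopologicalSpace Γ] {X : Type*} [TopologicalSpace X]
  [MulAction Γ X] {Γ' : Type*} [Group Γ'] [TopologicalSpace Γ'] {X' : Type*} [TopologicalSpace X']
  [MulAction Γ' X']

/-- The map `Γ × X' → X`, `(γ, x) ↦ γ • f x`. -/
def orbitMap (Γ : Type*) [Group Γ] [MulAction Γ X] (f : C(X', X))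
    (p : Γ × X') : X := p.1 • f p.2

/-- The `φ`-equivariant map `f : X' → X` identifies the induced space `Γ ×_Γ' X'` with a clopen
`Γ`-invariant subset of `X`, the range of `orbitMap Γ f`. -/
structure IsInduced (φ : Γ' →ₜ* Γ) (f : C(X', X)) : Prop where
  equivariant : ∀ (γ : Γ') (x : X'), f (γ • x) = φ γ • f x
  isOpenMap : IsOpenMap (orbitMap Γ f)
  isClosed_range : IsClosed (Set.range (orbitMap Γ f))
  exists_of_eq : ∀ (γ : Γ) (x y : X'), f y = γ • f x → ∃ h : Γ', γ = φ h ∧ y = h • x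

theorem IsInduced.prod {φ : Γ' →ₜ* Γ} {f : C(X', X)} (h : IsInduced φ f) (T : Type*)
    [TopologicalSpace T] : IsInduced φ (TrivProd.map T f) where
  equivariant γ p := TrivProd.map_smul T φ f h.equivariant γ p
  isOpenMap := by
    have h₁ : IsOpenMap (Prod.map (orbitMap Γ f) (id : T → T)) := h.isOpenMap.prodMap .id
    exact h₁.comp (Homeomorph.prodAssoc Γ X' T).symm.isOpenMap
  isClosed_range := by
    have : Set.range (orbitMap Γ (TrivProd.map T f)) =
        (TrivProd.proj X T) ⁻¹' Set.range (orbitMap Γ f) := by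
      ext ⟨x, t⟩
      constructor
      · rintro ⟨⟨γ, y, s⟩, hy⟩
        exact ⟨(γ, y), congrArg Prod.fst hy⟩
      · rintro ⟨⟨γ, y⟩, hy⟩
        exact ⟨(γ, (y, t)), Prod.ext hy rfl⟩
    rw [this]
    exact h.isClosed_range.preimage (TrivProd.proj X T).continuous
  exists_of_eq := by
    rintro γ ⟨x, s⟩ ⟨y, t⟩ e
    obtain ⟨k, hk, rfl⟩ := h.exists_of_eq γ x y (congrArg Prod.fst e)
    exact ⟨k, hk, Prod.ext rfl (congrArg (Prod.snd : X × T → T) e)⟩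

section GlueFun

variable {P Y M : Type*}

open Classical in
/-- The function equal to `A` along `p`, and to `B` off the range of `p`. -/
def glueFun (p : P → Y) (A : P → M) (B : Y → M) (y : Y) : M :=
  if h : ∃ q, p q = y then A h.choose else B y

theorem glueFun_apply {p : P → Y} {A : P → M} {B : Y → M}
    (hA : ∀ q q', p q = p q' → A q = A q') (q : P) : glueFun p A B (p q) = A q := by
  have h : ∃ q', p q' = p q := ⟨q, rfl⟩
  rw [glueFun, dif_pos h]
  exact hA _ _ h.choose_spec

theorem glueFun_of_notMem {p : P → Y} {A : P → M} {B : Y → M} {y : Y} (hy : y ∉ Set.range p) :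
    glueFun p A B y = B y := dif_neg hy

/-- A function is continuous if it is so along an open map with closed range, and agrees with a
continuous function off that range. -/
theorem continuous_of_isOpenMap [TopologicalSpace P] [TopologicalSpace Y] [TopologicalSpace M]
    {p : P → Y} (hp : IsOpenMap p) (hc : IsClosed (Set.range p)) {G B : Y → M}
    (hG : Continuous fun q => G (p q)) (hB : Continuous B) (h : ∀ y ∉ Set.range p, G y = B y) :
    Continuous G := by
  refine continuous_def.2 fun U hU => ?_
  have : G ⁻¹' U = p '' ((fun q => G (p q)) ⁻¹' U) ∪ ((Set.range p)ᶜ ∩ B ⁻¹' U) := by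
    ext y
    by_cases hy : y ∈ Set.range p
    · obtain ⟨q, rfl⟩ := hy
      simp only [Set.mem_preimage, Set.mem_union, Set.mem_image, Set.mem_inter_iff,
        Set.mem_compl_iff, Set.mem_range_self, not_true_eq_false, false_and, or_false]
      exact ⟨fun hq => ⟨q, hq, rfl⟩, fun ⟨q', hq', e⟩ => e ▸ hq'⟩
    · simp only [Set.mem_preimage, Set.mem_union, Set.mem_image, Set.mem_inter_iff,
        Set.mem_compl_iff, hy, not_false_eq_true, true_and, h y hy]
      exact ⟨Or.inr, fun h' => h'.resolve_left fun ⟨q, _, e⟩ => hy ⟨q, e⟩⟩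
  rw [this]
  exact (hp _ (hU.preimage hG)).union (hc.isOpen_compl.inter (hU.preimage hB))

end GlueFun

section TranslateOp

variable {X' : Type*} {W₀ W₁ : HilbRep Γ} {A₀ A₁ : HilbRep Γ'} (u₀ : A₀.V ≃ₗᵢ[ℂ] W₀.V)
    (u₁ : A₁.V ≃ₗᵢ[ℂ] W₁.V) (T : X' → A₀.V →L[ℂ] A₁.V)

/-- The operator `γ ∘ u₁ ∘ T x ∘ u₀⁻¹ ∘ γ⁻¹`. -/
def translateOp (p : Γ × X') : W₀.V →L[ℂ] W₁.V :=
  W₁.op p.1 ∘L (u₁.toContinuousLinearEquiv.toContinuousLinearMap ∘L T p.2 ∘L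
    u₀.symm.toContinuousLinearEquiv.toContinuousLinearMap) ∘L W₀.op p.1⁻¹

theorem translateOp_apply (p : Γ × X') (v : W₀.V) :
    translateOp u₀ u₁ T p v = W₁.ρ p.1 (u₁ (T p.2 (u₀.symm (W₀.ρ p.1⁻¹ v)))) := rfl

theorem isCompactOperator_translateOp (p : Γ × X') (hT : IsCompactOperator (T p.2)) :
    IsCompactOperator (translateOp u₀ u₁ T p) :=
  (((hT.comp_clm _).clm_comp _).comp_clm _).clm_comp _

theorem translateOp_inner (S : X' → A₁.V →L[ℂ] A₀.V) (p : Γ × X')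
    (h : ∀ v w, ⟪T p.2 v, w⟫_ℂ = ⟪v, S p.2 w⟫_ℂ) (v : W₀.V) (w : W₁.V) :
    ⟪translateOp u₀ u₁ T p v, w⟫_ℂ = ⟪v, translateOp u₁ u₀ S p w⟫_ℂ := by
  rw [translateOp_apply, translateOp_apply, W₁.inner_ρ_left, ← inv_inv p.1, ← W₀.inner_ρ_left,
    inv_inv]
  obtain ⟨w', hw⟩ := u₁.surjective (W₁.ρ p.1⁻¹ w)
  obtain ⟨v', hv⟩ := u₀.surjective (W₀.ρ p.1⁻¹ v)
  rw [← hw, ← hv, u₁.inner_map_map, u₀.inner_map_map, u₁.symm_apply_apply, u₀.symm_apply_apply, h]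

/-- A translated product `S * T` is the identity plus the translated defect. -/
theorem translateOp_comp (S : X' → A₁.V →L[ℂ] A₀.V) (L : X' → A₀.V →L[ℂ] A₀.V) (p : Γ × X')
    (h : ∀ v, S p.2 (T p.2 v) = v + L p.2 v) (v : W₀.V) :
    translateOp u₁ u₀ S p (translateOp u₀ u₁ T p v) = v + translateOp u₀ u₀ L p v := by
  simp only [translateOp_apply, W₁.ρ_inv_apply_self, u₁.symm_apply_apply, h, map_add,
    u₀.apply_symm_apply, W₀.ρ_apply_inv_self]

theorem translateOp_smul (γ : Γ) (p : Γ × X') (v : W₀.V) :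
    translateOp u₀ u₁ T (γ * p.1, p.2) (W₀.ρ γ v) = W₁.ρ γ (translateOp u₀ u₁ T p v) := by
  simp only [translateOp_apply, W₁.ρ_mul, ← W₀.ρ_mul, mul_inv_rev, inv_mul_cancel_right]

end TranslateOp

/-- The translated operator at `(γ, x)` depends only on the point `γ • f x` of the induced space. -/
theorem translateOp_congr {φ : Γ' →ₜ* Γ} {f : C(X', X)} (hI : IsInduced φ f)
    {W₀ W₁ : HilbRep Γ} {A₀ A₁ : HilbRep Γ'} {u₀ : A₀.V ≃ₗᵢ[ℂ] W₀.V} {u₁ : A₁.V ≃ₗᵢ[ℂ] W₁.V}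
    {T : X' → A₀.V →L[ℂ] A₁.V}
    (h₀ : ∀ γ v, u₀ (A₀.ρ γ v) = W₀.ρ (φ γ) (u₀ v)) (h₁ : ∀ γ v, u₁ (A₁.ρ γ v) = W₁.ρ (φ γ) (u₁ v))
    (hT : ∀ γ x v, T (γ • x) (A₀.ρ γ v) = A₁.ρ γ (T x v)) (q q' : Γ × X')
    (e : orbitMap Γ f q = orbitMap Γ f q') :
    translateOp u₀ u₁ T q = translateOp u₀ u₁ T q' := by
  obtain ⟨a, x⟩ := q
  obtain ⟨b, y⟩ := q'
  have e' : f y = (b⁻¹ * a) • f x := by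
    rw [mul_smul, eq_inv_smul_iff]; exact e.symm
  obtain ⟨h, hh, rfl⟩ := hI.exists_of_eq _ _ _ e'
  obtain rfl : a = b * φ h := by rw [← hh, mul_inv_cancel_left]
  ext v
  rw [translateOp_apply, translateOp_apply]
  have key : ∀ w, u₀.symm (W₀.ρ (φ h) w) = A₀.ρ h (u₀.symm w) := fun w =>
    u₀.injective (by rw [u₀.apply_symm_apply, h₀, u₀.apply_symm_apply])
  have e₁ : W₀.ρ b⁻¹ v = W₀.ρ (φ h) (W₀.ρ (b * φ h)⁻¹ v) := by
    rw [← W₀.ρ_mul]; congr 2; group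
  simp only
  rw [e₁, key, hT, h₁, W₁.ρ_mul]

section Glue

variable [IsTopologicalGroup Γ] {φ : Γ' →ₜ* Γ} {f : C(X', X)} (hI : IsInduced φ f)
    (B : FredholmFamily Γ X) (c : FredholmFamily Γ' X') (u₀ : c.E₀.V ≃ₗᵢ[ℂ] B.E₀.V)
    (u₁ : c.E₁.V ≃ₗᵢ[ℂ] B.E₁.V)

theorem FredholmFamily.continuous_translate :
    (∀ v, Continuous fun q : Γ × X' => translateOp u₀ u₁ c.F q v) ∧
    Continuous fun q : Γ × X' => translateOp u₀ u₀ c.defectLeft q := by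
  constructor
  · intro v
    exact B.E₁.continuous_ρ continuous_fst (u₁.continuous.comp
      (c.continuous_apply_apply continuous_snd (u₀.symm.continuous.comp
        (B.E₀.continuous_ρ continuous_fst.inv continuous_const))))
  · refine B.E₀.continuous_conj continuous_fst ?_ ?_ ?_
    · exact continuous_const.clm_comp ((c.continuous_left.comp continuous_snd).clm_comp
        continuous_const)
    · exact fun q => ((c.isCompact_left q.2).comp_clm _).clm_comp _
    · intro q
      symm
      rw [ContinuousLinearMap.eq_adjoint_iff]
      intro v w
      obtain ⟨v, rfl⟩ := u₀.surjective v
      obtain ⟨w, rfl⟩ := u₀.surjective w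
      change ⟪u₀ (c.defectLeft q.2 (u₀.symm (u₀ v))), u₀ w⟫_ℂ =
        ⟪u₀ v, u₀ (c.defectLeft q.2 (u₀.symm (u₀ w)))⟫_ℂ
      rw [u₀.inner_map_map, u₀.inner_map_map, u₀.symm_apply_apply, u₀.symm_apply_apply,
        ← ContinuousLinearMap.adjoint_inner_right, c.adjoint_defectLeft]

omit [TopologicalSpace Γ] [IsTopologicalGroup Γ] in
theorem orbitMap_smul (f : C(X', X)) (γ : Γ) (q : Γ × X') :
    γ • orbitMap Γ f q = orbitMap Γ f (γ * q.1, q.2) := (mul_smul _ _ _).symm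

omit [TopologicalSpace Γ] [IsTopologicalGroup Γ] in
theorem smul_mem_range_orbitMap (f : C(X', X)) (γ : Γ) {x : X} :
    γ • x ∈ Set.range (orbitMap Γ f) ↔ x ∈ Set.range (orbitMap Γ f) := by
  constructor
  · rintro ⟨q, hq⟩
    exact ⟨(γ⁻¹ * q.1, q.2), by rw [← orbitMap_smul, hq, inv_smul_smul]⟩
  · rintro ⟨q, rfl⟩
    exact ⟨_, (orbitMap_smul f γ q).symm⟩

/-- The family equal to `B` off the range of the induced space, and extending the `Γ'`-family `c`,
moved by the isometries `u₀` and `u₁`, on the induced space. -/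
def FredholmFamily.glue (h₀ : ∀ γ v, u₀ (c.E₀.ρ γ v) = B.E₀.ρ (φ γ) (u₀ v))
    (h₁ : ∀ γ v, u₁ (c.E₁.ρ γ v) = B.E₁.ρ (φ γ) (u₁ v)) : FredholmFamily Γ X :=
  have eF := glueFun_apply (B := B.F) (translateOp_congr hI h₀ h₁ c.equivariant)
  have eFs := glueFun_apply (B := fun x => (B.F x).adjoint)
    (translateOp_congr (T := fun x => (c.F x).adjoint) hI h₁ h₀ c.adjoint_equivariant)
  have eL := glueFun_apply (B := B.defectLeft) (translateOp_congr hI h₀ h₀ c.defectLeft_equivariant)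
  have eR := glueFun_apply (B := B.defectRight)
    (translateOp_congr hI h₁ h₁ c.defectRight_equivariant)
  .ofAdjoint B.E₀ B.E₁ (glueFun (orbitMap Γ f) (translateOp u₀ u₁ c.F) B.F)
    (glueFun (orbitMap Γ f) (translateOp u₁ u₀ fun x => (c.F x).adjoint) fun x => (B.F x).adjoint)
    (glueFun (orbitMap Γ f) (translateOp u₀ u₀ c.defectLeft) B.defectLeft)
    (glueFun (orbitMap Γ f) (translateOp u₁ u₁ c.defectRight) B.defectRight)
    (fun x v w => by
      by_cases hx : x ∈ Set.range (orbitMap Γ f)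
      · obtain ⟨q, rfl⟩ := hx
        rw [eF, eFs]
        exact translateOp_inner _ _ _ _ _
          (fun v w => (ContinuousLinearMap.adjoint_inner_right _ _ _).symm) _ _
      · rw [glueFun_of_notMem hx, glueFun_of_notMem hx, ContinuousLinearMap.adjoint_inner_right])
    (fun v => continuous_of_isOpenMap hI.isOpenMap hI.isClosed_range
      (by simpa only [eF] using (continuous_translate B c u₀ u₁).1 v) (B.continuous_apply v)
      fun x hx => by rw [glueFun_of_notMem hx])
    (fun v => continuous_of_isOpenMap hI.isOpenMap hI.isClosed_range
      (((continuous_translate B.adj c.adj u₁ u₀).1 v).congr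
        fun q => (congrArg (fun S => S v) (eFs q)).symm)
      (B.continuous_adjoint_apply v) fun x hx => by rw [glueFun_of_notMem hx])
    (fun x v => by
      by_cases hx : x ∈ Set.range (orbitMap Γ f)
      · obtain ⟨q, rfl⟩ := hx
        rw [eF, eFs, eL]
        exact translateOp_comp _ _ _ _ _ _ (c.adjoint_apply_apply _) _
      · rw [glueFun_of_notMem hx, glueFun_of_notMem hx, glueFun_of_notMem hx,
          B.adjoint_apply_apply])
    (fun x v => by
      by_cases hx : x ∈ Set.range (orbitMap Γ f)
      · obtain ⟨q, rfl⟩ := hx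
        rw [eF, eFs, eR]
        exact translateOp_comp _ _ _ _ _ _ (c.apply_adjoint_apply _) _
      · rw [glueFun_of_notMem hx, glueFun_of_notMem hx, glueFun_of_notMem hx,
          B.apply_adjoint_apply])
    (fun x => by
      by_cases hx : x ∈ Set.range (orbitMap Γ f)
      · obtain ⟨q, rfl⟩ := hx
        rw [eL]
        exact isCompactOperator_translateOp _ _ _ _ (c.isCompact_left _)
      · rw [glueFun_of_notMem hx]
        exact B.isCompact_left x)
    (fun x => by
      by_cases hx : x ∈ Set.range (orbitMap Γ f)
      · obtain ⟨q, rfl⟩ := hx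
        rw [eR]
        exact isCompactOperator_translateOp _ _ _ _ (c.isCompact_right _)
      · rw [glueFun_of_notMem hx]
        exact B.isCompact_right x)
    (continuous_of_isOpenMap hI.isOpenMap hI.isClosed_range
      (by simpa only [eL] using (continuous_translate B c u₀ u₁).2) B.continuous_left
      fun x hx => by rw [glueFun_of_notMem hx]; rfl)
    (continuous_of_isOpenMap hI.isOpenMap hI.isClosed_range
      (((continuous_translate B.adj c.adj u₁ u₀).2.congr fun q => by
        rw [c.adj_defectLeft]; rfl).congr fun q => (eR q).symm) B.continuous_right
      fun x hx => by rw [glueFun_of_notMem hx]; rfl)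
    (fun γ x v => by
      by_cases hx : x ∈ Set.range (orbitMap Γ f)
      · obtain ⟨q, rfl⟩ := hx
        rw [orbitMap_smul, eF, eF]
        exact translateOp_smul _ _ _ _ _ _
      · rw [glueFun_of_notMem hx, glueFun_of_notMem
          (fun h => hx ((smul_mem_range_orbitMap f γ).1 h)), B.equivariant])

variable {hI B c u₀ u₁} (h₀ : ∀ γ v, u₀ (c.E₀.ρ γ v) = B.E₀.ρ (φ γ) (u₀ v))
    (h₁ : ∀ γ v, u₁ (c.E₁.ρ γ v) = B.E₁.ρ (φ γ) (u₁ v))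

theorem FredholmFamily.glue_apply (x : X') (v : c.E₀.V) :
    (glue hI B c u₀ u₁ h₀ h₁).F (f x) (u₀ v) = u₁ (c.F x v) := by
  have e : f x = orbitMap Γ f (1, x) := (one_smul _ _).symm
  rw [e]
  refine (congrArg (fun S => S (u₀ v)) (glueFun_apply (B := B.F)
    (translateOp_congr hI h₀ h₁ c.equivariant) (1, x))).trans ?_
  rw [translateOp_apply, inv_one, B.E₀.ρ_one, B.E₁.ρ_one, u₀.symm_apply_apply]

theorem FredholmFamily.glue_of_notMem {x : X} (hx : x ∉ Set.range (orbitMap Γ f)) :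
    (glue hI B c u₀ u₁ h₀ h₁).F x = B.F x :=
  glueFun_of_notMem hx

theorem FredholmFamily.glue_unitaryAt_of_notMem {x : X} (hx : x ∉ Set.range (orbitMap Γ f))
    (h : B.UnitaryAt x) : (glue hI B c u₀ u₁ h₀ h₁).UnitaryAt x := by
  have e := glue_of_notMem (hI := hI) h₀ h₁ hx
  unfold UnitaryAt
  rw [e]
  exact h

theorem FredholmFamily.glue_unitaryAt (x : X') (h : c.UnitaryAt x) (γ : Γ) :
    (glue hI B c u₀ u₁ h₀ h₁).UnitaryAt (γ • f x) := by
  refine UnitaryAt.smul ?_ γ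
  refine unitaryAt_of_inverse _ _ (fun w => u₀ ((c.F x).adjoint (u₁.symm w))) ?_ ?_ ?_
  · intro v w
    obtain ⟨v, rfl⟩ := u₀.surjective v
    obtain ⟨w, rfl⟩ := u₁.surjective w
    rw [glue_apply]
    refine (u₁.inner_map_map _ _).trans (Eq.trans ?_ (u₀.inner_map_map _ _).symm)
    rw [ContinuousLinearMap.adjoint_inner_right]
    exact congrArg _ (u₁.symm_apply_apply w).symm
  · intro v
    obtain ⟨v, rfl⟩ := u₀.surjective v
    rw [glue_apply]
    refine congrArg u₀ (Eq.trans ?_ (h.1 v))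
    exact congrArg _ (u₁.symm_apply_apply _)
  · intro w
    rw [glue_apply, h.2]
    exact u₁.apply_symm_apply w

/-- Gluing changes nothing on the orbits on which `c` is the restriction of `B`. -/
theorem FredholmFamily.glue_eq_self (x : X)
    (h : ∀ (γ : Γ) (y : X'), x = γ • f y → ∀ v, B.F (f y) (u₀ v) = u₁ (c.F y v)) :
    (glue hI B c u₀ u₁ h₀ h₁).F x = B.F x := by
  by_cases hx : x ∈ Set.range (orbitMap Γ f)
  · obtain ⟨⟨γ, y⟩, rfl⟩ := hx
    ext v
    obtain ⟨v, rfl⟩ := (B.E₀.ρ γ).surjective v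
    obtain ⟨v, rfl⟩ := u₀.surjective v
    refine ((glue hI B c u₀ u₁ h₀ h₁).equivariant γ (f y) (u₀ v)).trans ?_
    refine Eq.trans ?_ (B.equivariant γ (f y) (u₀ v)).symm
    exact congrArg (B.E₁.ρ γ) ((glue_apply h₀ h₁ y v).trans (h γ y rfl v).symm)
  · exact glue_of_notMem h₀ h₁ hx

end Glue

/-- A homotopy over the induced space, from the restriction of `A` to a unitary family, deforms `A`
into a family that is unitary on the induced space and equal to `A` elsewhere. -/
theorem FredholmFamily.exists_mk_eq_of_homotopy [IsTopologicalGroup Γ] {φ : Γ' →ₜ* Γ}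
    {f : C(X', X)} (hI : IsInduced φ f) (A : FredholmFamily Γ X)
    (r : FredholmFamily Γ' (TrivProd X' unitInterval)) (u₀ : r.E₀.V ≃ₗᵢ[ℂ] A.E₀.V)
    (u₁ : r.E₁.V ≃ₗᵢ[ℂ] A.E₁.V) (h₀ : ∀ γ v, u₀ (r.E₀.ρ γ v) = A.E₀.ρ (φ γ) (u₀ v))
    (h₁ : ∀ γ v, u₁ (r.E₁.ρ γ v) = A.E₁.ρ (φ γ) (u₁ v))
    (hF : ∀ y v, A.F (f y) (u₀ v) = u₁ (r.F (TrivProd.slice X' 0 y) v))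
    (hr : ∀ y, r.UnitaryAt (TrivProd.slice X' 1 y)) :
    ∃ D : FredholmFamily Γ X, K0.mk A = K0.mk D ∧
      (∀ x ∈ Set.range (orbitMap Γ f), D.UnitaryAt x) ∧ ∀ x, A.UnitaryAt x → D.UnitaryAt x := by
  let B : FredholmFamily Γ (TrivProd X unitInterval) :=
    A.pullback (ContinuousMonoidHom.id Γ) (TrivProd.proj X unitInterval) fun _ _ => rfl
  let h := glue (hI.prod unitInterval) B r u₀ u₁ h₀ h₁
  have hunit : ∀ x ∈ Set.range (orbitMap Γ f), h.UnitaryAt (TrivProd.slice X 1 x) := by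
    rintro _ ⟨⟨γ, y⟩, rfl⟩
    exact glue_unitaryAt _ _ (TrivProd.slice X' 1 y) (hr y) γ
  refine ⟨h.pullback (ContinuousMonoidHom.id Γ) (TrivProd.slice X 1) (TrivProd.slice_smul Γ 1),
    ?_, hunit, ?_⟩
  · rw [← K0.mk_homotopic ⟨h, rfl, rfl⟩]
    refine K0.mk_congr (.refl ℂ _) (.refl ℂ _) (fun _ _ => rfl) (fun _ _ => rfl) fun x v => ?_
    have e : h.F (TrivProd.slice X 0 x) = B.F (TrivProd.slice X 0 x) := by
      refine glue_eq_self _ _ _ ?_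
      rintro γ p hp v
      obtain ⟨y, rfl⟩ : ∃ y, p = TrivProd.slice X' 0 y :=
        ⟨p.1, Prod.ext rfl (congrArg (Prod.snd : X × unitInterval → _) hp).symm⟩
      exact hF y v
    exact congrArg (fun S => S v) e
  · intro x hx
    by_cases hxr : x ∈ Set.range (orbitMap Γ f)
    · exact hunit x hxr
    · have hB : B.UnitaryAt (TrivProd.slice X 1 x) := hx
      change h.UnitaryAt (TrivProd.slice X 1 x)
      refine glue_unitaryAt_of_notMem (hI := hI.prod unitInterval) h₀ h₁ ?_ hB
      rintro ⟨⟨γ, p⟩, hy⟩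
      exact hxr ⟨(γ, p.1), congrArg (Prod.fst : X × unitInterval → _) hy⟩

/-- Rotating `c ⊕ c†` to a unitary family over the induced space shows that two families `C`, `C'`
with the same restriction `c`, up to degenerate summands, differ only by a family that is unitary
on the induced space and wherever `C` and `C'` are. -/
theorem FredholmFamily.exists_mk_add_mk_adj [IsTopologicalGroup Γ] {φ : Γ' →ₜ* Γ} {f : C(X', X)}
    (hI : IsInduced φ f) {C C' : FredholmFamily Γ X} {c d d' : FredholmFamily Γ' X'}
    (hC : c.IsDirectSum d (C.pullback φ f hI.equivariant))
    (hC' : c.IsDirectSum d' (C'.pullback φ f hI.equivariant)) (hd : d.IsDegenerate)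
    (hd' : d'.IsDegenerate) :
    ∃ D : FredholmFamily Γ X, K0.mk C + K0.mk C'.adj = K0.mk D ∧
      (∀ x ∈ Set.range (orbitMap Γ f), D.UnitaryAt x) ∧
      ∀ x, C.UnitaryAt x → C'.UnitaryAt x → D.UnitaryAt x := by
  obtain ⟨u₀, u₁, h₀, h₁, hF⟩ := hC.dsum hC'.adj
  let r : FredholmFamily Γ' (TrivProd X' unitInterval) :=
    c.rot.dsum ((d.dsum d'.adj).pullback (ContinuousMonoidHom.id Γ') (TrivProd.proj X' unitInterval)
      fun _ _ => rfl)
  have hr₀ : ∀ y v, WithLp.toLp 2 ((c.dsum c.adj).F y v.fst, (d.dsum d'.adj).F y v.snd) =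
      r.F (TrivProd.slice X' 0 y) v := fun y v =>
    congrArg (WithLp.toLp 2) (Prod.ext (c.rot_zero y v.fst).symm rfl)
  have hr₁ : ∀ y, r.UnitaryAt (TrivProd.slice X' 1 y) := fun y => (c.rot_one y).dsum
    (((d.isDegenerate_iff).1 hd y).dsum ((d'.isDegenerate_iff).1 hd' y).adj)
  obtain ⟨D, hD, h, h'⟩ := exists_mk_eq_of_homotopy hI (C.dsum C'.adj) r u₀ u₁
    (fun γ v => h₀ γ v.fst v.snd) (fun γ v => h₁ γ v.fst v.snd)
    (fun y v => (hF y v.fst v.snd).trans (congrArg u₁ (hr₀ y v))) hr₁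
  exact ⟨D, (K0.mk_dsum _ _).symm.trans hD, h, fun x hx hx' => h' x (hx.dsum hx'.adj)⟩

end Induction

/-! ### Extension by degenerate families -/

section Extension

variable {Γ : Type*} [Group Γ] [TopologicalSpace Γ] {X : Type*} [TopologicalSpace X]
  [MulAction Γ X] {Γ' : Type*} [Group Γ'] [TopologicalSpace Γ'] {X' : Type*} [TopologicalSpace X']
  [MulAction Γ' X']

/-- Every representation of `Γ'` is absorbed by the restriction of some representation of `Γ`;
moreover any two are absorbed by the same one. -/
def HasAbsorption (φ : Γ' →ₜ* Γ) : Prop :=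
  ∀ E₀ E₁ : HilbRep Γ', ∃ (U : HilbRep Γ) (u₀ : WithLp 2 (E₀.V × U.V) ≃ₗᵢ[ℂ] U.V)
    (u₁ : WithLp 2 (E₁.V × U.V) ≃ₗᵢ[ℂ] U.V),
    (∀ γ v w, u₀ (WithLp.toLp 2 (E₀.ρ γ v, U.ρ (φ γ) w)) = U.ρ (φ γ) (u₀ (WithLp.toLp 2 (v, w)))) ∧
    (∀ γ v w, u₁ (WithLp.toLp 2 (E₁.ρ γ v, U.ρ (φ γ) w)) = U.ρ (φ γ) (u₁ (WithLp.toLp 2 (v, w))))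

/-- `C` is unitary off the induced space, and restricts to `c` up to a degenerate summand. -/
def FredholmFamily.IsExtension {φ : Γ' →ₜ* Γ} {f : C(X', X)} (hI : IsInduced φ f)
    (c : FredholmFamily Γ' X') (C : FredholmFamily Γ X) : Prop :=
  (∃ d : FredholmFamily Γ' X', d.IsDegenerate ∧
    c.IsDirectSum d (C.pullback φ f hI.equivariant)) ∧
  ∀ x ∉ Set.range (orbitMap Γ f), C.UnitaryAt x

theorem FredholmFamily.const_isDegenerate (U : HilbRep Γ) : (const X U).IsDegenerate :=
  (isDegenerate_iff _).2 fun x => const_unitaryAt U x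

/-- The rotation homotopy deforms `c ⊕ c†` to a unitary family. -/
theorem K0.mk_adj (c : FredholmFamily Γ X) : K0.mk c.adj = -K0.mk c := by
  refine eq_neg_of_add_eq_zero_right ?_
  have h₀ : K0.mk (c.dsum c.adj) = K0.mk (c.rot.pullback (ContinuousMonoidHom.id Γ)
      (TrivProd.slice X 0) (TrivProd.slice_smul Γ 0)) :=
    K0.mk_congr (.refl ℂ _) (.refl ℂ _) (fun _ _ => rfl) (fun _ _ => rfl)
      fun x v => c.rot_zero x v
  rw [← K0.mk_dsum, h₀, K0.mk_homotopic ⟨c.rot, rfl, rfl⟩]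
  exact K0.mk_degenerate ((FredholmFamily.isDegenerate_iff _).2 fun x => c.rot_one x)

variable [IsTopologicalGroup Γ] {φ : Γ' →ₜ* Γ} {f : C(X', X)} (hI : IsInduced φ f)

/-- By absorption `c ⊕ 1` acts between representations of `Γ`, so that it can be glued with an
identity family. -/
theorem FredholmFamily.exists_isExtension (hA : HasAbsorption φ) (c : FredholmFamily Γ' X') :
    ∃ C, IsExtension hI c C := by
  obtain ⟨U, u₀, u₁, h₀, h₁⟩ := hA c.E₀ c.E₁
  refine ⟨glue hI (const X U) (c.dsum (const X' (U.res φ))) u₀ u₁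
    (fun γ v => h₀ γ v.fst v.snd) (fun γ v => h₁ γ v.fst v.snd),
    ⟨const X' (U.res φ), const_isDegenerate _, u₀, u₁, h₀, h₁, ?_⟩, fun x hx => ?_⟩
  · exact fun x v w => glue_apply (hI := hI) (B := const X U) (c := c.dsum (const X' (U.res φ)))
      (fun γ v => h₀ γ v.fst v.snd) (fun γ v => h₁ γ v.fst v.snd) x (WithLp.toLp 2 (v, w))
  · exact glue_unitaryAt_of_notMem (hI := hI) (B := const X U) (c := c.dsum (const X' (U.res φ)))
      (fun γ v => h₀ γ v.fst v.snd) (fun γ v => h₁ γ v.fst v.snd) hx (const_unitaryAt U x)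

variable {hI}

theorem FredholmFamily.IsExtension.mk_eq {c : FredholmFamily Γ' X'} {C C' : FredholmFamily Γ X}
    (h : IsExtension hI c C) (h' : IsExtension hI c C') : K0.mk C = K0.mk C' := by
  obtain ⟨⟨d, hd, hs⟩, hu⟩ := h
  obtain ⟨⟨d', hd', hs'⟩, hu'⟩ := h'
  obtain ⟨D, hD, h₁, h₂⟩ := exists_mk_add_mk_adj hI hs hs' hd hd'
  have : D.IsDegenerate := (isDegenerate_iff _).2 fun x => by
    by_cases hx : x ∈ Set.range (orbitMap Γ f)
    · exact h₁ x hx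
    · exact h₂ x (hu x hx) (hu' x hx)
  rw [K0.mk_degenerate this, K0.mk_adj] at hD
  exact add_neg_eq_zero.1 hD

omit [IsTopologicalGroup Γ] in
theorem FredholmFamily.IsExtension.isDirectSum {a b c : FredholmFamily Γ' X'}
    {A B : FredholmFamily Γ X} (hA : IsExtension hI a A) (hB : IsExtension hI b B)
    (h : a.IsDirectSum b c) : IsExtension hI c (A.dsum B) := by
  obtain ⟨⟨d, hd, hs⟩, hu⟩ := hA
  obtain ⟨⟨d', hd', hs'⟩, hu'⟩ := hB
  refine ⟨⟨d.dsum d', ?_, h.congr_left (hs.dsum hs')⟩, fun x hx => (hu x hx).dsum (hu' x hx)⟩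
  rw [isDegenerate_iff] at *
  exact fun x => (hd x).dsum (hd' x)

omit [IsTopologicalGroup Γ] in
theorem FredholmFamily.IsExtension.isDegenerate {a : FredholmFamily Γ' X'}
    {A : FredholmFamily Γ X} (hA : IsExtension hI a A) (h : a.IsDegenerate) : A.IsDegenerate := by
  obtain ⟨⟨d, hd, hs⟩, hu⟩ := hA
  rw [isDegenerate_iff] at *
  intro x
  by_cases hx : x ∈ Set.range (orbitMap Γ f)
  · obtain ⟨⟨γ, y⟩, rfl⟩ := hx
    have : (A.pullback φ f hI.equivariant).UnitaryAt y := .of_isDirectSum hs (h y) (hd y)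
    exact UnitaryAt.smul (a := A) (x := f y) this γ
  · exact hu x hx

omit [IsTopologicalGroup Γ] in
theorem FredholmFamily.IsExtension.slice {T : Type*} [TopologicalSpace T]
    {h : FredholmFamily Γ' (TrivProd X' T)} {C : FredholmFamily Γ (TrivProd X T)}
    (hC : IsExtension (hI.prod T) h C) (t : T) :
    IsExtension hI
      (h.pullback (ContinuousMonoidHom.id Γ') (TrivProd.slice X' t) (TrivProd.slice_smul Γ' t))
      (C.pullback (ContinuousMonoidHom.id Γ) (TrivProd.slice X t) (TrivProd.slice_smul Γ t)) := by
  obtain ⟨⟨d, hd, hs⟩, hu⟩ := hC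
  refine ⟨⟨_, hd.pullback (ContinuousMonoidHom.id Γ') (TrivProd.slice X' t)
    (TrivProd.slice_smul Γ' t), hs.pullback (ContinuousMonoidHom.id Γ') (TrivProd.slice X' t)
    (TrivProd.slice_smul Γ' t)⟩, fun x hx => hu (TrivProd.slice X t x) ?_⟩
  rintro ⟨⟨γ, p⟩, hp⟩
  exact hx ⟨(γ, p.1), congrArg (Prod.fst : X × T → _) hp⟩

variable (hI)

open FredholmFamily in
theorem K0.closure_relations_le_ker (hA : HasAbsorption φ) :
    AddSubgroup.closure (K0.relations Γ' X') ≤ (FreeAbelianGroup.lift fun c : FredholmFamily Γ' X' =>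
      K0.mk (exists_isExtension hI hA c).choose).ker := by
  have spec := fun c => (exists_isExtension hI hA c).choose_spec
  rw [AddSubgroup.closure_le]
  rintro z ((⟨a, b, c, h, rfl⟩ | ⟨a, b, ⟨h, rfl, rfl⟩, rfl⟩) | ⟨a, ha, rfl⟩)
  · change FreeAbelianGroup.lift _ _ = _
    rw [map_sub, map_add, FreeAbelianGroup.lift_apply_of, FreeAbelianGroup.lift_apply_of,
      FreeAbelianGroup.lift_apply_of, ← K0.mk_dsum, sub_eq_zero]
    exact (spec c).mk_eq ((spec a).isDirectSum (spec b) h)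
  · change FreeAbelianGroup.lift _ _ = _
    rw [map_sub, FreeAbelianGroup.lift_apply_of, FreeAbelianGroup.lift_apply_of, sub_eq_zero]
    obtain ⟨C, hC⟩ := exists_isExtension (hI.prod unitInterval) hA h
    rw [(spec _).mk_eq (hC.slice 0), (spec _).mk_eq (hC.slice 1)]
    exact K0.mk_homotopic ⟨C, rfl, rfl⟩
  · change FreeAbelianGroup.lift _ _ = _
    rw [FreeAbelianGroup.lift_apply_of]
    exact K0.mk_degenerate ((spec a).isDegenerate ha)

/-- Extension of classes from `X'` to `X`: induction to the induced space, and zero elsewhere. -/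
def K0.ext (hA : HasAbsorption φ) : K0 Γ' X' →+ K0 Γ X :=
  QuotientAddGroup.lift _ _ (K0.closure_relations_le_ker hI hA)

theorem K0.ext_mk (hA : HasAbsorption φ) {c : FredholmFamily Γ' X'} {C : FredholmFamily Γ X}
    (h : c.IsExtension hI C) : K0.ext hI hA (K0.mk c) = K0.mk C := by
  refine Eq.trans ?_ ((FredholmFamily.exists_isExtension hI hA c).choose_spec.mk_eq h)
  exact FreeAbelianGroup.lift_apply_of _ _

theorem K0.map_ext (hA : HasAbsorption φ) (a : K0 Γ' X') :
    K0.map φ f hI.equivariant (K0.ext hI hA a) = a := by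
  refine DFunLike.congr_fun (f := (K0.map φ f hI.equivariant).comp (K0.ext hI hA))
    (g := AddMonoidHom.id _) (K0.hom_ext fun c => ?_) a
  obtain ⟨C, hC⟩ := FredholmFamily.exists_isExtension hI hA c
  rw [AddMonoidHom.comp_apply, K0.ext_mk hI hA hC, K0.map_mk]
  obtain ⟨⟨d, hd, hs⟩, -⟩ := hC
  rw [K0.mk_isDirectSum hs, K0.mk_degenerate hd, add_zero]
  rfl

omit [IsTopologicalGroup Γ] in
theorem K0.map_mk_eq_zero {Γ₂ : Type*} [Group Γ₂] [TopologicalSpace Γ₂] {X₂ : Type*}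
    [TopologicalSpace X₂] [MulAction Γ₂ X₂] (φ₂ : Γ₂ →ₜ* Γ) (f₂ : C(X₂, X))
    (hf₂ : ∀ (γ : Γ₂) (x : X₂), f₂ (γ • x) = φ₂ γ • f₂ x) {C : FredholmFamily Γ X}
    (h : ∀ x, C.UnitaryAt (f₂ x)) : K0.map φ₂ f₂ hf₂ (K0.mk C) = 0 := by
  rw [K0.map_mk]
  exact K0.mk_degenerate ((FredholmFamily.isDegenerate_iff _).2 h)

end Extension

/-! ### Additivity over induced clopen pieces -/

section Decomposition

variable {Γ : Type*} [Group Γ] [TopologicalSpace Γ] [IsTopologicalGroup Γ] {X : Type*}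
  [TopologicalSpace X] [MulAction Γ X] {ι : Type*} {Γ' : ι → Type*} [∀ i, Group (Γ' i)]
  [∀ i, TopologicalSpace (Γ' i)] {X' : ι → Type*} [∀ i, TopologicalSpace (X' i)]
  [∀ i, MulAction (Γ' i) (X' i)] {φ : ∀ i, Γ' i →ₜ* Γ} {f : ∀ i, C(X' i, X)}
  (hI : ∀ i, IsInduced (φ i) (f i)) (hA : ∀ i, HasAbsorption (φ i))
  (hdisj : ∀ i j, i ≠ j → Disjoint (Set.range (orbitMap Γ (f i))) (Set.range (orbitMap Γ (f j))))

theorem mem_range_orbitMap {Γ X X' : Type*} [Group Γ] [TopologicalSpace X] [TopologicalSpace X']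
    [MulAction Γ X] (f : C(X', X)) (y : X') : f y ∈ Set.range (orbitMap Γ f) :=
  ⟨(1, y), one_smul _ _⟩

include hdisj in
open FredholmFamily in
/-- A family that is unitary off finitely many of the induced subspaces is the sum of the
extensions of its restrictions to these. The subspaces are removed one at a time. -/
theorem K0.mk_eq_sum_ext (s : Finset ι) (D : FredholmFamily Γ X)
    (hD : ∀ x, (∀ i ∈ s, x ∉ Set.range (orbitMap Γ (f i))) → D.UnitaryAt x) :
    K0.mk D = ∑ i ∈ s, K0.ext (hI i) (hA i) (K0.map (φ i) (f i) (hI i).equivariant (K0.mk D)) := by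
  classical
  induction s using Finset.induction_on generalizing D with
  | empty =>
    rw [Finset.sum_empty]
    exact K0.mk_degenerate ((isDegenerate_iff _).2 fun x => hD x (by simp))
  | insert i s hi ih =>
    have hDs : (D.pullback (φ i) (f i) (hI i).equivariant).IsDirectSum _
        ((D.dsum (const X D.E₀)).pullback (φ i) (f i) (hI i).equivariant) :=
      (isDirectSum_dsum D (const X D.E₀)).pullback (φ i) (f i) (hI i).equivariant
    obtain ⟨Di, hDi⟩ := exists_isExtension (hI i) (hA i)
      (D.pullback (φ i) (f i) (hI i).equivariant)
    have hmk : K0.mk Di =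
        K0.ext (hI i) (hA i) (K0.map (φ i) (f i) (hI i).equivariant (K0.mk D)) := by
      rw [K0.map_mk, K0.ext_mk _ _ hDi]
    obtain ⟨⟨d, hd, hs⟩, hu⟩ := hDi
    obtain ⟨D', hD', h₁, h₂⟩ := exists_mk_add_mk_adj (hI i) hDs hs
      ((const_isDegenerate (X := X) D.E₀).pullback (φ i) (f i) (hI i).equivariant) hd
    rw [K0.mk_dsum, K0.mk_degenerate (const_isDegenerate (X := X) D.E₀), add_zero, K0.mk_adj,
      ← sub_eq_add_neg] at hD'
    have h := ih D' fun x hx => by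
      by_cases hxi : x ∈ Set.range (orbitMap Γ (f i))
      · exact h₁ x hxi
      · exact h₂ x ((hD x (Finset.forall_mem_insert _ _ _ |>.2 ⟨hxi, hx⟩)).dsum
          (const_unitaryAt _ x)) (hu x hxi)
    rw [Finset.sum_insert hi, ← hmk, ← sub_eq_iff_eq_add', hD', h]
    refine Finset.sum_congr rfl fun j hj => ?_
    congr 1
    rw [← hD', map_sub, K0.map_mk_eq_zero (φ j) (f j) (hI j).equivariant (C := Di), sub_zero]
    intro x
    refine hu _ fun hx => ?_
    exact Set.disjoint_left.1 (hdisj i j fun e => hi (e ▸ hj)) hx (mem_range_orbitMap (f j) x)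

variable [Fintype ι] (hcov : ∀ x, ∃ i, x ∈ Set.range (orbitMap Γ (f i)))

include hA hdisj hcov in
theorem K0.bijective_restrictions : Function.Bijective fun (a : K0 Γ X) (i : ι) =>
    K0.map (φ i) (f i) (hI i).equivariant a := by
  have hsum : ∀ a : K0 Γ X,
      a = ∑ i, K0.ext (hI i) (hA i) (K0.map (φ i) (f i) (hI i).equivariant a) := by
    intro a
    have := DFunLike.congr_fun (f := AddMonoidHom.id (K0 Γ X)) (g := ∑ i,
      (K0.ext (hI i) (hA i)).comp (K0.map (φ i) (f i) (hI i).equivariant))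
      (K0.hom_ext fun c => ?_) a
    · simpa using this
    · simp only [AddMonoidHom.id_apply, AddMonoidHom.finsetSum_apply, AddMonoidHom.comp_apply]
      refine K0.mk_eq_sum_ext hI hA hdisj _ c fun x hx => ?_
      obtain ⟨i, hi⟩ := hcov x
      exact absurd hi (hx i (Finset.mem_univ i))
  constructor
  · intro a b hab
    rw [hsum a, hsum b]
    exact Finset.sum_congr rfl fun i _ => congrArg _ (congrFun hab i)
  · intro b
    refine ⟨∑ i, K0.ext (hI i) (hA i) (b i), funext fun j => ?_⟩
    beta_reduce
    rw [map_sum, Finset.sum_eq_single j, K0.map_ext]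
    · intro i _ hij
      generalize b i = b at *
      refine DFunLike.congr_fun (f := (K0.map (φ j) (f j) (hI j).equivariant).comp
        (K0.ext (hI i) (hA i))) (g := 0) (K0.hom_ext fun c => ?_) b
      obtain ⟨C, hC⟩ := FredholmFamily.exists_isExtension (hI i) (hA i) c
      rw [AddMonoidHom.comp_apply, K0.ext_mk _ _ hC]
      refine K0.map_mk_eq_zero _ _ _ fun x => hC.2 _ fun hx => ?_
      exact Set.disjoint_left.1 (hdisj i j hij) hx (mem_range_orbitMap (f j) x)
    · simp

omit [Group Γ] [TopologicalSpace Γ] [IsTopologicalGroup Γ] [MulAction Γ X] in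
theorem range_orbitMap_prod (Γ : Type*) [Group Γ] [MulAction Γ X] {X' : Type*}
    [TopologicalSpace X'] (f : C(X', X)) (T : Type*)
    [TopologicalSpace T] (p : TrivProd X T) :
    p ∈ Set.range (orbitMap Γ (TrivProd.map T f)) ↔ p.1 ∈ Set.range (orbitMap Γ f) := by
  constructor
  · rintro ⟨⟨γ, q⟩, rfl⟩
    exact ⟨(γ, q.1), rfl⟩
  · rintro ⟨⟨γ, y⟩, hy⟩
    exact ⟨(γ, (y, p.2)), Prod.ext hy rfl⟩

include hA hdisj hcov in
theorem KGroup.bijective_restrictions (n : ℤ) : Function.Bijective fun (a : KGroup Γ X n) (i : ι) =>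
    KGroup.map n (φ i) (f i) (hI i).equivariant a := by
  have h₀ := K0.bijective_restrictions hI hA hdisj hcov
  have h₁ := K0.bijective_restrictions (fun i => (hI i).prod (Sph n.natAbs)) hA
    (fun i j hij => Set.disjoint_left.2 fun p hi hj => Set.disjoint_left.1 (hdisj i j hij)
      ((range_orbitMap_prod Γ _ _ p).1 hi) ((range_orbitMap_prod Γ _ _ p).1 hj))
    (fun p => (hcov p.1).imp fun i hi => (range_orbitMap_prod Γ _ _ p).2 hi)
  constructor
  · intro a b hab
    exact Subtype.ext (h₁.1 (funext fun i => congrArg Subtype.val (congrFun hab i)))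
  · intro b
    obtain ⟨a, ha⟩ := h₁.2 fun i => (b i).1
    have hmem : a ∈ (K0.map (ContinuousMonoidHom.id Γ) (TrivProd.slice X (Sph.base n.natAbs))
        (TrivProd.slice_smul Γ (Sph.base n.natAbs)) :
        K0 Γ (TrivProd X (Sph n.natAbs)) →+ K0 Γ X).ker := by
      rw [AddMonoidHom.mem_ker]
      refine h₀.1 (funext fun i => ?_)
      beta_reduce
      have hf : ∀ (γ : Γ' i) (x : X' i), (TrivProd.slice X (Sph.base n.natAbs)).comp (f i) (γ • x) =
          φ i γ • (TrivProd.slice X (Sph.base n.natAbs)).comp (f i) x :=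
        fun γ x => Prod.ext ((hI i).equivariant γ x) rfl
      have e₁ := K0.map_map (ContinuousMonoidHom.id Γ) (TrivProd.slice X (Sph.base n.natAbs))
        (TrivProd.slice_smul Γ (Sph.base n.natAbs)) (φ i) (f i) (hI i).equivariant (φ i) _ hf
        rfl rfl a
      have e₂ := K0.map_map (φ i) (TrivProd.map (Sph n.natAbs) (f i))
        (TrivProd.map_smul (Sph n.natAbs) (φ i) (f i) (hI i).equivariant)
        (ContinuousMonoidHom.id (Γ' i)) (TrivProd.slice (X' i) (Sph.base n.natAbs))
        (TrivProd.slice_smul (Γ' i) (Sph.base n.natAbs)) (φ i) _ hf rfl rfl a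
      rw [map_zero, e₁, ← e₂]
      exact (congrArg _ (congrFun ha i)).trans (b i).2
    exact ⟨⟨a, hmem⟩, funext fun i => Subtype.ext (congrFun ha i)⟩

end Decomposition

/-! ### Polar decomposition -/

section Polar

variable {E W : Type*} [NormedAddCommGroup E] [InnerProductSpace ℂ E] [CompleteSpace E]
  [NormedAddCommGroup W] [InnerProductSpace ℂ W] [CompleteSpace W]

/-- The isometric part of the polar decomposition of an injective operator. By uniqueness of the
decomposition it commutes with all the isometries that the operator commutes with. -/
theorem exists_linearIsometry_of_injective (T : E →L[ℂ] W) (hT : Function.Injective T) :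
    ∃ j : E →ₗᵢ[ℂ] W, ∀ (U : E ≃ₗᵢ[ℂ] E) (V : W ≃ₗᵢ[ℂ] W), (∀ v, T (U v) = V (T v)) →
      ∀ v, j (U v) = V (j v) := by
  set A : E →L[ℂ] E := T.adjoint ∘L T with hA
  have hA0 : 0 ≤ A := (ContinuousLinearMap.nonneg_iff_isPositive _).2
    (ContinuousLinearMap.isPositive_adjoint_comp_self T)
  set S : E →L[ℂ] E := CFC.sqrt A with hS
  have hSS : S * S = A := CFC.sqrt_mul_sqrt_self A hA0
  have hSa : S.adjoint = S := (IsSelfAdjoint.of_nonneg (CFC.sqrt_nonneg A)).adjoint_eq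
  have hnorm : ∀ v, ‖T v‖ = ‖S v‖ := fun v => by
    rw [← sq_eq_sq₀ (norm_nonneg _) (norm_nonneg _),
      ContinuousLinearMap.apply_norm_sq_eq_inner_adjoint_left,
      ContinuousLinearMap.apply_norm_sq_eq_inner_adjoint_left, hSa]
    change RCLike.re ⟪A v, v⟫_ℂ = RCLike.re ⟪(S * S) v, v⟫_ℂ
    rw [hSS]
  have hdense : DenseRange S := by
    have : (LinearMap.range S.toLinearMap)ᗮ = ⊥ := by
      rw [Submodule.eq_bot_iff]
      intro v hv
      have h0 : S v = 0 := by
        refine ext_inner_left ℂ fun w => ?_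
        rw [← hSa, ContinuousLinearMap.adjoint_inner_right, inner_zero_right]
        exact hv (S w) ⟨w, rfl⟩
      refine hT (norm_eq_zero.1 ?_ |>.trans (map_zero T).symm)
      rw [hnorm, h0, norm_zero]
    have h := Submodule.topologicalClosure_eq_top_iff.2 this
    exact Submodule.dense_iff_topologicalClosure_eq_top.2 h
  have hb : ∀ v, ‖T v‖ ≤ 1 * ‖S v‖ := fun v => by rw [one_mul, hnorm]
  let j₀ : E →L[ℂ] W := T.toLinearMap.extendOfNorm S.toLinearMap
  have hj : ∀ v, j₀ (S v) = T v := LinearMap.extendOfNorm_eq (f := T.toLinearMap)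
    (e := S.toLinearMap) hdense ⟨1, hb⟩
  refine ⟨⟨j₀.toLinearMap, fun v => ?_⟩, fun U V hUV => ?_⟩
  · refine hdense.induction (P := fun v => ‖j₀ v‖ = ‖v‖) ?_
      (isClosed_eq (by fun_prop) (by fun_prop)) v
    rintro _ ⟨v, rfl⟩
    rw [hj, hnorm]
  · let Uc : E →L[ℂ] E := U.toContinuousLinearEquiv.toContinuousLinearMap
    have hAU : Commute Uc A := by
      ext v
      change U (T.adjoint (T v)) = T.adjoint (T (U v))
      refine ext_inner_left ℂ fun w => ?_
      obtain ⟨w, rfl⟩ := U.surjective w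
      rw [U.inner_map_map, ContinuousLinearMap.adjoint_inner_right,
        ContinuousLinearMap.adjoint_inner_right, hUV, hUV, V.inner_map_map]
    have hSU : ∀ v, S (U v) = U (S v) := by
      have : Commute S Uc := by
        rw [hS, CFC.sqrt]
        exact (hAU.symm).cfcₙ_nnreal _
      exact fun v => congrArg (fun f : E →L[ℂ] E => f v) this.eq
    intro v
    change j₀ (U v) = V (j₀ v)
    refine hdense.induction (P := fun v => j₀ (U v) = V (j₀ v)) ?_
      (isClosed_eq (by fun_prop) (by fun_prop)) v
    rintro _ ⟨v, rfl⟩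
    rw [← hSU, hj, hj, hUV]

end Polar

/-! ### Multiples of a representation -/

section Ell2

open TopologicalSpace

/-- Strong continuity of a representation may be tested on a set of vectors with dense span. -/
theorem continuous_apply_of_dense_span {Γ V : Type*} [Group Γ] [TopologicalSpace Γ]
    [NormedAddCommGroup V] [InnerProductSpace ℂ V] (ρ : Γ →* (V ≃ₗᵢ[ℂ] V)) (s : Set V)
    (hs : (Submodule.span ℂ s).topologicalClosure = ⊤) (h : ∀ v ∈ s, Continuous fun γ => ρ γ v)
    (v : V) : Continuous fun γ => ρ γ v := by
  have hspan : ∀ v ∈ Submodule.span ℂ s, Continuous fun γ => ρ γ v := by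
    intro v hv
    induction hv using Submodule.span_induction with
    | mem v hv => exact h v hv
    | zero => simpa using continuous_const
    | add v w _ _ hv hw => simp only [map_add]; exact hv.add hw
    | smul c v _ hv => simp only [map_smul]; exact hv.const_smul c
  have hd : Dense (Submodule.span ℂ s : Set V) :=
    Submodule.dense_iff_topologicalClosure_eq_top.2 hs
  refine continuous_of_uniform_approx_of_continuous fun u hu => ?_
  obtain ⟨ε, hε, hεu⟩ := Metric.mem_uniformity_dist.1 hu
  obtain ⟨w, hw, hvw⟩ := Metric.dense_iff.1 hd v ε hε
  refine ⟨fun γ => ρ γ w, hspan w hvw, fun γ => hεu ?_⟩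
  rw [(ρ γ).dist_map, dist_comm]
  exact hw

variable {V : Type*} [NormedAddCommGroup V]

theorem memℓp_two_iff {f : ℕ → V} : Memℓp f 2 ↔ Summable fun n => ‖f n‖ ^ 2 := by
  rw [memℓp_gen_iff (by norm_num)]
  norm_num

theorem hasSum_norm_sq_lp (f : lp (fun _ : ℕ => V) 2) :
    HasSum (fun n => ‖f n‖ ^ 2) (‖f‖ ^ 2) := by
  have := lp.hasSum_norm (p := 2) (by norm_num) f
  norm_num at this
  exact this

variable [InnerProductSpace ℂ V]

theorem span_single_topologicalClosure :
    (Submodule.span ℂ {w : lp (fun _ : ℕ => V) 2 | ∃ n v, w = lp.single 2 n v}).topologicalClosure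
      = ⊤ := by
  rw [Submodule.eq_top_iff']
  intro w
  refine mem_closure_of_tendsto (lp.hasSum_single (by norm_num) w) (Filter.Eventually.of_forall ?_)
  exact fun s => Submodule.sum_mem _ fun n _ => Submodule.subset_span ⟨n, _, rfl⟩

theorem separableSpace_ell2 [SeparableSpace V] : SeparableSpace (lp (fun _ : ℕ => V) 2) := by
  have h₁ : IsSeparable {w : lp (fun _ : ℕ => V) 2 | ∃ n v, w = lp.single 2 n v} := by
    have : {w : lp (fun _ : ℕ => V) 2 | ∃ n v, w = lp.single 2 n v} =
        ⋃ n : ℕ, Set.range (lp.single (E := fun _ : ℕ => V) 2 n) := by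
      ext w
      simp [eq_comm]
    rw [this]
    exact IsSeparable.iUnion fun n => isSeparable_range (lp.isometry_single n).continuous
  have h₂ := (h₁.span (R := ℂ)).closure
  rw [← Submodule.topologicalClosure_coe, span_single_topologicalClosure, Submodule.top_coe] at h₂
  exact isSeparable_univ_iff.1 h₂

/-- The coordinatewise action of an isometry on square summable sequences. -/
def ell2Map (u : V ≃ₗᵢ[ℂ] V) : lp (fun _ : ℕ => V) 2 ≃ₗᵢ[ℂ] lp (fun _ : ℕ => V) 2 where
  toFun w := ⟨fun n => u (w n), by
    have := memℓp_two_iff.1 w.2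
    exact memℓp_two_iff.2 (by simpa using this)⟩
  invFun w := ⟨fun n => u.symm (w n), by
    have := memℓp_two_iff.1 w.2
    exact memℓp_two_iff.2 (by simpa using this)⟩
  left_inv w := by ext n; exact u.symm_apply_apply _
  right_inv w := by ext n; exact u.apply_symm_apply _
  map_add' w w' := by ext n; exact map_add u _ _
  map_smul' c w := by ext n; exact map_smul u c _
  norm_map' w := by
    rw [← sq_eq_sq₀ (norm_nonneg _) (norm_nonneg _)]
    refine (hasSum_norm_sq_lp _).unique ?_
    refine (hasSum_norm_sq_lp w).congr_fun ?_
    exact fun n => by simp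

variable {Γ : Type*} [Group Γ] [TopologicalSpace Γ]

/-- The direct sum of countably many copies of a representation. -/
def HilbRep.ell2 (W : HilbRep Γ) : HilbRep Γ where
  V := lp (fun _ : ℕ => W.V) 2
  separable := separableSpace_ell2
  ρ :=
    { toFun := fun γ => ell2Map (W.ρ γ)
      map_one' := by ext w n; exact W.ρ_one _
      map_mul' := fun a b => by ext w n; exact W.ρ_mul _ _ _ }
  continuous_apply := by
    refine continuous_apply_of_dense_span _ _ span_single_topologicalClosure ?_
    rintro _ ⟨n, v, rfl⟩
    refine ((lp.isometry_single n).continuous.comp (W.continuous_apply v)).congr fun γ => ?_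
    ext m
    change lp.single (E := fun _ : ℕ => W.V) 2 n (W.ρ γ v) m =
      W.ρ γ (lp.single (E := fun _ : ℕ => W.V) 2 n v m)
    rw [lp.single_apply, lp.single_apply]
    by_cases h : m = n
    · subst h; simp
    · simp [h]

end Ell2

/-! ### The Eilenberg swindle -/

section Swindle

variable {E W : Type*} [NormedAddCommGroup E] [InnerProductSpace ℂ E] [CompleteSpace E]
  [NormedAddCommGroup W] [InnerProductSpace ℂ W] [CompleteSpace W]

variable (j : E →ₗᵢ[ℂ] W)

/-- The orthogonal projection onto the range of an isometry `j`. -/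
def rangeProj : W →L[ℂ] W := j.toContinuousLinearMap ∘L j.toContinuousLinearMap.adjoint

variable {j}

theorem adjoint_apply_self (v : E) : j.toContinuousLinearMap.adjoint (j v) = v := by
  refine ext_inner_left ℂ fun w => ?_
  rw [ContinuousLinearMap.adjoint_inner_right]
  exact j.inner_map_map w v

theorem rangeProj_apply_self (v : E) : rangeProj j (j v) = j v :=
  congrArg j (adjoint_apply_self v)

theorem rangeProj_rangeProj (w : W) : rangeProj j (rangeProj j w) = rangeProj j w :=
  rangeProj_apply_self _

theorem inner_rangeProj_left (w z : W) : ⟪rangeProj j w, z⟫_ℂ = ⟪w, rangeProj j z⟫_ℂ := by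
  refine (ContinuousLinearMap.adjoint_inner_right j.toContinuousLinearMap _ z).symm.trans ?_
  exact ContinuousLinearMap.adjoint_inner_left j.toContinuousLinearMap _ w

theorem norm_sq_sub_rangeProj_add (w z : W) (hz : rangeProj j z = z) :
    ‖w - rangeProj j w + z‖ ^ 2 = ‖w‖ ^ 2 - ‖rangeProj j w‖ ^ 2 + ‖z‖ ^ 2 := by
  have h : ∀ z, rangeProj j z = z → ⟪w - rangeProj j w, z⟫_ℂ = 0 := fun z hz => by
    rw [← hz, ← inner_rangeProj_left, map_sub, rangeProj_rangeProj, sub_self, inner_zero_left]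
  have h₁ := norm_add_sq_eq_norm_sq_add_norm_sq_of_inner_eq_zero _ _ (h z hz)
  have h₂ := norm_add_sq_eq_norm_sq_add_norm_sq_of_inner_eq_zero _ _
    (h _ (rangeProj_rangeProj w))
  rw [sub_add_cancel] at h₂
  nlinarith

variable (j) in
/-- The part of the swindle that is shifted: `j v, P w₀, P w₁, …`. -/
def swindleShift (v : E) (w : ℕ → W) : ℕ → W
  | 0 => j v
  | k + 1 => rangeProj j (w k)

theorem rangeProj_swindleShift (v : E) (w : ℕ → W) (k : ℕ) :
    rangeProj j (swindleShift j v w k) = swindleShift j v w k := by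
  cases k with
  | zero => exact rangeProj_apply_self v
  | succ k => exact rangeProj_rangeProj _

theorem hasSum_swindle (v : E) (w : lp (fun _ : ℕ => W) 2) :
    HasSum (fun k => ‖w k - rangeProj j (w k) + swindleShift j v w k‖ ^ 2)
      (‖v‖ ^ 2 + ‖w‖ ^ 2) := by
  have h₀ := hasSum_norm_sq_lp w
  have hP : Summable fun k => ‖rangeProj j (w k)‖ ^ 2 := by
    refine (h₀.summable.mul_left (‖rangeProj j‖ ^ 2)).of_nonneg_of_le (fun _ => by positivity)
      fun k => ?_
    rw [← mul_pow]
    exact pow_le_pow_left₀ (norm_nonneg _) ((rangeProj j).le_opNorm _) 2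
  obtain ⟨p, hp⟩ := hP
  have hs : HasSum (fun k => ‖swindleShift j v w k‖ ^ 2) (‖v‖ ^ 2 + p) := by
    rw [← hasSum_nat_add_iff' 1]
    simpa [swindleShift] using hp
  have := (h₀.sub hp).add hs
  have e : ‖w‖ ^ 2 - p + (‖v‖ ^ 2 + p) = ‖v‖ ^ 2 + ‖w‖ ^ 2 := by ring
  rw [e] at this
  refine this.congr_fun fun k => ?_
  exact norm_sq_sub_rangeProj_add _ _ (rangeProj_swindleShift v w k)

variable (j) in
/-- The isometry `(v, w) ↦ (1 - P) w + (j v, P w₀, P w₁, …)` from `E ⊕ ℓ²(W)` to `ℓ²(W)`, where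
`P` is the projection onto the range of `j : E → W`. -/
def swindleIsometry : WithLp 2 (E × lp (fun _ : ℕ => W) 2) →ₗᵢ[ℂ] lp (fun _ : ℕ => W) 2 where
  toFun p := ⟨fun k => p.snd k - rangeProj j (p.snd k) + swindleShift j p.fst p.snd k,
    memℓp_two_iff.2 (hasSum_swindle p.fst p.snd).summable⟩
  map_add' p q := by
    ext k
    cases k with
    | zero =>
      change p.snd 0 + q.snd 0 - rangeProj j (p.snd 0 + q.snd 0) + j (p.fst + q.fst) =
        (p.snd 0 - rangeProj j (p.snd 0) + j p.fst) + (q.snd 0 - rangeProj j (q.snd 0) + j q.fst)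
      rw [map_add, map_add]; abel
    | succ k =>
      change p.snd (k + 1) + q.snd (k + 1) - rangeProj j (p.snd (k + 1) + q.snd (k + 1)) +
        rangeProj j (p.snd k + q.snd k) =
        (p.snd (k + 1) - rangeProj j (p.snd (k + 1)) + rangeProj j (p.snd k)) +
        (q.snd (k + 1) - rangeProj j (q.snd (k + 1)) + rangeProj j (q.snd k))
      rw [map_add, map_add]; abel
  map_smul' c p := by
    ext k
    cases k with
    | zero =>
      change c • p.snd 0 - rangeProj j (c • p.snd 0) + j (c • p.fst) =
        c • (p.snd 0 - rangeProj j (p.snd 0) + j p.fst)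
      rw [map_smul, map_smul, smul_add, smul_sub]
    | succ k =>
      change c • p.snd (k + 1) - rangeProj j (c • p.snd (k + 1)) + rangeProj j (c • p.snd k) =
        c • (p.snd (k + 1) - rangeProj j (p.snd (k + 1)) + rangeProj j (p.snd k))
      rw [map_smul, map_smul, smul_add, smul_sub]
  norm_map' p := by
    rw [← sq_eq_sq₀ (norm_nonneg _) (norm_nonneg _), WithLp.prod_norm_sq_eq_of_L2]
    exact (hasSum_norm_sq_lp _).unique (hasSum_swindle p.fst p.snd)

theorem swindleIsometry_surjective : Function.Surjective (swindleIsometry j) := by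
  intro z
  have h₀ := (hasSum_norm_sq_lp z).summable
  let w : ℕ → W := fun k => (z k - rangeProj j (z k)) + rangeProj j (z (k + 1))
  have hw : Memℓp w 2 := by
    refine memℓp_two_iff.2 ((h₀.add ((summable_nat_add_iff 1).2 h₀ |>.mul_left
      (‖rangeProj j‖ ^ 2))).of_nonneg_of_le (fun _ => by positivity) fun k => ?_)
    rw [norm_sq_sub_rangeProj_add _ _ (rangeProj_rangeProj _), ← mul_pow]
    have := pow_le_pow_left₀ (norm_nonneg _) ((rangeProj j).le_opNorm (z (k + 1))) 2
    have := sq_nonneg ‖rangeProj j (z k)‖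
    linarith
  have hPw : ∀ k, rangeProj j (w k) = rangeProj j (z (k + 1)) := fun k => by
    simp only [w, map_add, map_sub, rangeProj_rangeProj, sub_self, zero_add]
  refine ⟨WithLp.toLp 2 (j.toContinuousLinearMap.adjoint (z 0), ⟨w, hw⟩), ?_⟩
  ext k
  cases k with
  | zero =>
    change w 0 - rangeProj j (w 0) + rangeProj j (z 0) = z 0
    rw [hPw]
    simp only [w]
    abel
  | succ k =>
    change w (k + 1) - rangeProj j (w (k + 1)) + rangeProj j (w k) = z (k + 1)
    rw [hPw, hPw]
    simp only [w]
    abel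

/-- A representation `E` that embeds isometrically in `W` is absorbed by the direct sum of countably
many copies of `W` (the Eilenberg swindle). -/
theorem HilbRep.exists_swindle {Γ Γ' : Type*} [Group Γ] [TopologicalSpace Γ] [Group Γ']
    [TopologicalSpace Γ'] (φ : Γ' →ₜ* Γ) (E : HilbRep Γ') (W : HilbRep Γ) (j : E.V →ₗᵢ[ℂ] W.V)
    (hj : ∀ γ v, j (E.ρ γ v) = W.ρ (φ γ) (j v)) :
    ∃ u : WithLp 2 (E.V × W.ell2.V) ≃ₗᵢ[ℂ] W.ell2.V,
      ∀ γ v w, u (WithLp.toLp 2 (E.ρ γ v, W.ell2.ρ (φ γ) w)) =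
        W.ell2.ρ (φ γ) (u (WithLp.toLp 2 (v, w))) := by
  have hP : ∀ γ w, rangeProj j (W.ρ (φ γ) w) = W.ρ (φ γ) (rangeProj j w) := by
    intro γ w
    have h : ∀ w, j.toContinuousLinearMap.adjoint (W.ρ (φ γ) w) =
        E.ρ γ (j.toContinuousLinearMap.adjoint w) := by
      intro w
      refine ext_inner_left ℂ fun v => ?_
      obtain ⟨v, rfl⟩ := (E.ρ γ).surjective v
      rw [ContinuousLinearMap.adjoint_inner_right, LinearIsometryEquiv.inner_map_map,
        ContinuousLinearMap.adjoint_inner_right]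
      change ⟪j (E.ρ γ v), _⟫_ℂ = _
      rw [hj, LinearIsometryEquiv.inner_map_map]
      rfl
    exact (congrArg j (h w)).trans (hj γ _)
  refine ⟨LinearIsometryEquiv.ofSurjective (swindleIsometry j) swindleIsometry_surjective,
    fun γ v (w : lp (fun _ : ℕ => W.V) 2) => ?_⟩
  refine lp.ext (funext fun k => ?_)
  cases k with
  | zero =>
    change W.ρ (φ γ) (w 0) - rangeProj j (W.ρ (φ γ) (w 0)) + j (E.ρ γ v) =
      W.ρ (φ γ) (w 0 - rangeProj j (w 0) + j v)
    rw [hP, hj, map_add, map_sub]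
  | succ k =>
    change W.ρ (φ γ) (w (k + 1)) - rangeProj j (W.ρ (φ γ) (w (k + 1))) +
      rangeProj j (W.ρ (φ γ) (w k)) =
      W.ρ (φ γ) (w (k + 1) - rangeProj j (w (k + 1)) + rangeProj j (w k))
    rw [hP, hP, map_add, map_sub]

end Swindle

/-! ### Models of Hilbert spaces in `Type` -/

section Transport

/-- A strongly continuous isometric representation on a separable Hilbert space, in whatever
universe, is isomorphic to one on a Hilbert space in `Type`. -/
theorem exists_hilbRep {Γ : Type*} [Group Γ] [TopologicalSpace Γ] {V : Type*}
    [NormedAddCommGroup V] [InnerProductSpace ℂ V] [CompleteSpace V]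
    [TopologicalSpace.SeparableSpace V] (ρ : Γ →* (V ≃ₗᵢ[ℂ] V))
    (hρ : ∀ v, Continuous fun γ => ρ γ v) :
    ∃ (R : HilbRep Γ) (e : V ≃ₗᵢ[ℂ] R.V), ∀ γ v, e (ρ γ v) = R.ρ γ (e v) := by
  obtain ⟨s, b, hb⟩ := exists_hilbertBasis ℂ V
  -- The basis vectors have mutual distance `√2`, so there are countably many of them.
  have hs : s.Countable := by
    have ho : Orthonormal ℂ (fun i : s => (i : V)) := hb ▸ b.orthonormal
    refine Set.PairwiseDisjoint.countable_of_isOpen (s := fun v => Metric.ball v (1 / 2 : ℝ)) ?_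
      (fun v _ => Metric.isOpen_ball) (fun v _ => ⟨v, by simp⟩)
    intro v hv w hw hvw
    refine Metric.ball_disjoint_ball ?_
    have h0 := ho.2 (i := ⟨v, hv⟩) (j := ⟨w, hw⟩) (fun h => hvw (congrArg Subtype.val h))
    have h1 : ‖v‖ = 1 := ho.1 ⟨v, hv⟩
    have h2 : ‖w‖ = 1 := ho.1 ⟨w, hw⟩
    have h3 := norm_sub_sq (𝕜 := ℂ) v w
    rw [h1, h2, show ⟪v, w⟫_ℂ = 0 from h0, map_zero] at h3
    rw [dist_eq_norm]
    nlinarith [norm_nonneg (v - w)]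
  have : Countable s := hs
  obtain ⟨f, hf⟩ := exists_injective_nat s
  let c : s ≃ Set.range f := Equiv.ofInjective f hf
  have b' : HilbertBasis (Set.range f) ℂ V :=
    HilbertBasis.mk (v := fun i => b (c.symm i)) (b.orthonormal.comp _ c.symm.injective) (by
      have : Set.range (fun i => b (c.symm i)) = Set.range b :=
        c.symm.surjective.range_comp b
      rw [this, b.dense_span])
  let e := b'.repr
  have : TopologicalSpace.SeparableSpace (lp (fun _ : Set.range f => ℂ) 2) :=
    e.surjective.denseRange.separableSpace e.continuous
  refine ⟨{ V := lp (fun _ : Set.range f => ℂ) 2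
            ρ :=
              { toFun := fun γ => e.symm.trans ((ρ γ).trans e)
                map_one' := by ext v : 1; simp
                map_mul' := fun a b => by ext v : 1; simp }
            continuous_apply := fun v => e.continuous.comp (hρ (e.symm v)) }, e, fun γ v => ?_⟩
  change e (ρ γ v) = e (ρ γ (e.symm (e v)))
  rw [e.symm_apply_apply]

end Transport

/-! ### The regular representation -/

section Regular

open MeasureTheory

/-- The left regular representation of a compact group `Γ` on `L²(Γ)`, up to isomorphism, together
with the embedding of the continuous functions. -/
theorem exists_regularRep (Γ : Type*) [Group Γ] [TopologicalSpace Γ] [IsTopologicalGroup Γ]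
    [CompactSpace Γ] [T2Space Γ] [SecondCountableTopology Γ] :
    ∃ (R : HilbRep Γ) (ι : C(Γ, ℂ) →L[ℂ] R.V), Function.Injective ι ∧
      ∀ γ (κ : C(Γ, ℂ)), R.ρ γ (ι κ) = ι (κ.comp (ContinuousMap.mulLeft γ⁻¹)) := by
  let _ : MeasurableSpace Γ := borel Γ
  have : BorelSpace Γ := ⟨rfl⟩
  have : Fact ((2 : ENNReal) ≠ ⊤) := ⟨by simp⟩
  let μ : Measure Γ := Measure.haar
  let A : Γ → (Lp ℂ 2 μ →ₗᵢ[ℂ] Lp ℂ 2 μ) := fun γ =>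
    { toFun := fun f => DomMulAct.mk γ⁻¹ • f
      map_add' := fun f g => smul_add _ _ _
      map_smul' := fun c f => smul_comm _ _ _
      norm_map' := fun f => DomMulAct.norm_smul_Lp _ _ }
  have hAm : ∀ a b f, A (a * b) f = A a (A b f) := fun a b f => by
    change DomMulAct.mk (a * b)⁻¹ • f = DomMulAct.mk a⁻¹ • DomMulAct.mk b⁻¹ • f
    rw [smul_smul, mul_inv_rev, DomMulAct.mk_mul]
  have hA1 : ∀ f, A 1 f = f := fun f => by
    change DomMulAct.mk (1 : Γ)⁻¹ • f = f
    rw [inv_one, DomMulAct.mk_one, one_smul]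
  let ρ : Γ →* (Lp ℂ 2 μ ≃ₗᵢ[ℂ] Lp ℂ 2 μ) :=
    { toFun := fun γ => LinearIsometryEquiv.ofSurjective (A γ)
        fun f => ⟨A γ⁻¹ f, by rw [← hAm, mul_inv_cancel, hA1]⟩
      map_one' := LinearIsometryEquiv.ext hA1
      map_mul' := fun a b => LinearIsometryEquiv.ext (hAm a b) }
  obtain ⟨R, e, he⟩ := exists_hilbRep ρ fun f => by
    change Continuous fun γ => DomMulAct.mk γ⁻¹ • f
    have : Continuous fun γ : Γ => DomMulAct.mk γ⁻¹ :=
      DomMulAct.continuous_mk.comp continuous_inv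
    exact this.smul continuous_const
  refine ⟨R, e.toContinuousLinearEquiv.toContinuousLinearMap ∘L ContinuousMap.toLp 2 μ ℂ,
    e.injective.comp (ContinuousMap.toLp_injective μ), fun γ κ => ?_⟩
  exact (he γ _).symm

end Regular

/-! ### Averaged rank one operators -/

section Coefficients

open MeasureTheory

variable {Γ Γ' : Type*} [Group Γ] [TopologicalSpace Γ] [Group Γ'] [TopologicalSpace Γ']
  (φ : Γ' →ₜ* Γ) (E : HilbRep Γ') (R : HilbRep Γ)

theorem continuous_coefficient (w v : E.V) (k : R.V) :
    Continuous fun h : Γ' => ⟪E.ρ h w, v⟫_ℂ • R.ρ (φ h) k :=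
  ((E.continuous_apply w).inner continuous_const).smul
    ((R.continuous_apply k).comp φ.continuous_toFun)

variable [IsTopologicalGroup Γ'] [CompactSpace Γ'] [MeasurableSpace Γ'] [BorelSpace Γ']

theorem integrable_of_continuous {V : Type*} [NormedAddCommGroup V] {f : Γ' → V}
    (hf : Continuous f) : Integrable f (Measure.haar : Measure Γ') :=
  hf.integrable_of_hasCompactSupport (HasCompactSupport.of_compactSpace _)

/-- The value at `v` of the intertwining operator `v ↦ ∫ ⟪h w, v⟫ φ(h) k dh` that is obtained by
averaging a rank one operator over the group. -/
def coefficient (w v : E.V) (k : R.V) : R.V :=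
  ∫ h : Γ', ⟪E.ρ h w, v⟫_ℂ • R.ρ (φ h) k ∂Measure.haar

theorem exists_norm_coefficient_le : ∃ C : ℝ, ∀ (w v : E.V) (k : R.V),
    ‖coefficient φ E R w v k‖ ≤ C * (‖w‖ * ‖v‖ * ‖k‖) := by
  refine ⟨(Measure.haar : Measure Γ').real Set.univ, fun w v k => ?_⟩
  rw [mul_comm]
  refine norm_integral_le_of_norm_le_const (Filter.Eventually.of_forall fun h => ?_)
  rw [norm_smul, LinearIsometryEquiv.norm_map]
  gcongr
  simpa using norm_inner_le_norm (𝕜 := ℂ) (E.ρ h w) v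

variable {E R}

theorem coefficient_add_left (w w' v : E.V) (k : R.V) :
    coefficient φ E R (w + w') v k = coefficient φ E R w v k + coefficient φ E R w' v k := by
  rw [coefficient, coefficient, coefficient,
    ← integral_add (integrable_of_continuous (continuous_coefficient φ E R w v k))
      (integrable_of_continuous (continuous_coefficient φ E R w' v k))]
  simp only [map_add, inner_add_left, add_smul]

theorem coefficient_add (w v v' : E.V) (k : R.V) :
    coefficient φ E R w (v + v') k = coefficient φ E R w v k + coefficient φ E R w v' k := by
  rw [coefficient, coefficient, coefficient,
    ← integral_add (integrable_of_continuous (continuous_coefficient φ E R w v k))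
      (integrable_of_continuous (continuous_coefficient φ E R w v' k))]
  simp only [inner_add_right, add_smul]

theorem coefficient_add_right (w v : E.V) (k k' : R.V) :
    coefficient φ E R w v (k + k') = coefficient φ E R w v k + coefficient φ E R w v k' := by
  rw [coefficient, coefficient, coefficient,
    ← integral_add (integrable_of_continuous (continuous_coefficient φ E R w v k))
      (integrable_of_continuous (continuous_coefficient φ E R w v k'))]
  simp only [map_add, smul_add]

theorem coefficient_smul (c : ℂ) (w v : E.V) (k : R.V) :
    coefficient φ E R w (c • v) k = c • coefficient φ E R w v k := by
  rw [coefficient, coefficient, ← integral_smul]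
  simp only [inner_smul_right, mul_smul]

theorem coefficient_equivariant (γ : Γ') (w v : E.V) (k : R.V) :
    coefficient φ E R w (E.ρ γ v) k = R.ρ (φ γ) (coefficient φ E R w v k) := by
  rw [coefficient, coefficient]
  have h₁ := (R.ρ (φ γ)).toContinuousLinearEquiv.toContinuousLinearMap.integral_comp_comm
    (integrable_of_continuous (continuous_coefficient φ E R w v k))
  refine Eq.trans ?_ h₁
  rw [← integral_mul_left_eq_self _ γ]
  refine integral_congr_ae (Filter.Eventually.of_forall fun h => ?_)
  change ⟪E.ρ (γ * h) w, E.ρ γ v⟫_ℂ • R.ρ (φ (γ * h)) k =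
    R.ρ (φ γ) (⟪E.ρ h w, v⟫_ℂ • R.ρ (φ h) k)
  rw [E.ρ_mul, LinearIsometryEquiv.inner_map_map, map_smul, map_mul, R.ρ_mul]

theorem continuous_coefficient_left (v : E.V) (k : R.V) :
    Continuous fun w => coefficient φ E R w v k := by
  obtain ⟨C, hC⟩ := exists_norm_coefficient_le φ E R
  refine AddMonoidHomClass.continuous_of_bound
    (AddMonoidHom.mk' _ fun w w' => coefficient_add_left φ w w' v k) (C * (‖v‖ * ‖k‖)) fun w => ?_
  refine (hC w v k).trans (le_of_eq ?_)
  ring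

theorem continuous_coefficient_right (w v : E.V) :
    Continuous fun k => coefficient φ E R w v k := by
  obtain ⟨C, hC⟩ := exists_norm_coefficient_le φ E R
  refine AddMonoidHomClass.continuous_of_bound
    (AddMonoidHom.mk' _ fun k k' => coefficient_add_right φ w v k k') (C * (‖w‖ * ‖v‖)) fun k => ?_
  refine (hC w v k).trans (le_of_eq ?_)
  ring

variable (E R) in
/-- The averaged rank one operator `v ↦ ∫ ⟪h w, v⟫ φ(h) k dh`. -/
def coefficientOp (w : E.V) (k : R.V) : E.V →L[ℂ] R.V :=
  LinearMap.mkContinuousOfExistsBound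
    { toFun := fun v => coefficient φ E R w v k
      map_add' := fun v v' => coefficient_add φ w v v' k
      map_smul' := fun c v => coefficient_smul φ c w v k } (by
    obtain ⟨C, hC⟩ := exists_norm_coefficient_le φ E R
    refine ⟨C * (‖w‖ * ‖k‖), fun v => (hC w v k).trans (le_of_eq ?_)⟩
    ring)

/-- The averaged rank one operators with values in the regular representation separate points. The
matrix coefficient `h ↦ ⟪h v, v⟫` is tested against a Tietze extension of its conjugate to `Γ`. -/
theorem eq_zero_of_coefficient_eq_zero [IsTopologicalGroup Γ] [CompactSpace Γ] [T2Space Γ] (hφ : Function.Injective φ)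
    (ι : C(Γ, ℂ) →L[ℂ] R.V) (hι : Function.Injective ι)
    (hρ : ∀ γ (κ : C(Γ, ℂ)), R.ρ γ (ι κ) = ι (κ.comp (ContinuousMap.mulLeft γ⁻¹)))
    (v : E.V) (h : ∀ w k, coefficient φ E R w v k = 0) : v = 0 := by
  let c : C(Γ', ℂ) := ⟨fun h => ⟪E.ρ h v, v⟫_ℂ, (E.continuous_apply v).inner continuous_const⟩
  have he : Topology.IsClosedEmbedding fun h : Γ' => (φ h)⁻¹ :=
    (φ.continuous_toFun.inv).isClosedEmbedding (inv_injective.comp hφ)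
  obtain ⟨κ, hκ⟩ := ContinuousMap.exists_extension he (star c)
  have hκ' : ∀ h, κ (φ h)⁻¹ = star (c h) := fun h => congrArg (fun f : C(Γ', ℂ) => f h) hκ
  let D : C(Γ', C(Γ, ℂ)) := ContinuousMap.curry
    ⟨fun p : Γ' × Γ => κ ((φ p.1)⁻¹ * p.2), by
      refine κ.continuous.comp ?_
      exact ((φ.continuous_toFun.comp continuous_fst).inv).mul continuous_snd⟩
  have hD : Continuous fun h => c h • D h := c.continuous.smul D.continuous
  have h0 : ι (∫ h, c h • D h ∂Measure.haar) = 0 := by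
    rw [← ι.integral_comp_comm (integrable_of_continuous hD), ← h v (ι κ)]
    refine integral_congr_ae (Filter.Eventually.of_forall fun h => ?_)
    change ι (c h • D h) = c h • R.ρ (φ h) (ι κ)
    rw [map_smul, hρ]
    rfl
  have h1 : ∫ h, c h • D h ∂Measure.haar = 0 := hι (h0.trans (map_zero ι).symm)
  have h2 : ∫ h, ‖c h‖ ^ 2 ∂Measure.haar = 0 := by
    let ev : C(Γ, ℂ) →L[ℂ] ℂ := ContinuousMap.evalCLM ℂ (1 : Γ)
    have h3 := ev.integral_comp_comm (integrable_of_continuous hD)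
    rw [h1, map_zero] at h3
    rw [← Complex.ofReal_eq_zero, ← integral_complex_ofReal, ← h3]
    refine integral_congr_ae (Filter.Eventually.of_forall fun h => ?_)
    change ((‖c h‖ ^ 2 : ℝ) : ℂ) = c h * κ ((φ h)⁻¹ * 1)
    rw [mul_one, hκ']
    exact_mod_cast (Complex.mul_conj' (c h)).symm
  by_contra hv
  have h3 : 0 < ∫ h, ‖c h‖ ^ 2 ∂Measure.haar := by
    refine Continuous.integral_pos_of_hasCompactSupport_nonneg_nonzero (x := (1 : Γ'))
      (c.continuous.norm.pow 2) (HasCompactSupport.of_compactSpace _) (fun _ => by positivity) ?_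
    have : c 1 ≠ 0 := by
      change ⟪E.ρ 1 v, v⟫_ℂ ≠ 0
      rw [E.ρ_one]
      exact inner_self_ne_zero.2 hv
    positivity
  exact h3.ne' h2

end Coefficients

/-! ### Absorption of representations -/

section Absorption

variable {V W : Type*} [NormedAddCommGroup V] [InnerProductSpace ℂ V]
  [NormedAddCommGroup W] [InnerProductSpace ℂ W]

/-- Countably many bounded operators combine, after scaling, into one operator to `ℓ²`. -/
theorem exists_ell2_operator (T : ℕ → V →L[ℂ] W) :
    ∃ (S : V →L[ℂ] lp (fun _ : ℕ => W) 2) (c : ℕ → ℂ), (∀ n, c n ≠ 0) ∧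
      ∀ v n, S v n = c n • T n v := by
  let c : ℕ → ℝ := fun n => (1 / 2) ^ n / (1 + ‖T n‖)
  have hc : ∀ n, 0 < c n := fun n => by positivity
  have hb : ∀ v n, ‖(c n : ℂ) • T n v‖ ^ 2 ≤ ‖v‖ ^ 2 * (1 / 4) ^ n := by
    intro v n
    have h1 : ‖(c n : ℂ) • T n v‖ ≤ (1 / 2) ^ n * ‖v‖ := by
      rw [norm_smul, Complex.norm_real, Real.norm_of_nonneg (hc n).le, div_mul_eq_mul_div,
        div_le_iff₀ (by positivity), mul_assoc]
      refine mul_le_mul_of_nonneg_left ?_ (by positivity)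
      have := (T n).le_opNorm v
      nlinarith [norm_nonneg v]
    refine (pow_le_pow_left₀ (norm_nonneg _) h1 2).trans (le_of_eq ?_)
    rw [mul_pow, ← pow_mul, mul_comm n 2, pow_mul]
    norm_num
    ring
  have hg : ∀ v : V, HasSum (fun n => ‖v‖ ^ 2 * (1 / 4 : ℝ) ^ n) (‖v‖ ^ 2 * (1 - 1 / 4)⁻¹) :=
    fun v => (hasSum_geometric_of_lt_one (by norm_num) (by norm_num)).mul_left _
  have hm : ∀ v, Memℓp (fun n => (c n : ℂ) • T n v) 2 := fun v =>
    memℓp_two_iff.2 ((hg v).summable.of_nonneg_of_le (fun _ => by positivity) (hb v))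
  refine ⟨LinearMap.mkContinuous
    { toFun := fun v => ⟨fun n => (c n : ℂ) • T n v, hm v⟩
      map_add' := fun v w => lp.ext (funext fun n => by
        change (c n : ℂ) • T n (v + w) = (c n : ℂ) • T n v + (c n : ℂ) • T n w
        rw [map_add, smul_add])
      map_smul' := fun a v => lp.ext (funext fun n => by
        change (c n : ℂ) • T n (a • v) = a • (c n : ℂ) • T n v
        rw [map_smul, smul_comm]) } 2 fun v => ?_, fun n => c n,
    fun n => Complex.ofReal_ne_zero.2 (hc n).ne', fun v n => rfl⟩
  have h := hasSum_le (hb v) (hasSum_norm_sq_lp ⟨fun n => (c n : ℂ) • T n v, hm v⟩) (hg v)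
  refine le_of_sq_le_sq (h.trans ?_) (by positivity)
  nlinarith [sq_nonneg ‖v‖]

open TopologicalSpace in
/-- Every representation of a closed subgroup of a compact group embeds isometrically in a multiple
of the regular representation of the group. -/
theorem HilbRep.exists_embedding {Γ Γ' : Type*} [Group Γ] [TopologicalSpace Γ]
    [IsTopologicalGroup Γ] [CompactSpace Γ] [T2Space Γ] [Group Γ']
    [TopologicalSpace Γ'] [IsTopologicalGroup Γ'] [CompactSpace Γ'] (φ : Γ' →ₜ* Γ)
    (hφ : Function.Injective φ) (R : HilbRep Γ) (ι : C(Γ, ℂ) →L[ℂ] R.V)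
    (hι : Function.Injective ι)
    (hρ : ∀ γ (κ : C(Γ, ℂ)), R.ρ γ (ι κ) = ι (κ.comp (ContinuousMap.mulLeft γ⁻¹)))
    (E : HilbRep Γ') :
    ∃ j : E.V →ₗᵢ[ℂ] R.ell2.V, ∀ γ v, j (E.ρ γ v) = R.ell2.ρ (φ γ) (j v) := by
  let _ : MeasurableSpace Γ' := borel Γ'
  have : BorelSpace Γ' := ⟨rfl⟩
  let T : ℕ → E.V →L[ℂ] R.V := fun n =>
    coefficientOp φ E R (denseSeq E.V n.unpair.1) (denseSeq R.V n.unpair.2)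
  obtain ⟨S, c, hc, hS⟩ := exists_ell2_operator T
  have hinj : Function.Injective S := by
    refine (injective_iff_map_eq_zero S).2 fun v hv => ?_
    have h0 : ∀ a b, coefficient φ E R (denseSeq E.V a) v (denseSeq R.V b) = 0 := by
      intro a b
      have h := hS v (Nat.pair a b)
      rw [hv] at h
      have h' : T (Nat.pair a b) v = 0 :=
        (smul_eq_zero.1 (h.symm.trans rfl)).resolve_left (hc _)
      simp only [T, Nat.unpair_pair] at h'
      exact h'
    have h1 : ∀ w b, coefficient φ E R w v (denseSeq R.V b) = 0 := fun w b =>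
      congrFun ((denseRange_denseSeq E.V).equalizer (continuous_coefficient_left φ v _)
        continuous_const (funext fun a => h0 a b)) w
    refine eq_zero_of_coefficient_eq_zero φ hφ ι hι hρ v fun w k => ?_
    exact congrFun ((denseRange_denseSeq R.V).equalizer (continuous_coefficient_right φ w v)
        continuous_const (funext fun b => h1 w b)) k
  obtain ⟨j, hj⟩ := exists_linearIsometry_of_injective (W := R.ell2.V) S hinj
  refine ⟨j, fun γ v => hj (E.ρ γ) (R.ell2.ρ (φ γ)) (fun v => lp.ext (funext fun n => ?_)) v⟩
  change S (E.ρ γ v) n = R.ρ (φ γ) (S v n)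
  rw [hS, hS, map_smul]
  exact congrArg (c n • ·) (coefficient_equivariant φ γ _ _ _)

/-- Both representations embed in the same multiple of the regular representation, hence are
absorbed by the direct sum of countably many copies of it. -/
theorem hasAbsorption_of_injective {Γ Γ' : Type*} [Group Γ] [TopologicalSpace Γ]
    [IsTopologicalGroup Γ] [CompactSpace Γ] [T2Space Γ] [SecondCountableTopology Γ] [Group Γ']
    [TopologicalSpace Γ'] [IsTopologicalGroup Γ'] [CompactSpace Γ'] (φ : Γ' →ₜ* Γ)
    (hφ : Function.Injective φ) : HasAbsorption φ := by
  intro E₀ E₁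
  obtain ⟨R, ι, hι, hρ⟩ := exists_regularRep Γ
  obtain ⟨j₀, hj₀⟩ := HilbRep.exists_embedding φ hφ R ι hι hρ E₀
  obtain ⟨j₁, hj₁⟩ := HilbRep.exists_embedding φ hφ R ι hι hρ E₁
  obtain ⟨u₀, hu₀⟩ := HilbRep.exists_swindle φ E₀ R.ell2 j₀ hj₀
  obtain ⟨u₁, hu₁⟩ := HilbRep.exists_swindle φ E₁ R.ell2 j₁ hj₁
  exact ⟨R.ell2.ell2, u₀, u₁, hu₀, hu₁⟩

end Absorption

/-! ### Rigidity of elements of finite order -/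

section Rigidity

open Filter Asymptotics Topology

/-- Coordinates near the identity of a group in which, to first order, multiplication is addition
and conjugation by each element is linear. -/
structure GroupChart (G E : Type*) [Group G] [TopologicalSpace G] [NormedAddCommGroup E]
    [NormedSpace ℝ E] where
  coord : G → E
  dom : Set G
  dom_mem : dom ∈ 𝓝 1
  isCompact_dom : IsCompact dom
  continuousOn : ContinuousOn coord dom
  map_one : coord 1 = 0
  eq_one : ∀ a ∈ dom, coord a = 0 → a = 1
  mul_sub : ∀ δ > 0, ∀ᶠ p : G × G in 𝓝 (1, 1),
    ‖coord (p.1 * p.2) - coord p.1 - coord p.2‖ ≤ δ * ‖coord p.2‖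
  conj : ∀ σ, ∃ A : E →L[ℝ] E, (fun a => coord (σ * a * σ⁻¹) - A (coord a)) =o[𝓝 1] coord

namespace GroupChart

variable {G E : Type*} [Group G] [TopologicalSpace G] [NormedAddCommGroup E]
  [NormedSpace ℝ E] (c : GroupChart G E)

theorem continuousAt : ContinuousAt c.coord 1 := c.continuousOn.continuousAt c.dom_mem

theorem tendsto_zero {ι : Type*} {l : Filter ι} {f : ι → G} (hf : Tendsto f l (𝓝 1)) :
    Tendsto (fun i => c.coord (f i)) l (𝓝 0) := by
  have := c.continuousAt.tendsto.comp hf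
  rwa [c.map_one] at this

/-- The coordinates detect convergence to the identity, by compactness of their domain. -/
theorem exists_norm_lt {U : Set G} (hU : U ∈ 𝓝 1) :
    ∃ ε > 0, ∀ a ∈ c.dom, ‖c.coord a‖ < ε → a ∈ U := by
  have hK : IsCompact (c.dom \ interior U) := c.isCompact_dom.diff isOpen_interior
  rcases (c.dom \ interior U).eq_empty_or_nonempty with h | h
  · exact ⟨1, one_pos, fun a ha _ => interior_subset (Set.sdiff_eq_empty.1 h ha)⟩
  · obtain ⟨a, ha, hmin⟩ := hK.exists_isMinOn h
      ((c.continuousOn.mono Set.sdiff_subset).norm)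
    refine ⟨‖c.coord a‖, ?_, fun b hb hlt => ?_⟩
    · refine norm_pos_iff.2 fun h0 => ha.2 ?_
      rw [c.eq_one a ha.1 h0]
      exact mem_interior_iff_mem_nhds.2 hU
    · by_contra hbU
      exact absurd (hmin ⟨hb, fun h => hbU (interior_subset h)⟩) (not_le.2 hlt)

theorem tendsto_one {ι : Type*} {l : Filter ι} {f : ι → G} (hd : ∀ᶠ i in l, f i ∈ c.dom)
    (hf : Tendsto (fun i => c.coord (f i)) l (𝓝 0)) : Tendsto f l (𝓝 1) := by
  intro U hU
  obtain ⟨ε, hε, h⟩ := c.exists_norm_lt hU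
  change ∀ᶠ i in l, f i ∈ U
  filter_upwards [hd, hf.eventually (Metric.ball_mem_nhds 0 hε)] with i hi hi'
  exact h _ hi (by simpa using hi')

/-- The elements `f i` tend to the identity, with coordinates `x i = O(s i)` up to `o(s i)`. -/
structure HasCoord {ι : Type*} (l : Filter ι) (s : ι → ℝ) (f : ι → G) (x : ι → E) : Prop where
  tendsto : Tendsto f l (𝓝 1)
  isBigO : x =O[l] s
  isLittleO : (fun i => c.coord (f i) - x i) =o[l] s

namespace HasCoord

variable {c} {ι : Type*} {l : Filter ι} {s : ι → ℝ} {f g : ι → G} {x y : ι → E}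

theorem coord_isBigO (hf : c.HasCoord l s f x) : (fun i => c.coord (f i)) =O[l] s := by
  simpa using hf.isLittleO.isBigO.add hf.isBigO

theorem one : c.HasCoord l s (fun _ => 1) (fun _ => 0) :=
  ⟨tendsto_const_nhds, isBigO_zero _ _, by simp [c.map_one]⟩

theorem congr (hf : c.HasCoord l s f x) (h : (fun i => y i - x i) =o[l] s) :
    c.HasCoord l s f y := by
  refine ⟨hf.tendsto, by simpa using h.isBigO.add hf.isBigO, ?_⟩
  simpa using hf.isLittleO.sub h

variable [IsTopologicalGroup G]

theorem mul (hf : c.HasCoord l s f x) (hg : c.HasCoord l s g y) :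
    c.HasCoord l s (fun i => f i * g i) (fun i => x i + y i) := by
  refine ⟨by simpa using hf.tendsto.mul hg.tendsto, hf.isBigO.add hg.isBigO, ?_⟩
  have h : (fun i => c.coord (f i * g i) - c.coord (f i) - c.coord (g i)) =o[l]
      fun i => c.coord (g i) := by
    refine IsLittleO.of_bound fun δ hδ => ?_
    have := hf.tendsto.prodMk_nhds hg.tendsto
    exact this.eventually (c.mul_sub δ hδ)
  refine (((h.trans_isBigO hg.coord_isBigO).add hf.isLittleO).add hg.isLittleO).congr_left ?_
  intro i
  abel

/-- Differentiability of the inverse need not be assumed: apply the estimate for products to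
`f i * (f i)⁻¹ = 1`. -/
theorem inv (hf : c.HasCoord l s f x) : c.HasCoord l s (fun i => (f i)⁻¹) (fun i => -x i) := by
  have ht : Tendsto (fun i => (f i)⁻¹) l (𝓝 1) := by simpa using hf.tendsto.inv
  have h : (fun i => c.coord (f i) + c.coord (f i)⁻¹) =o[l] fun i => c.coord (f i)⁻¹ := by
    refine IsLittleO.of_bound fun δ hδ => ?_
    filter_upwards [(hf.tendsto.prodMk_nhds ht).eventually (c.mul_sub δ hδ)] with i hi
    refine le_trans (le_of_eq ?_) hi
    rw [mul_inv_cancel, c.map_one, ← norm_neg]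
    congr 1
    abel
  have hO : (fun i => c.coord (f i)⁻¹) =O[l] s := by
    refine IsBigO.trans ?_ hf.coord_isBigO
    refine IsBigO.of_bound 2 ?_
    filter_upwards [h.bound (half_pos one_pos)] with i hi
    have := norm_sub_le (c.coord (f i) + c.coord (f i)⁻¹) (c.coord (f i))
    rw [add_sub_cancel_left] at this
    linarith
  refine ⟨ht, hf.isBigO.neg_left, ?_⟩
  refine ((h.trans_isBigO hO).sub hf.isLittleO).congr_left fun i => ?_
  abel

theorem conj (hf : c.HasCoord l s f x) {σ : G} {A : E →L[ℝ] E}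
    (hA : (fun a => c.coord (σ * a * σ⁻¹) - A (c.coord a)) =o[𝓝 1] c.coord) :
    c.HasCoord l s (fun i => σ * f i * σ⁻¹) (fun i => A (x i)) := by
  refine ⟨?_, (A.isBigO_comp x l).trans hf.isBigO, ?_⟩
  · simpa using (hf.tendsto.const_mul σ).mul_const σ⁻¹
  · have h := (hA.comp_tendsto hf.tendsto).trans_isBigO hf.coord_isBigO
    refine (h.add ((A.isBigO_comp _ l).trans_isLittleO hf.isLittleO)).congr_left fun i => ?_
    simp

theorem conj_pow (hf : c.HasCoord l s f x) {σ : G} {A : E →L[ℝ] E}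
    (hA : (fun a => c.coord (σ * a * σ⁻¹) - A (c.coord a)) =o[𝓝 1] c.coord) (j : ℕ) :
    c.HasCoord l s (fun i => σ ^ j * f i * (σ ^ j)⁻¹) (fun i => (A ^ j) (x i)) := by
  induction j with
  | zero => simpa using hf
  | succ j ih =>
    have h := ih.conj hA
    simp only [pow_succ', mul_inv_rev, mul_assoc] at h ⊢
    exact h

theorem pow (hf : c.HasCoord l s f x) (j : ℕ) :
    c.HasCoord l s (fun i => f i ^ j) (fun i => (j : ℝ) • x i) := by
  induction j with
  | zero => simpa using one
  | succ j ih => simpa [pow_succ, add_smul] using ih.mul hf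

end HasCoord

variable [IsTopologicalGroup G]

/-- The coordinates of `u ^ j` are `j` times those of `u`, with a relative error that is uniform in
`j` as long as `j • coord u` stays small. -/
theorem exists_pow_coord {δ : ℝ} (hδ : 0 < δ) : ∃ r > 0, ∀ u ∈ c.dom, ‖c.coord u‖ < r →
    ∀ j : ℕ, j * ‖c.coord u‖ < r →
      u ^ j ∈ c.dom ∧ ‖c.coord (u ^ j) - (j : ℝ) • c.coord u‖ ≤ δ * (j * ‖c.coord u‖) := by
  have h1 := c.mul_sub δ hδ
  have h2 : ∀ᶠ p : G × G in 𝓝 (1, 1), p.1 * p.2 ∈ c.dom := by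
    have : Tendsto (fun p : G × G => p.1 * p.2) (𝓝 (1, 1)) (𝓝 (1 * 1)) :=
      (continuous_mul.tendsto ((1 : G), (1 : G)))
    rw [one_mul] at this
    exact this c.dom_mem
  rw [nhds_prod_eq] at h1 h2
  obtain ⟨U, hU, V, hV, hUV⟩ := mem_prod_iff.1 (h1.and h2)
  obtain ⟨ε, hε, hdom⟩ := c.exists_norm_lt (inter_mem hU hV)
  refine ⟨ε / (1 + δ), by positivity, fun u hu hu1 j => ?_⟩
  have hu' : ‖c.coord u‖ < ε := hu1.trans_le (div_le_self hε.le (by linarith))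
  induction j with
  | zero =>
    intro _
    simpa [c.map_one] using mem_of_mem_nhds c.dom_mem
  | succ j ih =>
    intro hj
    push_cast at hj
    have hj' : j * ‖c.coord u‖ < ε / (1 + δ) := by nlinarith [norm_nonneg (c.coord u)]
    obtain ⟨hm, hn⟩ := ih hj'
    have hlt : ‖c.coord (u ^ j)‖ < ε := by
      have h3 := norm_add_le (c.coord (u ^ j) - (j : ℝ) • c.coord u) ((j : ℝ) • c.coord u)
      rw [sub_add_cancel, norm_smul, Real.norm_natCast] at h3
      rw [lt_div_iff₀ (by positivity)] at hj'
      linarith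
    obtain ⟨h4, h5⟩ := hUV (Set.mk_mem_prod (hdom _ hm hlt).1 (hdom u hu hu').2)
    refine ⟨by rw [pow_succ]; exact h5, ?_⟩
    have h6 := norm_add_le (c.coord (u ^ j * u) - c.coord (u ^ j) - c.coord u)
      (c.coord (u ^ j) - (j : ℝ) • c.coord u)
    have h4' : ‖c.coord (u ^ j * u) - c.coord (u ^ j) - c.coord u‖ ≤ δ * ‖c.coord u‖ := h4
    have e : c.coord (u ^ (j + 1)) - ((j + 1 : ℕ) : ℝ) • c.coord u =
        (c.coord (u ^ j * u) - c.coord (u ^ j) - c.coord u) +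
          (c.coord (u ^ j) - (j : ℝ) • c.coord u) := by
      rw [pow_succ]
      push_cast
      rw [add_smul, one_smul]
      abel
    rw [e]
    push_cast
    linarith

/-- A sequence in a subgroup that tends to the identity in a limiting direction `ξ` may be rescaled:
suitable powers of later terms have the coordinates `t • x k`, to first order. -/
theorem exists_rescale (H : Subgroup G) {v : ℕ → G} (hvH : ∀ k, v k ∈ H) (hvd : ∀ k, v k ∈ c.dom)
    (hv1 : ∀ k, v k ≠ 1) (hv : Tendsto v atTop (𝓝 1)) {ξ : E}
    (hξ : Tendsto (fun k => ‖c.coord (v k)‖⁻¹ • c.coord (v k)) atTop (𝓝 ξ)) {t : ℝ}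
    (ht : 0 < t) (ht1 : t ≤ 1) :
    ∃ b : ℕ → G, (∀ k, b k ∈ H) ∧
      c.HasCoord atTop (fun k => ‖c.coord (v k)‖) b (fun k => t • c.coord (v k)) := by
  have hpos : ∀ k, 0 < ‖c.coord (v k)‖ := fun k =>
    norm_pos_iff.2 fun h => hv1 k (c.eq_one _ (hvd k) h)
  have h0 : Tendsto (fun k => ‖c.coord (v k)‖) atTop (𝓝 0) := by
    simpa using (c.tendsto_zero hv).norm
  have hm : ∀ k, ∃ m, k ≤ m ∧ ‖c.coord (v m)‖ ≤ ‖c.coord (v k)‖ ^ 2 := fun k =>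
    ((eventually_ge_atTop k).and (h0.eventually_le_const (pow_pos (hpos k) 2))).exists
  choose m hkm hm2 using hm
  let j : ℕ → ℕ := fun k => ⌊t * ‖c.coord (v k)‖ / ‖c.coord (v (m k))‖⌋₊
  have hj1 : ∀ k, j k * ‖c.coord (v (m k))‖ ≤ t * ‖c.coord (v k)‖ := fun k => by
    rw [← le_div_iff₀ (hpos _)]
    exact Nat.floor_le (by positivity)
  have hj2 : ∀ k, t * ‖c.coord (v k)‖ - j k * ‖c.coord (v (m k))‖ ≤ ‖c.coord (v k)‖ ^ 2 :=
    fun k => by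
    have := (Nat.lt_floor_add_one (t * ‖c.coord (v k)‖ / ‖c.coord (v (m k))‖)).le
    rw [div_le_iff₀ (hpos _)] at this
    have h2 := hm2 k
    simp only [j]
    linarith
  have hj3 : ∀ k, j k * ‖c.coord (v (m k))‖ ≤ ‖c.coord (v k)‖ := fun k =>
    (hj1 k).trans (mul_le_of_le_one_left (norm_nonneg _) ht1)
  have hmt : Tendsto m atTop atTop := tendsto_atTop_mono hkm tendsto_id
  have hpow : ∀ δ > 0, ∀ᶠ k in atTop, v (m k) ^ j k ∈ c.dom ∧
      ‖c.coord (v (m k) ^ j k) - (j k : ℝ) • c.coord (v (m k))‖ ≤ δ * ‖c.coord (v k)‖ := by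
    intro δ hδ
    obtain ⟨r, hr, h⟩ := c.exists_pow_coord hδ
    filter_upwards [h0.eventually_lt_const hr, (h0.comp hmt).eventually_lt_const hr] with k hk hmk
    obtain ⟨h1, h2⟩ := h _ (hvd (m k)) hmk (j k) ((hj3 k).trans_lt hk)
    exact ⟨h1, h2.trans (mul_le_mul_of_nonneg_left (hj3 k) hδ.le)⟩
  have ho : (fun k => c.coord (v (m k) ^ j k) - t • c.coord (v k)) =o[atTop]
      fun k => ‖c.coord (v k)‖ := by
    have h1 : (fun k => c.coord (v (m k) ^ j k) - (j k : ℝ) • c.coord (v (m k))) =o[atTop]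
        fun k => ‖c.coord (v k)‖ :=
      IsLittleO.of_bound fun δ hδ => by
        filter_upwards [hpow δ hδ] with k hk
        rw [norm_norm]
        exact hk.2
    let d : ℕ → E := fun k => ‖c.coord (v k)‖⁻¹ • c.coord (v k)
    have hd : ∀ k, ‖c.coord (v k)‖ • d k = c.coord (v k) := fun k => by
      simp only [d]
      rw [smul_inv_smul₀ (hpos k).ne']
    have hdo : (fun k => d k - ξ) =o[atTop] fun _ => (1 : ℝ) :=
      (isLittleO_one_iff ℝ).2 (by simpa using hξ.sub_const ξ)
    have h2 : (fun k => (j k * ‖c.coord (v (m k))‖) • (d (m k) - ξ)) =o[atTop]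
        fun k => ‖c.coord (v k)‖ := by
      have := (IsBigO.of_bound 1 (Eventually.of_forall fun k => by
        rw [one_mul, norm_norm, Real.norm_of_nonneg (by positivity)]
        exact hj3 k) : (fun k => j k * ‖c.coord (v (m k))‖) =O[atTop] fun k =>
          ‖c.coord (v k)‖).smul_isLittleO (hdo.comp_tendsto hmt)
      simpa using this
    have h3 : (fun k => (j k * ‖c.coord (v (m k))‖ - t * ‖c.coord (v k)‖) • ξ) =o[atTop]
        fun k => ‖c.coord (v k)‖ := by
      have h4 : (fun k => j k * ‖c.coord (v (m k))‖ - t * ‖c.coord (v k)‖) =O[atTop] fun k =>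
          ‖c.coord (v k)‖ ^ 2 := IsBigO.of_bound 1 (Eventually.of_forall fun k => by
        rw [one_mul, norm_pow, norm_norm, Real.norm_eq_abs, abs_le]
        constructor
        · linarith [hj2 k]
        · have := hj1 k
          nlinarith [sq_nonneg ‖c.coord (v k)‖])
      have h5 : (fun k => ‖c.coord (v k)‖ ^ 2) =o[atTop] fun k => ‖c.coord (v k)‖ := by
        have h6 := (isBigO_refl (fun k => ‖c.coord (v k)‖) atTop).mul_isLittleO
          ((isLittleO_one_iff ℝ).2 h0)
        simpa [sq] using h6
      have := (h4.trans_isLittleO h5).smul_isBigO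
        (isBigO_refl (fun _ : ℕ => ξ) atTop |>.trans (isBigO_const_const ξ (one_ne_zero' ℝ) _))
      simpa using this
    have h4 : (fun k => (t * ‖c.coord (v k)‖) • (d k - ξ)) =o[atTop]
        fun k => ‖c.coord (v k)‖ := by
      have := ((isBigO_refl (fun k => ‖c.coord (v k)‖) atTop).const_mul_left t).smul_isLittleO hdo
      simpa using this
    refine (((h1.add h2).add h3).sub h4).congr_left fun k => ?_
    have e1 := hd k
    have e2 := hd (m k)
    simp only [smul_sub, sub_smul, mul_smul]
    rw [e1, e2]
    abel
  refine ⟨fun k => v (m k) ^ j k, fun k => H.pow_mem (hvH _) _, ?_, ?_, ho⟩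
  · refine c.tendsto_one ((hpow 1 one_pos).mono fun k hk => hk.1) ?_
    have : (fun k => c.coord (v (m k) ^ j k)) =O[atTop] fun k => ‖c.coord (v k)‖ := by
      have := ho.isBigO.add ((isBigO_refl (fun k => c.coord (v k)) atTop).const_smul_left t).norm_right
      simpa using this
    exact this.trans_tendsto h0
  · exact ((isBigO_refl (fun k => c.coord (v k)) atTop).const_smul_left t).norm_right

/-- An element of the twisted class `{h u σ h⁻¹ σ⁻¹}` of `u` that is closest to the identity. -/
theorem exists_min_twisted [T2Space G] [CompactSpace G] {H : Subgroup G}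
    (hH : IsClosed (H : Set G)) (σ u : G) (hu : u ∈ c.dom) :
    ∃ h ∈ H, h * (u * σ) * h⁻¹ * σ⁻¹ ∈ c.dom ∧
      ∀ k ∈ H, k * (u * σ) * k⁻¹ * σ⁻¹ ∈ c.dom →
        ‖c.coord (h * (u * σ) * h⁻¹ * σ⁻¹)‖ ≤ ‖c.coord (k * (u * σ) * k⁻¹ * σ⁻¹)‖ := by
  have hf : Continuous fun h : G => h * (u * σ) * h⁻¹ * σ⁻¹ := by fun_prop
  let S : Set G := {h | h ∈ H ∧ h * (u * σ) * h⁻¹ * σ⁻¹ ∈ c.dom}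
  have hS : IsCompact S := (hH.inter (c.isCompact_dom.isClosed.preimage hf)).isCompact
  obtain ⟨h, hh, hmin⟩ := hS.exists_isMinOn ⟨1, H.one_mem, by simpa using hu⟩
    ((c.continuousOn.comp hf.continuousOn fun h hh => hh.2).norm)
  exact ⟨h, hh.1, hh.2, fun k hk hk' => hmin ⟨hk, hk'⟩⟩

/-- Elements `u i σ` of order dividing `n` that tend to `σ`: the coordinates of `u i` are
annihilated to first order by the norm of the linearized conjugation by `σ`. -/
theorem HasCoord.sum_conj {ι : Type*} {l : Filter ι} {s : ι → ℝ} {v : ι → G} {x : ι → E}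
    (hv : c.HasCoord l s v x) {σ : G} {n : ℕ} (hσn : σ ^ n = 1) (hvn : ∀ i, (v i * σ) ^ n = 1)
    {A : E →L[ℝ] E} (hA : (fun a => c.coord (σ * a * σ⁻¹) - A (c.coord a)) =o[𝓝 1] c.coord) :
    (fun i => ∑ j ∈ Finset.range n, (A ^ j) (x i)) =o[l] s := by
  have h : ∀ m, c.HasCoord l s (fun i => (v i * σ) ^ m * (σ ^ m)⁻¹)
      (fun i => ∑ j ∈ Finset.range m, (A ^ j) (x i)) := by
    intro m
    induction m with
    | zero => simpa using HasCoord.one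
    | succ m ih =>
      have := ih.mul (hv.conj_pow hA m)
      simp only [Finset.sum_range_succ]
      convert this using 2 with i
      rw [pow_succ, pow_succ]
      group
  have := (h n).isLittleO
  simp only [hvn, hσn, inv_one, mul_one, c.map_one, zero_sub] at this
  simpa using this

/-- `(1 - A) ∑ j A ^ j = ∑ A ^ (j + 1) - n A ^ n`, the sums being over `j < n`. -/
theorem sum_twist (A : E →L[ℝ] E) (n : ℕ) (y : E) :
    (∑ j ∈ Finset.range n, (j : ℝ) • (A ^ j) y) - A (∑ j ∈ Finset.range n, (j : ℝ) • (A ^ j) y) =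
      (∑ j ∈ Finset.range n, (A ^ j) (A y)) - (n : ℝ) • (A ^ n) y := by
  induction n with
  | zero => simp
  | succ n ih =>
    have e : (A ^ n) (A y) = (A ^ (n + 1)) y := by rw [pow_succ]; rfl
    have e' : A ((A ^ n) y) = (A ^ (n + 1)) y := by rw [pow_succ']; rfl
    rw [Finset.sum_range_succ, Finset.sum_range_succ _ n, map_add, add_sub_add_comm, ih, map_smul,
      e, e']
    push_cast
    rw [add_smul, one_smul]
    abel

/-- In a closed subgroup, the elements of order dividing `n` close to `σ` are conjugate to `σ`. If
not, let `v k σ → σ` be closest to `σ` in its conjugacy class, for a sequence of such classes. In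
the limiting direction of `v k`, averaging over the powers of `σ` produces an element of the
subgroup that conjugates `v k σ` to an element still closer to `σ`. -/
theorem exists_nhds_conj (c : GroupChart G E) [T2Space G] [CompactSpace G] [FiniteDimensional ℝ E]
    {H : Subgroup G}
    (hH : IsClosed (H : Set G)) {σ : G} (hσ : σ ∈ H) {n : ℕ} (hn : 0 < n) (hσn : σ ^ n = 1) :
    ∃ U ∈ 𝓝 σ, ∀ τ ∈ H, τ ∈ U → τ ^ n = 1 → ∃ h ∈ H, h * τ * h⁻¹ = σ := by
  have : ProperSpace E := FiniteDimensional.proper ℝ E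
  by_contra! hcon
  have hstep : ∀ k : ℕ, ∃ v ∈ H, v ∈ c.dom ∧ v ≠ 1 ∧ ‖c.coord v‖ < 1 / ((k : ℝ) + 1) ∧
      (v * σ) ^ n = 1 ∧ ∀ h ∈ H, h * (v * σ) * h⁻¹ * σ⁻¹ ∈ c.dom →
        ‖c.coord v‖ ≤ ‖c.coord (h * (v * σ) * h⁻¹ * σ⁻¹)‖ := by
    intro k
    have hk : (0 : ℝ) < 1 / ((k : ℝ) + 1) := by positivity
    have hU : ∀ᶠ a in 𝓝 (1 : G), a ∈ c.dom ∧ ‖c.coord a‖ < 1 / ((k : ℝ) + 1) := by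
      have h0 : Tendsto c.coord (𝓝 1) (𝓝 0) := c.tendsto_zero tendsto_id
      refine (show ∀ᶠ a in 𝓝 (1 : G), a ∈ c.dom from c.dom_mem).and ?_
      have := h0.norm
      rw [norm_zero] at this
      exact this.eventually_lt_const hk
    have ht : Tendsto (fun τ : G => τ * σ⁻¹) (𝓝 σ) (𝓝 1) := by
      have : Tendsto (fun τ : G => τ * σ⁻¹) (𝓝 σ) (𝓝 (σ * σ⁻¹)) :=
        (continuous_mul_const σ⁻¹).tendsto σ
      rwa [mul_inv_cancel] at this
    obtain ⟨τ, hτH, ⟨hd, hlt⟩, hτn, hτ⟩ := hcon _ (ht.eventually hU)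
    obtain ⟨h, hhH, hhd, hmin⟩ := c.exists_min_twisted hH σ (τ * σ⁻¹) hd
    rw [inv_mul_cancel_right] at hhd hmin
    have e : ∀ k : G, k * (h * τ * h⁻¹ * σ⁻¹ * σ) * k⁻¹ * σ⁻¹ =
        (k * h) * τ * (k * h)⁻¹ * σ⁻¹ := fun k => by group
    refine ⟨h * τ * h⁻¹ * σ⁻¹, ?_, hhd, fun h1 => ?_, ?_, ?_, fun k hk hkd => ?_⟩
    · exact H.mul_mem (H.mul_mem (H.mul_mem hhH hτH) (H.inv_mem hhH)) (H.inv_mem hσ)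
    · exact hτ h hhH (mul_inv_eq_one.1 h1)
    · have := hmin 1 H.one_mem (by simpa using hd)
      simp only [one_mul, inv_one, mul_one] at this
      exact this.trans_lt hlt
    · rw [inv_mul_cancel_right, conj_pow, hτn]
      group
    · rw [e] at hkd ⊢
      exact hmin _ (H.mul_mem hk hhH) hkd
  choose v hvH hvd hv1 hvlt hvn hmin using hstep
  have hv0 : Tendsto v atTop (𝓝 1) := by
    refine c.tendsto_one (Eventually.of_forall hvd) ?_
    exact squeeze_zero_norm (fun k => (hvlt k).le) tendsto_one_div_add_atTop_nhds_zero_nat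
  have hpos : ∀ k, 0 < ‖c.coord (v k)‖ := fun k =>
    norm_pos_iff.2 fun h => hv1 k (c.eq_one _ (hvd k) h)
  obtain ⟨ξ, -, θ, hθ, hξ⟩ := (isCompact_sphere (0 : E) 1).tendsto_subseq
    (x := fun k => ‖c.coord (v k)‖⁻¹ • c.coord (v k)) fun k => by
      rw [mem_sphere_zero_iff_norm, norm_smul, norm_inv, norm_norm, inv_mul_cancel₀ (hpos k).ne']
  let w : ℕ → G := v ∘ θ
  let s : ℕ → ℝ := fun k => ‖c.coord (w k)‖
  have hw0 : Tendsto w atTop (𝓝 1) := hv0.comp hθ.tendsto_atTop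
  have hn' : (n : ℝ) ≠ 0 := Nat.cast_ne_zero.2 hn.ne'
  obtain ⟨b, hbH, hb⟩ := c.exists_rescale H (v := w) (fun k => hvH _) (fun k => hvd _)
    (fun k => hv1 _) hw0 hξ (t := (n : ℝ)⁻¹) (by positivity)
    (inv_le_one_of_one_le₀ (Nat.one_le_cast.2 hn))
  obtain ⟨A, hA⟩ := c.conj σ
  have hw : c.HasCoord atTop s w (fun k => c.coord (w k)) :=
    ⟨hw0, (isBigO_refl _ _).norm_right, by simp⟩
  -- The conjugating elements `h k = ∏ (σ ^ j * b k * σ⁻¹ ^ j) ^ j`.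
  let h : ℕ → ℕ → G := fun m k =>
    ((List.range m).map fun j => (σ ^ j * b k * (σ ^ j)⁻¹) ^ j).prod
  have hh : ∀ m, c.HasCoord atTop s (h m)
      (fun k => ∑ j ∈ Finset.range m, (j : ℝ) • (A ^ j) ((n : ℝ)⁻¹ • c.coord (w k))) := by
    intro m
    induction m with
    | zero => simpa [h] using HasCoord.one
    | succ m ih =>
      have := ih.mul ((hb.conj_pow hA m).pow m)
      simp only [Finset.sum_range_succ]
      convert this using 2 with k
      simp [h, List.range_succ]
  have hhH : ∀ m k, h m k ∈ H := fun m k => by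
    refine H.list_prod_mem fun a ha => ?_
    obtain ⟨j, -, rfl⟩ := List.mem_map.1 ha
    exact H.pow_mem (H.mul_mem (H.mul_mem (H.pow_mem hσ j) (hbH k)) (H.inv_mem (H.pow_mem hσ j))) _
  have hfin := ((hh n).mul hw).mul (((hh n).conj hA).inv)
  have hAn : (fun k => (A ^ n) (c.coord (w k)) - c.coord (w k)) =o[atTop] s := by
    have := (hw.conj_pow hA n).isLittleO
    simp only [hσn, one_mul, inv_one, mul_one] at this
    exact isLittleO_comm.1 this
  have hsum := hw.sum_conj c hσn (fun k => hvn _) hA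
  have hzero : c.HasCoord atTop s (fun k => h n k * w k * (σ * h n k * σ⁻¹)⁻¹) (fun _ => 0) := by
    refine hfin.congr ?_
    have h1 := ((A.isBigO_comp _ _).trans_isLittleO hsum).const_smul_left (n : ℝ)⁻¹
    refine (h1.sub hAn).neg_left.congr_left fun k => ?_
    have h2 := sum_twist A n ((n : ℝ)⁻¹ • c.coord (w k))
    have h3 : (n : ℝ) • (A ^ n) ((n : ℝ)⁻¹ • c.coord (w k)) = (A ^ n) (c.coord (w k)) := by
      rw [map_smul, smul_inv_smul₀ hn']
    have h4 : ∑ j ∈ Finset.range n, (A ^ j) (A ((n : ℝ)⁻¹ • c.coord (w k))) =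
        (n : ℝ)⁻¹ • A (∑ j ∈ Finset.range n, (A ^ j) (c.coord (w k))) := by
      rw [map_sum, Finset.smul_sum]
      refine Finset.sum_congr rfl fun j _ => ?_
      rw [map_smul, map_smul]
      congr 1
      change (A ^ j * A) _ = (A * A ^ j) _
      rw [← pow_succ, ← pow_succ']
    rw [h3, h4] at h2
    change -((n : ℝ)⁻¹ • A (∑ j ∈ Finset.range n, (A ^ j) (c.coord (w k))) - _) = _
    rw [eq_add_of_sub_eq h2.symm]
    abel
  have hlt : ∀ᶠ k in atTop, ‖c.coord (h n k * w k * (σ * h n k * σ⁻¹)⁻¹)‖ ≤ 1 / 2 * s k := by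
    have := hzero.isLittleO.bound (half_pos one_pos)
    simpa [s] using this
  obtain ⟨k, hk, hkd⟩ := (hlt.and (hzero.tendsto.eventually
    (show ∀ᶠ a in 𝓝 (1 : G), a ∈ c.dom from c.dom_mem))).exists
  have e : h n k * (w k * σ) * (h n k)⁻¹ * σ⁻¹ = h n k * w k * (σ * h n k * σ⁻¹)⁻¹ := by group
  have := hmin (θ k) (h n k) (hhH n k) (by rw [← e] at hkd; exact hkd)
  have h5 := hpos (θ k)
  change ‖c.coord (w k)‖ ≤ ‖c.coord (h n k * (w k * σ) * (h n k)⁻¹ * σ⁻¹)‖ at this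
  rw [e] at this
  have h6 : 0 < s k := h5
  have h7 : s k ≤ _ := this
  linarith

/-- In addition, the conjugating element may be chosen close to the identity. -/
theorem exists_nhds_conj_nhds (c : GroupChart G E) [T2Space G] [CompactSpace G] [FiniteDimensional ℝ E]
    {H : Subgroup G} (hH : IsClosed (H : Set G)) {σ : G} (hσ : σ ∈ H) {n : ℕ} (hn : 0 < n)
    (hσn : σ ^ n = 1) {V : Set G} (hV : V ∈ 𝓝 1) :
    ∃ U ∈ 𝓝 σ, ∀ τ ∈ H, τ ∈ U → τ ^ n = 1 → ∃ h ∈ H, h ∈ V ∧ τ = h * σ * h⁻¹ := by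
  obtain ⟨U, hU, hconj⟩ := c.exists_nhds_conj hH hσ hn hσn
  -- Off `V C`, where `C` is the centralizer of `σ` in `H`, the conjugates of `σ` stay away from it.
  let K : Set G := {h | h ∈ H ∧ ∀ z ∈ H, z * σ = σ * z → h * z⁻¹ ∉ interior V}
  have hK : IsCompact K := by
    have : K = (H : Set G) ∩ ⋂ z ∈ H, ⋂ (_ : z * σ = σ * z), (fun h => h * z⁻¹) ⁻¹' (interior V)ᶜ := by
      ext h
      simp [K]
    rw [this]
    refine (hH.inter (isClosed_biInter fun z _ => isClosed_iInter fun _ => ?_)).isCompact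
    exact (isOpen_interior.isClosed_compl).preimage (continuous_mul_const _)
  have hc : Continuous fun h : G => h * σ * h⁻¹ := by fun_prop
  have hcl : IsClosed ((fun h : G => h * σ * h⁻¹) '' K) := (hK.image hc).isClosed
  have hσK : σ ∉ (fun h : G => h * σ * h⁻¹) '' K := by
    rintro ⟨h, ⟨hhH, hh⟩, he⟩
    refine hh h hhH (mul_inv_eq_iff_eq_mul.1 he) ?_
    rw [mul_inv_cancel]
    exact mem_interior_iff_mem_nhds.2 hV
  refine ⟨U ∩ ((fun h : G => h * σ * h⁻¹) '' K)ᶜ, inter_mem hU (hcl.isOpen_compl.mem_nhds hσK),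
    fun τ hτ hτU hτn => ?_⟩
  obtain ⟨h, hh, he⟩ := hconj τ hτ hτU.1 hτn
  have he' : τ = h⁻¹ * σ * h⁻¹⁻¹ := by rw [← he]; group
  have hnK : h⁻¹ ∉ K := fun hK => hτU.2 ⟨h⁻¹, hK, he'.symm⟩
  have : ∃ z ∈ H, z * σ = σ * z ∧ h⁻¹ * z⁻¹ ∈ interior V := by
    by_contra! hcon
    exact hnK ⟨H.inv_mem hh, hcon⟩
  obtain ⟨z, hz, hzc, hzV⟩ := this
  refine ⟨h⁻¹ * z⁻¹, H.mul_mem (H.inv_mem hh) (H.inv_mem hz), interior_subset hzV, ?_⟩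
  have : z⁻¹ * σ * z = σ := by rw [mul_assoc, ← hzc]; group
  rw [he']
  calc h⁻¹ * σ * h⁻¹⁻¹ = h⁻¹ * (z⁻¹ * σ * z) * h := by rw [this, inv_inv]
    _ = _ := by group

end GroupChart

end Rigidity

/-! ### Charts of a Lie group at the identity -/

section LieGroupChart

open Filter Asymptotics Topology

/-- The coordinates of a compact Lie group given by a chart at the identity. -/
theorem nonempty_groupChart (E : Type*) [NormedAddCommGroup E] [NormedSpace ℝ E]
    (G : Type*) [Group G] [TopologicalSpace G] [IsTopologicalGroup G]
    [CompactSpace G] [T2Space G] [ChartedSpace E G] [LieGroup 𝓘(ℝ, E) ∞ G] :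
    Nonempty (GroupChart G E) := by
  let c : OpenPartialHomeomorph G E := chartAt E (1 : G)
  have h1 : (1 : G) ∈ c.source := mem_chart_source E 1
  have hc1 : c 1 ∈ c.target := c.map_source h1
  have hcs : c.symm (c 1) = 1 := c.left_inv h1
  have hsrc : c.source ∈ 𝓝 (1 : G) := c.open_source.mem_nhds h1
  have hct : Tendsto c (𝓝 1) (𝓝 (c 1)) := (c.continuousAt h1).tendsto
  have hsm : ContMDiffAt 𝓘(ℝ, E) 𝓘(ℝ, E) ∞ c 1 :=
    (contMDiffOn_chart (I := 𝓘(ℝ, E)) (x := (1 : G))).contMDiffAt hsrc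
  have hsymm : ContMDiffAt 𝓘(ℝ, E) 𝓘(ℝ, E) ∞ c.symm (c 1) :=
    (contMDiffOn_chart_symm (I := 𝓘(ℝ, E)) (x := (1 : G))).contMDiffAt
      (c.open_target.mem_nhds hc1)
  obtain ⟨D, hD, hDs, hDc⟩ := local_compact_nhds hsrc
  refine ⟨⟨fun a => c a - c 1, D, hD, hDc, (c.continuousOn.mono hDs).sub continuousOn_const,
    sub_self _, fun a ha h => c.injOn (hDs ha) h1 (sub_eq_zero.1 h), ?_, ?_⟩⟩
  · let m : E × E → E := fun p => c (c.symm p.1 * c.symm p.2)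
    have hm : ContDiffAt ℝ ∞ m (c 1, c 1) := by
      rw [← contMDiffAt_iff_contDiffAt]
      have e : c.symm (c 1) * c.symm (c 1) = 1 := by rw [hcs, one_mul]
      have hf : ContMDiffAt 𝓘(ℝ, E × E) 𝓘(ℝ, E) ∞ (fun p : E × E => c.symm p.1) (c 1, c 1) :=
        ContMDiffAt.comp (c 1, c 1) (g := c.symm) (f := Prod.fst) hsymm contDiffAt_fst.contMDiffAt
      have hg : ContMDiffAt 𝓘(ℝ, E × E) 𝓘(ℝ, E) ∞ (fun p : E × E => c.symm p.2) (c 1, c 1) :=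
        ContMDiffAt.comp (c 1, c 1) (g := c.symm) (f := Prod.snd) hsymm contDiffAt_snd.contMDiffAt
      refine ContMDiffAt.comp (c 1, c 1) (g := c) (f := fun p : E × E => c.symm p.1 * c.symm p.2)
        ?_ (hf.mul hg)
      change ContMDiffAt 𝓘(ℝ, E) 𝓘(ℝ, E) ∞ c (c.symm (c 1) * c.symm (c 1))
      rw [e]
      exact hsm
    have hL := hm.hasStrictFDerivAt (by simp)
    set L := fderiv ℝ m (c 1, c 1)
    have hLy : ∀ y, L (0, y) = y := by
      have h2 : HasFDerivAt (fun y : E => m (c 1, y))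
          (L.comp (ContinuousLinearMap.inr ℝ E E)) (c 1) :=
        hL.hasFDerivAt.comp (c 1) (hasFDerivAt_prodMk_right (c 1) (c 1))
      have h3 : (fun y : E => m (c 1, y)) =ᶠ[𝓝 (c 1)] id := by
        filter_upwards [c.open_target.mem_nhds hc1] with y hy
        simp only [m, hcs, one_mul, id]
        exact c.right_inv hy
      have h4 := (h2.congr_of_eventuallyEq h3.symm).unique (hasFDerivAt_id (c 1))
      exact fun y => congrArg (fun f : E →L[ℝ] E => f y) h4
    intro δ hδ
    have h5 : Tendsto (fun p : G × G => ((c p.1, c p.2), (c p.1, c 1))) (𝓝 (1, 1))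
        (𝓝 ((c 1, c 1), (c 1, c 1))) := by
      have ha : Tendsto (fun p : G × G => c p.1) (𝓝 (1, 1)) (𝓝 (c 1)) :=
        hct.comp continuous_fst.continuousAt
      have hb : Tendsto (fun p : G × G => c p.2) (𝓝 (1, 1)) (𝓝 (c 1)) :=
        hct.comp continuous_snd.continuousAt
      exact (ha.prodMk_nhds hb).prodMk_nhds (ha.prodMk_nhds tendsto_const_nhds)
    have ha : ∀ᶠ p : G × G in 𝓝 (1, 1), p.1 ∈ c.source :=
      (continuous_fst.tendsto ((1 : G), (1 : G))).eventually hsrc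
    have hb : ∀ᶠ p : G × G in 𝓝 (1, 1), p.2 ∈ c.source :=
      (continuous_snd.tendsto ((1 : G), (1 : G))).eventually hsrc
    filter_upwards [h5.eventually (hL.isLittleO.bound hδ), ha, hb] with p hp hpa hpb
    have e : (c p.1, c p.2) - (c p.1, c 1) = (0, c p.2 - c 1) := by simp
    simp only [m, e, hLy, c.left_inv hpa, c.left_inv hpb, hcs, mul_one, Prod.norm_mk, norm_zero,
      norm_nonneg, sup_of_le_right] at hp
    rwa [sub_sub_sub_cancel_right]
  · intro σ
    let k : E → E := fun x => c (σ * c.symm x * σ⁻¹)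
    have hk : ContDiffAt ℝ ∞ k (c 1) := by
      rw [← contMDiffAt_iff_contDiffAt]
      have e : σ * c.symm (c 1) * σ⁻¹ = 1 := by rw [hcs, mul_one, mul_inv_cancel]
      refine ContMDiffAt.comp (c 1) (g := c) (f := fun x : E => σ * c.symm x * σ⁻¹) ?_
        ((contMDiffAt_const.mul hsymm).mul contMDiffAt_const)
      rw [e]
      exact hsm
    have hA := (hk.differentiableAt (by simp)).hasFDerivAt
    refine ⟨fderiv ℝ k (c 1), ?_⟩
    refine (hA.isLittleO.comp_tendsto hct).congr' ?_ EventuallyEq.rfl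
    filter_upwards [hsrc] with a ha
    simp only [k, Function.comp_apply, c.left_inv ha, hcs, mul_one, mul_inv_cancel]

end LieGroupChart

/-! ### The topology of `Λ_G(g)` -/

section LamTopology

open Topology

variable {G : Type*} [Group G]

theorem mem_lamKernel {g : G} {p : Subgroup.centralizer ({g} : Set G) × Multiplicative ℝ} :
    p ∈ lamKernel g ↔ ∃ j : ℤ, g ^ j = p.1 ∧ p.2 = Multiplicative.ofAdd (-(j : ℝ)) := by
  rw [lamKernel, Subgroup.mem_zpowers_iff]
  refine exists_congr fun j => ?_
  rw [Prod.ext_iff, Prod.pow_fst, Prod.pow_snd, Subtype.ext_iff]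
  refine and_congr Iff.rfl ?_
  rw [← ofAdd_zsmul, zsmul_eq_mul, mul_neg, mul_one, eq_comm]

variable [TopologicalSpace G]

/-- The powers of `(g, -1)` form a closed set, as their real coordinates tend to infinity. -/
theorem isClosed_lamKernel [T2Space G] (g : G) :
    IsClosed (lamKernel g : Set (Subgroup.centralizer ({g} : Set G) × Multiplicative ℝ)) := by
  let f : ℤ → Subgroup.centralizer ({g} : Set G) × Multiplicative ℝ := fun j =>
    (⟨g, Subgroup.mem_centralizer_singleton_iff.2 rfl⟩, Multiplicative.ofAdd (-1)) ^ j
  have hs : IsProperMap (Prod.snd ∘ f) := by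
    have h : IsProperMap fun j : ℤ => Multiplicative.ofAdd (-(j : ℝ)) :=
      ((Homeomorph.neg ℝ).isClosedEmbedding.comp Int.isClosedEmbedding_coe_real).isProperMap
    convert h using 2 with j
    change Multiplicative.ofAdd (-1 : ℝ) ^ j = _
    rw [← ofAdd_zsmul, zsmul_eq_mul, mul_neg, mul_one]
  have hf : IsProperMap f := isProperMap_of_comp_of_t2 continuous_of_discreteTopology
    continuous_snd hs
  have : (lamKernel g : Set (Subgroup.centralizer ({g} : Set G) × Multiplicative ℝ)) =
      Set.range f := by
    ext p
    exact Subgroup.mem_zpowers_iff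
  rw [this]
  exact hf.isClosedMap.isClosed_range

variable [IsTopologicalGroup G]

instance [T2Space G] (g : G) : T2Space (Lam g) := by
  have := isClosed_lamKernel g
  infer_instance

instance [T2Space G] [CompactSpace G] (g : G) : CompactSpace (Lam g) := by
  have : CompactSpace (Subgroup.centralizer ({g} : Set G)) :=
    isCompact_iff_compactSpace.1 (Set.isClosed_centralizer ({g} : Set G)).isCompact
  let q : Subgroup.centralizer ({g} : Set G) × ℝ → Lam g := fun p =>
    QuotientGroup.mk (p.1, Multiplicative.ofAdd p.2)
  have hq : Continuous q :=
    continuous_quot_mk.comp (continuous_fst.prodMk (continuous_ofAdd.comp continuous_snd))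
  have hK : IsCompact (q '' (Set.univ ×ˢ Set.Icc 0 1)) :=
    (isCompact_univ.prod isCompact_Icc).image hq
  refine ⟨hK.of_isClosed_subset isClosed_univ fun x _ => ?_⟩
  induction x using QuotientGroup.induction_on with
  | H p =>
    -- The real coordinate is moved into `[0, 1]` by a power of `(g, -1)`.
    obtain ⟨a, t⟩ := p
    let z : Subgroup.centralizer ({g} : Set G) × Multiplicative ℝ :=
      (⟨g, Subgroup.mem_centralizer_singleton_iff.2 rfl⟩, Multiplicative.ofAdd (-1)) ^
        ⌊t.toAdd⌋
    refine ⟨((a, t) * z).map id Multiplicative.toAdd, ⟨trivial, ?_⟩, ?_⟩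
    · have : (((a, t) * z).map id Multiplicative.toAdd).2 = Int.fract t.toAdd := by
        change t.toAdd + (Multiplicative.ofAdd (-1 : ℝ) ^ ⌊t.toAdd⌋).toAdd = _
        rw [← ofAdd_zsmul, toAdd_ofAdd, zsmul_eq_mul, mul_neg, mul_one]
        rfl
      rw [this]
      exact ⟨Int.fract_nonneg _, (Int.fract_lt_one _).le⟩
    · exact QuotientGroup.mk_mul_of_mem (a, t) (Subgroup.zpow_mem _ (Subgroup.mem_zpowers _) _)

end LamTopology

/-! ### Inner automorphisms -/

section Inner

variable {Γ : Type*} [Group Γ] [TopologicalSpace Γ] {X : Type*}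
  [TopologicalSpace X] [MulAction Γ X]

/-- Inner automorphisms act trivially on K-theory: the action of `γ` on the representations is an
isomorphism from a family to its pullback. -/
theorem K0.map_inner (γ : Γ) (φ : Γ →ₜ* Γ) (hφ : ∀ a, φ a = γ * a * γ⁻¹) (f : C(X, X))
    (hfγ : ∀ x, f x = γ • x) (hf : ∀ (a : Γ) (x : X), f (a • x) = φ a • f x) (z : K0 Γ X) :
    K0.map φ f hf z = z := by
  refine DFunLike.congr_fun (g := AddMonoidHom.id _) (K0.hom_ext fun c => ?_) z
  rw [K0.map_mk]
  have h : ∀ (E : HilbRep Γ) (a : Γ) (v : E.V), E.ρ γ (E.ρ a v) = (E.res φ).ρ a (E.ρ γ v) := by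
    intro E a v
    change _ = E.ρ (φ a) (E.ρ γ v)
    rw [hφ, ← E.ρ_mul, ← E.ρ_mul, inv_mul_cancel_right]
  refine (K0.mk_congr (a := c) (b := c.pullback φ f hf) (c.E₀.ρ γ) (c.E₁.ρ γ) (h _) (h _)
    fun x v => ?_).symm
  change c.F (f x) (c.E₀.ρ γ v) = c.E₁.ρ γ (c.F x v)
  rw [hfγ, c.equivariant]

theorem KGroup.map_inner (n : ℤ) (γ : Γ) (φ : Γ →ₜ* Γ) (hφ : ∀ a, φ a = γ * a * γ⁻¹) (f : C(X, X))
    (hfγ : ∀ x, f x = γ • x) (hf : ∀ (a : Γ) (x : X), f (a • x) = φ a • f x)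
    (z : KGroup Γ X n) : KGroup.map n φ f hf z = z :=
  Subtype.ext (K0.map_inner γ φ hφ (TrivProd.map _ f) (fun p => Prod.ext (hfγ p.1) rfl) _ z.1)

end Inner

section InnerLam

variable {G : Type*} [Group G] [TopologicalSpace G] [IsTopologicalGroup G] {X : Type*}
  [TopologicalSpace X] [MulAction G X] [ContinuousSMul G X]

/-- Conjugation by an element `c` of the centralizer of `g` is the inner automorphism of `Λ_G(g)`
given by `[c, 0]`. -/
theorem KLam.map_conj_self (n : ℤ) (c : G) {g : G} (hg : conjHom c g = g)
    (z : KGroup (Lam g) (MulAction.fixedBy X g) n) :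
    KLam.map n (conjHom c) (translateMap X c) (translateMap_smul X c) hg z = z := by
  have hc : c ∈ Subgroup.centralizer ({g} : Set G) :=
    Subgroup.mem_centralizer_singleton_iff.2 (mul_inv_eq_iff_eq_mul.1 hg)
  refine KGroup.map_inner n (QuotientGroup.mk (⟨c, hc⟩, 1)) _ (fun a => ?_) _ (fun x => rfl) _ z
  induction a using QuotientGroup.induction_on with
  | H p =>
    refine congrArg QuotientGroup.mk (Prod.ext rfl ?_)
    change p.2 = 1 * p.2 * 1⁻¹
    rw [one_mul, inv_one, mul_one]

end InnerLam

/-! ### Fixed points of induced spaces -/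

section Components

open Filter Topology

variable {G : Type*} [Group G] [TopologicalSpace G] [IsTopologicalGroup G] (H : Subgroup G)
  (X : Type*) [TopologicalSpace X] [MulAction H X] [ContinuousSMul H X]

/-- The homomorphism `H → G`, `h ↦ k * h * k⁻¹`. -/
def conjIncl (k : G) : H →ₜ* G := (conjHom k).comp (inclHom H)

/-- The map `X → G ×_H X`, `x ↦ [k, x]`. -/
def translateIncl (k : G) : C(X, Induced H X) :=
  (translateMap (Induced H X) k).comp (Induced.incl H X)

variable {H X}

theorem translateIncl_apply (k : G) (x : X) : translateIncl H X k x = Induced.mk H k x := by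
  change Induced.mk H (k * 1) x = _
  rw [mul_one]

theorem translateIncl_smul (k : G) (h : H) (x : X) :
    translateIncl H X k (h • x) = conjIncl H k h • translateIncl H X k x := by
  change k • Induced.incl H X (h • x) = conjHom k h • translateMap (Induced H X) k _
  rw [Induced.incl_smul]
  exact translateMap_smul (Induced H X) k (h : G) (Induced.incl H X x)

omit [TopologicalSpace G] [IsTopologicalGroup G] [TopologicalSpace X] [ContinuousSMul H X] in
theorem Induced.mk_eq_mk {k l : G} {x y : X} :
    Induced.mk H k x = Induced.mk H l y ↔ ∃ h : H, k = l * h ∧ y = h • x := by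
  constructor
  · intro e
    obtain ⟨h, hh⟩ := Quotient.exact (s := inducedSetoid H X) e
    have h₁ : l = k * (h : G)⁻¹ := congrArg Prod.fst hh
    exact ⟨h, by rw [h₁, inv_mul_cancel_right], congrArg Prod.snd hh⟩
  · rintro ⟨h, rfl, rfl⟩
    exact Induced.mk_mul H X l h x

theorem conjIncl_eq_iff {k g : G} {τ : H} : conjIncl H k τ = g ↔ k * τ = g * k :=
  mul_inv_eq_iff_eq_mul

omit [TopologicalSpace X] [ContinuousSMul H X] in
/-- The points of `(G ×_H X)^g` are the `[k, x]` with `τ = k⁻¹ * g * k ∈ H` and `x ∈ X^τ`. -/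
theorem exists_of_mem_fixedBy {k g : G} {x : X}
    (h : Induced.mk H k x ∈ MulAction.fixedBy (Induced H X) g) :
    ∃ τ : H, conjIncl H k τ = g ∧ x ∈ MulAction.fixedBy X τ := by
  rw [MulAction.mem_fixedBy, Induced.smul_mk, Induced.mk_eq_mk] at h
  obtain ⟨τ, h₁, h₂⟩ := h
  exact ⟨τ, conjIncl_eq_iff.2 h₁.symm, h₂.symm⟩

/-- The map `X^τ → (G ×_H X)^g`, `x ↦ [k, x]`, where `g = k * τ * k⁻¹`. -/
def componentMap {k g : G} {τ : H} (hg : conjIncl H k τ = g) :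
    C(MulAction.fixedBy X τ, MulAction.fixedBy (Induced H X) g) :=
  fixedByMap (conjIncl H k) (translateIncl H X k) (translateIncl_smul k) hg

theorem componentMap_val {k g : G} {τ : H} (hg : conjIncl H k τ = g)
    (x : MulAction.fixedBy X τ) : (componentMap hg x : Induced H X) = Induced.mk H k (x : X) :=
  translateIncl_apply k x.1

theorem mem_range_orbitMap_componentMap {k g : G} {τ : H} (hg : conjIncl H k τ = g)
    (y : MulAction.fixedBy (Induced H X) g) :
    y ∈ Set.range (orbitMap (Lam g) (componentMap (X := X) hg)) ↔
      ∃ c ∈ Subgroup.centralizer ({g} : Set G), ∃ x ∈ MulAction.fixedBy X τ,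
        (y : Induced H X) = Induced.mk H (c * k) x := by
  constructor
  · rintro ⟨⟨γ, x⟩, rfl⟩
    induction γ using QuotientGroup.induction_on with
    | H p =>
      refine ⟨p.1, p.1.2, x, x.2, ?_⟩
      change (p.1 : G) • (componentMap hg x : Induced H X) = _
      rw [componentMap_val, Induced.smul_mk]
  · rintro ⟨c, hc, x, hx, hy⟩
    refine ⟨(QuotientGroup.mk (⟨c, hc⟩, 1), ⟨x, hx⟩), Subtype.ext ?_⟩
    change c • (componentMap hg ⟨x, hx⟩ : Induced H X) = _
    rw [componentMap_val, Induced.smul_mk, hy]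

/-- A point `[l, x]` of `(G ×_H X)^g` lies in the orbit of the image of the component map for `k`
if and only if `l` lies in the double coset of `k`. -/
theorem mk_mem_range_componentMap_iff {k l g : G} {τ : H} (hg : conjIncl H k τ = g) (x : X)
    (y : MulAction.fixedBy (Induced H X) g) (hy : (y : Induced H X) = Induced.mk H l x) :
    y ∈ Set.range (orbitMap (Lam g) (componentMap (X := X) hg)) ↔
      ∃ c ∈ Subgroup.centralizer ({g} : Set G), ∃ h : H, l = c * k * h := by
  rw [mem_range_orbitMap_componentMap, hy]
  constructor
  · rintro ⟨c, hc, z, -, he⟩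
    obtain ⟨h, he, -⟩ := Induced.mk_eq_mk.1 he
    exact ⟨c, hc, h, he⟩
  · rintro ⟨c, hc, h, rfl⟩
    obtain ⟨τ', hτ', hx⟩ := exists_of_mem_fixedBy (hy ▸ y.2)
    refine ⟨c, hc, h • x, ?_, Induced.mk_mul H X _ h x⟩
    have e : h * τ' = τ * h := by
      have h₁ := conjIncl_eq_iff.1 hτ'
      have h₂ := conjIncl_eq_iff.1 hg
      have h₃ := Subgroup.mem_centralizer_singleton_iff.1 hc
      refine Subtype.ext (mul_left_cancel (a := c * k) ?_)
      calc c * k * ((h : G) * τ') = c * k * h * τ' := by simp only [mul_assoc]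
        _ = g * (c * k * h) := h₁
        _ = g * c * k * h := by simp only [mul_assoc]
        _ = c * (g * k) * h := by rw [← h₃]; simp only [mul_assoc]
        _ = c * k * (τ * h) := by rw [← h₂]; simp only [mul_assoc]
    rw [MulAction.mem_fixedBy, ← mul_smul, ← e, mul_smul, hx]

/-- The rigidity of elements of finite order in `H`: if `σ ^ n = 1`, the elements of `H` near `σ`
of order dividing `n` are conjugate to `σ` by elements of `H` close to the identity. -/
def Rigid (H : Subgroup G) : Prop :=
  ∀ σ ∈ H, ∀ n, 0 < n → σ ^ n = 1 → ∀ V ∈ 𝓝 (1 : G),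
    ∃ U ∈ 𝓝 σ, ∀ τ ∈ H, τ ∈ U → τ ^ n = 1 → ∃ h ∈ H, h ∈ V ∧ τ = h * σ * h⁻¹

/-- If `k⁻¹ * g * k ∈ H`, then `l` close to `k` with `l⁻¹ * g * l ∈ H` have the form `c * k * h⁻¹`
with `c ∈ C_G(g)` and `h ∈ H` close to the identity. -/
theorem Rigid.eventually (hH : Rigid H) {k g : G} {τ : H} (hg : conjIncl H k τ = g)
    (hfin : IsOfFinOrder g) {N V : Set G} (hN : N ∈ 𝓝 1) (hV : V ∈ 𝓝 1) :
    ∀ᶠ l in 𝓝 k, ∀ τ' : H, conjIncl H l τ' = g →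
      ∃ c ∈ Subgroup.centralizer ({g} : Set G), c ∈ N ∧ ∃ h : H, (h : G) ∈ V ∧
        l = c * k * (h : G)⁻¹ := by
  obtain ⟨n, hn, hgn⟩ := isOfFinOrder_iff_pow_eq_one.1 hfin
  have hpow : ∀ (l : G) (τ' : H), conjIncl H l τ' = g → (τ' : G) ^ n = 1 := by
    intro l τ' h
    have e : (τ' : G) = l⁻¹ * g * l⁻¹⁻¹ := by
      rw [inv_inv, mul_assoc, ← conjIncl_eq_iff.1 h, inv_mul_cancel_left]
    rw [e, conj_pow, hgn]
    group
  have ht : Tendsto (fun p : G × G => p.1 * p.2 * k⁻¹) (𝓝 (k, 1)) (𝓝 1) := by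
    have : Tendsto (fun p : G × G => p.1 * p.2 * k⁻¹) (𝓝 (k, 1)) (𝓝 (k * 1 * k⁻¹)) :=
      Continuous.tendsto (by fun_prop) (k, (1 : G))
    rwa [mul_one, mul_inv_cancel] at this
  have ht' := ht.eventually hN
  rw [nhds_prod_eq] at ht'
  obtain ⟨A, hA, V', hV', hAV⟩ := mem_prod_iff.1 ht'
  obtain ⟨U, hU, hUV⟩ := hH τ τ.2 n hn (hpow k τ hg) _ (inter_mem hV hV')
  have hk : Tendsto (fun l : G => l⁻¹ * g * l) (𝓝 k) (𝓝 (τ : G)) := by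
    have : Tendsto (fun l : G => l⁻¹ * g * l) (𝓝 k) (𝓝 (k⁻¹ * g * k)) :=
      Continuous.tendsto (by fun_prop) k
    rwa [mul_assoc, ← conjIncl_eq_iff.1 hg, inv_mul_cancel_left] at this
  filter_upwards [hA, hk.eventually hU] with l hlA hlU τ' hl
  have e : (τ' : G) = l⁻¹ * g * l := by
    rw [mul_assoc, ← conjIncl_eq_iff.1 hl, inv_mul_cancel_left]
  obtain ⟨h, hh, ⟨hhV, hhV'⟩, hτ'⟩ := hUV τ' τ'.2 (e ▸ hlU) (hpow l τ' hl)
  refine ⟨l * h * k⁻¹, ?_, hAV (Set.mk_mem_prod hlA hhV'), ⟨h, hh⟩, hhV, ?_⟩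
  · rw [Subgroup.mem_centralizer_singleton_iff]
    have h₁ := conjIncl_eq_iff.1 hl
    have h₂ := conjIncl_eq_iff.1 hg
    have h₃ : (τ' : G) * h = h * τ := by rw [hτ', inv_mul_cancel_right]
    calc l * h * k⁻¹ * g = l * h * (k⁻¹ * (g * k)) * k⁻¹ := by group
      _ = l * (h * τ) * k⁻¹ := by rw [← h₂, inv_mul_cancel_left]; group
      _ = (l * τ') * h * k⁻¹ := by rw [← h₃]; group
      _ = g * (l * h * k⁻¹) := by rw [h₁]; group
  · group

theorem Rigid.isOpenMap_orbitMap (hH : Rigid H) {k g : G} {τ : H} (hg : conjIncl H k τ = g)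
    (hfin : IsOfFinOrder g) : IsOpenMap (orbitMap (Lam g) (componentMap (X := X) hg)) := by
  refine IsOpenMap.of_nhds_le ?_
  rintro ⟨γ, x⟩ W hW
  rw [mem_map] at hW
  -- Neighbourhoods of `1` in `C_G(g)` and of `x` in `X`.
  have hcont : Tendsto (fun p : Subgroup.centralizer ({g} : Set G) × MulAction.fixedBy X τ =>
      ((γ * QuotientGroup.mk (p.1, 1) : Lam g), p.2)) (𝓝 (1, x)) (𝓝 (γ, x)) := by
    have h1 : Continuous fun p : Subgroup.centralizer ({g} : Set G) × MulAction.fixedBy X τ =>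
        ((γ * QuotientGroup.mk (p.1, 1) : Lam g), p.2) := by
      refine Continuous.prodMk (continuous_const.mul (continuous_quot_mk.comp ?_)) continuous_snd
      exact continuous_fst.prodMk continuous_const
    have h2 := h1.tendsto (1, x)
    have h3 : (γ * QuotientGroup.mk ((1 : Subgroup.centralizer ({g} : Set G)), (1 : Multiplicative ℝ))
        : Lam g) = γ := mul_one γ
    simp only [h3] at h2
    exact h2
  have hW' := hcont hW
  rw [mem_map, nhds_prod_eq] at hW'
  obtain ⟨N₀, hN₀, M₀, hM₀, hNM⟩ := mem_prod_iff.1 hW'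
  obtain ⟨N, hN, hNN⟩ := mem_nhds_induced _ _ _ |>.1 hN₀
  obtain ⟨M, hM, hMM⟩ := mem_nhds_induced _ _ _ |>.1 hM₀
  have hact : Tendsto (fun p : H × X => p.1⁻¹ • p.2) (𝓝 (1, (x : X))) (𝓝 (x : X)) := by
    have : Tendsto (fun p : H × X => p.1⁻¹ • p.2) (𝓝 (1, (x : X))) (𝓝 ((1 : H)⁻¹ • (x : X))) :=
      Continuous.tendsto (by fun_prop) ((1 : H), (x : X))
    rwa [inv_one, one_smul] at this
  have hM' := hact hM
  rw [mem_map, nhds_prod_eq] at hM'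
  obtain ⟨V₀, hV₀, M', hM', hVM⟩ := mem_prod_iff.1 hM'
  obtain ⟨V, hV, hVV⟩ := mem_nhds_induced _ _ _ |>.1 hV₀
  have hev := hH.eventually hg hfin hN hV
  -- Points of `G ×_H X` close to `[k, x]` are represented by pairs close to `(k, x)`.
  have hQ : Quotient.mk (inducedSetoid H X) '' ({l | ∀ τ' : H, conjIncl H l τ' = g →
      ∃ c ∈ Subgroup.centralizer ({g} : Set G), c ∈ N ∧ ∃ h : H, (h : G) ∈ V ∧
        l = c * k * (h : G)⁻¹} ×ˢ M') ∈ 𝓝 (Induced.mk H k (x : X)) :=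
    (Induced.isOpenQuotientMap H X).isOpenMap.image_mem_nhds (prod_mem_nhds hev hM')
  have hγ : Tendsto (fun y : MulAction.fixedBy (Induced H X) g =>
      ((γ⁻¹ • y : MulAction.fixedBy (Induced H X) g) : Induced H X))
      (𝓝 (orbitMap (Lam g) (componentMap hg) (γ, x))) (𝓝 (Induced.mk H k (x : X))) := by
    have h1 : Continuous fun y : MulAction.fixedBy (Induced H X) g =>
        ((γ⁻¹ • y : MulAction.fixedBy (Induced H X) g) : Induced H X) := by
      induction γ using QuotientGroup.induction_on with
      | H p =>
        change Continuous fun y : MulAction.fixedBy (Induced H X) g =>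
          ((p⁻¹).1 : G) • (y : Induced H X)
        exact continuous_subtype_val.const_smul ((p⁻¹).1 : G)
    have h2 := h1.tendsto (orbitMap (Lam g) (componentMap hg) (γ, x))
    have h3 : γ⁻¹ • orbitMap (Lam g) (componentMap (X := X) hg) (γ, x) = componentMap hg x :=
      inv_smul_smul γ _
    rwa [h3, componentMap_val] at h2
  filter_upwards [hγ hQ] with y hy
  obtain ⟨⟨l, x'⟩, ⟨hl, hx'⟩, hlx⟩ := hy
  change Induced.mk H l x' = ((γ⁻¹ • y : MulAction.fixedBy (Induced H X) g) : Induced H X) at hlx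
  obtain ⟨τ', hτ', hfix⟩ := exists_of_mem_fixedBy (hlx ▸ (γ⁻¹ • y).2)
  obtain ⟨c, hc, hcN, h, hhV, rfl⟩ := hl τ' hτ'
  have hx'' : Induced.mk H (c * k * (h : G)⁻¹) x' = Induced.mk H (c * k) (h⁻¹ • x') :=
    Induced.mk_mul H X (c * k) h⁻¹ x'
  have hfix' : h⁻¹ • x' ∈ MulAction.fixedBy X τ := by
    have hck : conjIncl H (c * k) τ = g := by
      have h₂ := conjIncl_eq_iff.1 hg
      have h₃ := Subgroup.mem_centralizer_singleton_iff.1 hc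
      rw [conjIncl_eq_iff, mul_assoc, h₂, ← mul_assoc, h₃, mul_assoc]
    obtain ⟨τ'', h₁, h₂⟩ := exists_of_mem_fixedBy (hx'' ▸ hlx ▸ (γ⁻¹ • y).2)
    have : τ'' = τ := Subtype.ext (mul_left_cancel
      ((conjIncl_eq_iff.1 h₁).trans (conjIncl_eq_iff.1 hck).symm))
    exact this ▸ h₂
  have hmem : ((γ * QuotientGroup.mk ((⟨c, hc⟩ : Subgroup.centralizer ({g} : Set G)), 1) : Lam g),
      (⟨h⁻¹ • x', hfix'⟩ : MulAction.fixedBy X τ)) ∈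
      orbitMap (Lam g) (componentMap (X := X) hg) ⁻¹' W :=
    hNM (Set.mk_mem_prod (hNN hcN) (hMM (hVM (Set.mk_mem_prod (hVV hhV) hx'))))
  have hval : orbitMap (Lam g) (componentMap (X := X) hg)
      ((γ * QuotientGroup.mk ((⟨c, hc⟩ : Subgroup.centralizer ({g} : Set G)), 1) : Lam g),
      (⟨h⁻¹ • x', hfix'⟩ : MulAction.fixedBy X τ)) = y := by
    change (γ * _) • componentMap hg _ = y
    rw [mul_smul, smul_eq_iff_eq_inv_smul]
    refine Subtype.ext ?_
    change c • (componentMap hg ⟨h⁻¹ • x', hfix'⟩ : Induced H X) = _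
    rw [componentMap_val, Induced.smul_mk, ← hlx]
    exact hx''.symm
  rw [← hval]
  exact hmem

theorem Rigid.isInduced (hH : Rigid H) {k g : G} {τ : H} (hg : conjIncl H k τ = g)
    (hfin : IsOfFinOrder g) :
    IsInduced (Lam.map (conjIncl H k) hg) (componentMap (X := X) hg) where
  equivariant := fixedByMap_smul _ _ _ hg
  isOpenMap := hH.isOpenMap_orbitMap hg hfin
  isClosed_range := by
    -- The complement is the union of the ranges for the other double cosets, which are open.
    refine isOpen_compl_iff.1 (isOpen_iff_mem_nhds.2 fun y hy => ?_)
    obtain ⟨⟨l, x⟩, hlx⟩ := Quotient.exists_rep (s := inducedSetoid H X) y.1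
    have hlx' : (y : Induced H X) = Induced.mk H l x := hlx.symm
    obtain ⟨τ', hτ', -⟩ := exists_of_mem_fixedBy (hlx' ▸ y.2)
    have hyl : y ∈ Set.range (orbitMap (Lam g) (componentMap (X := X) hτ')) :=
      (mk_mem_range_componentMap_iff hτ' x y hlx').2 ⟨1, Subgroup.one_mem _, 1, by simp⟩
    refine mem_of_superset ((hH.isOpenMap_orbitMap hτ' hfin).isOpen_range.mem_nhds hyl) ?_
    intro z hz hz'
    obtain ⟨⟨m, w⟩, hmw⟩ := Quotient.exists_rep (s := inducedSetoid H X) z.1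
    have hmw' : (z : Induced H X) = Induced.mk H m w := hmw.symm
    obtain ⟨c₁, hc₁, h₁, rfl⟩ := (mk_mem_range_componentMap_iff hτ' w z hmw').1 hz
    obtain ⟨c₂, hc₂, h₂, e⟩ := (mk_mem_range_componentMap_iff hg w z hmw').1 hz'
    refine hy ((mk_mem_range_componentMap_iff hg x y hlx').2
      ⟨c₁⁻¹ * c₂, mul_mem (inv_mem hc₁) hc₂, h₂ * h₁⁻¹, ?_⟩)
    rw [Subgroup.coe_mul, Subgroup.coe_inv, ← mul_assoc, mul_assoc c₁⁻¹, mul_assoc c₁⁻¹, ← e]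
    group
  exists_of_eq γ x y h := by
    induction γ using QuotientGroup.induction_on with
    | H p =>
      have e : Induced.mk H k (y : X) = Induced.mk H ((p.1 : G) * k) (x : X) := by
        rw [← componentMap_val hg, h, Lam.coe_mk_smul, componentMap_val, Induced.smul_mk]
      obtain ⟨h, e₁, e₂⟩ := Induced.mk_eq_mk.1 e.symm
      have hk := conjIncl_eq_iff.1 hg
      have hp := Subgroup.mem_centralizer_singleton_iff.1 p.1.2
      have hc : h ∈ Subgroup.centralizer ({τ} : Set H) := by
        rw [Subgroup.mem_centralizer_singleton_iff]
        refine Subtype.ext (mul_left_cancel (a := k) ?_)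
        rw [Subgroup.coe_mul, Subgroup.coe_mul, ← mul_assoc, ← mul_assoc, ← e₁, hk, mul_assoc, hk,
          mul_assoc, ← e₁, ← mul_assoc, hp, mul_assoc]
      refine ⟨QuotientGroup.mk (⟨h, hc⟩, p.2), ?_, Subtype.ext e₂⟩
      refine congrArg QuotientGroup.mk (Prod.ext (Subtype.ext ?_) rfl)
      change (p.1 : G) = k * h * k⁻¹
      rw [← e₁, mul_inv_cancel_right]

omit [IsTopologicalGroup G] in
theorem Lam.map_injective {G' : Type*} [Group G'] [TopologicalSpace G'] {φ : G' →ₜ* G}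
    (hφ : Function.Injective φ) {g' : G'} {g : G} (hg : φ g' = g) :
    Function.Injective (Lam.map φ hg) := by
  refine (injective_iff_map_eq_one (Lam.map φ hg)).2 fun γ hγ => ?_
  induction γ using QuotientGroup.induction_on with
  | H p =>
    obtain ⟨_, e⟩ := Lam.map_mk φ hg p
    rw [e, QuotientGroup.eq_one_iff, mem_lamKernel] at hγ
    obtain ⟨j, h₁, h₂⟩ := hγ
    refine (QuotientGroup.eq_one_iff _).2 (mem_lamKernel.2 ⟨j, hφ ?_, h₂⟩)
    rw [map_zpow, hg]
    exact h₁

end Components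

/-! ### The decomposition over double cosets -/

section DoubleCosets

open Filter Topology

variable {G : Type*} [Group G] [TopologicalSpace G] [IsTopologicalGroup G] (H : Subgroup G)

/-- The equivalence relation on `{k | k⁻¹ * g * k ∈ H}` whose classes are the double cosets of
`C_G(g)` and `H`. -/
def conjSetoid (g : G) : Setoid {k : G // ∃ τ : H, conjIncl H k τ = g} where
  r k l := ∃ c ∈ Subgroup.centralizer ({g} : Set G), ∃ h : H, (l : G) = c * k * h
  iseqv :=
    { refl := fun k => ⟨1, one_mem _, 1, by simp⟩
      symm := by
        rintro k l ⟨c, hc, h, e⟩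
        exact ⟨c⁻¹, inv_mem hc, h⁻¹, by rw [e, Subgroup.coe_inv]; group⟩
      trans := by
        rintro k l m ⟨c, hc, h, e⟩ ⟨c', hc', h', e'⟩
        exact ⟨c' * c, mul_mem hc' hc, h * h', by rw [e', e, Subgroup.coe_mul]; group⟩ }

variable {H}

/-- There are finitely many classes, as they are open in a compact set. -/
theorem Rigid.finite_quotient [CompactSpace G] (hH : Rigid H) (hcl : IsClosed (H : Set G)) {g : G}
    (hfin : IsOfFinOrder g) : Finite (Quotient (conjSetoid H g)) := by
  have e : {k : G | ∃ τ : H, conjIncl H k τ = g} = (fun k : G => k⁻¹ * g * k) ⁻¹' (H : Set G) := by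
    ext k
    constructor
    · rintro ⟨τ, hτ⟩
      have : k⁻¹ * g * k = τ := by rw [mul_assoc, ← conjIncl_eq_iff.1 hτ, inv_mul_cancel_left]
      change k⁻¹ * g * k ∈ H
      rw [this]
      exact τ.2
    · intro hk
      refine ⟨⟨k⁻¹ * g * k, hk⟩, conjIncl_eq_iff.2 ?_⟩
      change k * (k⁻¹ * g * k) = g * k
      group
  have hc : IsClosed {k : G | ∃ τ : H, conjIncl H k τ = g} := by
    rw [e]
    exact hcl.preimage (by fun_prop)
  have : CompactSpace {k : G // ∃ τ : H, conjIncl H k τ = g} :=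
    isCompact_iff_compactSpace.1 hc.isCompact
  have : DiscreteTopology (Quotient (conjSetoid H g)) := by
    refine discreteTopology_iff_isOpen_singleton.2 fun q => ?_
    obtain ⟨⟨k, τ, hg⟩, rfl⟩ := Quotient.exists_rep q
    refine (isQuotientMap_quotient_mk' (s := conjSetoid H g)).isOpen_preimage.1
      (isOpen_iff_mem_nhds.2 ?_)
    rintro ⟨l, τ', hl⟩ hlq
    have hev := hH.eventually hl hfin univ_mem univ_mem
    have hval : Tendsto (Subtype.val : {k : G // ∃ τ : H, conjIncl H k τ = g} → G)
        (𝓝 ⟨l, τ', hl⟩) (𝓝 l) := continuous_subtype_val.tendsto _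
    filter_upwards [hval.eventually hev] with m hm
    obtain ⟨τ'', hm'⟩ := m.2
    obtain ⟨c, hc, -, h, -, hml⟩ := hm τ'' hm'
    have : Quotient.mk (conjSetoid H g) m = Quotient.mk (conjSetoid H g) ⟨l, τ', hl⟩ :=
      (Quotient.sound (s := conjSetoid H g) ⟨c, hc, h⁻¹, hml⟩).symm
    exact this.trans hlq
  exact finite_of_compact_of_discrete

/-- A representative of a double coset. -/
def rep {g : G} (i : Quotient (conjSetoid H g)) : G := i.out.1

/-- The element `k⁻¹ * g * k` of `H`, for the representative `k` of a double coset. -/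
def repElem {g : G} (i : Quotient (conjSetoid H g)) : H := i.out.2.choose

theorem conjIncl_rep {g : G} (i : Quotient (conjSetoid H g)) :
    conjIncl H (rep i) (repElem i) = g :=
  i.out.2.choose_spec

theorem exists_rep_eq {k g : G} {τ : H} (hg : conjIncl H k τ = g) :
    ∃ i : Quotient (conjSetoid H g), ∃ c ∈ Subgroup.centralizer ({g} : Set G), ∃ h : H,
      k = c * rep i * h :=
  ⟨Quotient.mk _ ⟨k, τ, hg⟩, Quotient.exact (s := conjSetoid H g)
    (Quotient.out_eq (Quotient.mk (conjSetoid H g) ⟨k, τ, hg⟩))⟩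

theorem eq_of_rep_eq {g : G} {i j : Quotient (conjSetoid H g)} {c : G}
    (hc : c ∈ Subgroup.centralizer ({g} : Set G)) {h : H} (e : rep j = c * rep i * h) : i = j := by
  rw [← Quotient.out_eq i, ← Quotient.out_eq j]
  exact Quotient.sound (s := conjSetoid H g) ⟨c, hc, h, e⟩

/-- `K^n_{Λ_G(g)}((G ×_H X)^g)` is the product of the groups `K^n_{Λ_H(τ)}(X^τ)` over the double
cosets. -/
theorem Rigid.bijective_components [CompactSpace G] [T2Space G] [SecondCountableTopology G]
    (hH : Rigid H) (hcl : IsClosed (H : Set G)) (X : Type*) [TopologicalSpace X] [MulAction H X]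
    [ContinuousSMul H X] (n : ℤ) {g : G} (hfin : IsOfFinOrder g) :
    Function.Bijective fun (a : KGroup (Lam g) (MulAction.fixedBy (Induced H X) g) n)
      (i : Quotient (conjSetoid H g)) =>
        KLam.map n (conjIncl H (rep i)) (translateIncl H X (rep i)) (translateIncl_smul (rep i))
          (conjIncl_rep i) a := by
  have := hH.finite_quotient hcl hfin
  have := Fintype.ofFinite (Quotient (conjSetoid H g))
  have : CompactSpace H := isCompact_iff_compactSpace.1 hcl.isCompact
  have : SecondCountableTopology (Subgroup.centralizer ({g} : Set G)) :=
    TopologicalSpace.Subtype.secondCountableTopology _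
  have hinj : ∀ i : Quotient (conjSetoid H g), Function.Injective (conjIncl H (rep i)) := fun i =>
    (MulAut.conj (rep i)).injective.comp Subtype.val_injective
  refine KGroup.bijective_restrictions (fun i => hH.isInduced (X := X) (conjIncl_rep i) hfin)
    (fun i => hasAbsorption_of_injective _ (Lam.map_injective (hinj i) (conjIncl_rep i)))
    (fun i j hij => Set.disjoint_left.2 fun y hi hj => hij ?_) (fun y => ?_) n
  · obtain ⟨⟨l, x⟩, hlx⟩ := Quotient.exists_rep (s := inducedSetoid H X) y.1
    obtain ⟨c₁, hc₁, h₁, e₁⟩ := (mk_mem_range_componentMap_iff _ x y hlx.symm).1 hi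
    obtain ⟨c₂, hc₂, h₂, e₂⟩ := (mk_mem_range_componentMap_iff _ x y hlx.symm).1 hj
    refine eq_of_rep_eq (c := c₂⁻¹ * c₁) (mul_mem (inv_mem hc₂) hc₁) (h := h₁ * h₂⁻¹) ?_
    rw [Subgroup.coe_mul, Subgroup.coe_inv, ← mul_assoc, mul_assoc c₂⁻¹, mul_assoc c₂⁻¹, ← e₁, e₂]
    group
  · obtain ⟨⟨l, x⟩, hlx⟩ := Quotient.exists_rep (s := inducedSetoid H X) y.1
    have hlx' : (y : Induced H X) = Induced.mk H l x := hlx.symm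
    obtain ⟨τ, hτ, -⟩ := exists_of_mem_fixedBy (hlx' ▸ y.2)
    obtain ⟨i, h⟩ := exists_rep_eq hτ
    exact ⟨i, (mk_mem_range_componentMap_iff _ x y hlx').2 h⟩

end DoubleCosets

/-! ### The change-of-group map -/

section ChangeOfGroup

variable {G : Type*} [Group G] [TopologicalSpace G] [IsTopologicalGroup G] {H : Subgroup G}
  {X : Type*} [TopologicalSpace X] [MulAction H X] [ContinuousSMul H X] (n : ℤ)

/-- The restriction of a class on `(G ×_H X)^g` to `X^τ`, where `g = k * τ * k⁻¹`. -/
abbrev component {k g : G} {τ : H} (hg : conjIncl H k τ = g) :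
    KGroup (Lam g) (MulAction.fixedBy (Induced H X) g) n →+
      KGroup (Lam τ) (MulAction.fixedBy X τ) n :=
  KLam.map n (conjIncl H k) (translateIncl H X k) (translateIncl_smul k) hg

/-- Components of a class are compatible with the action of `G` on the family of K-groups. -/
theorem component_conj {k l g g' : G} {τ : H} (hg : conjIncl H k τ = g)
    (hg' : conjIncl H (l * k) τ = g') (h : conjHom l g = g')
    (a : KGroup (Lam g') (MulAction.fixedBy (Induced H X) g') n) :
    component n hg (KLam.map n (conjHom l) (translateMap (Induced H X) l)
      (translateMap_smul (Induced H X) l) h a) = component n hg' a := by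
  refine KLam.map_map n _ _ _ _ _ _ _ _ _ ?_ ?_ _ _ _ a
  · ext γ
    change l * k * γ * (l * k)⁻¹ = l * (k * γ * k⁻¹) * l⁻¹
    group
  · ext x
    exact mul_smul l k (Induced.incl H X x)

/-- Replacing `k` by `k * h` with `h ∈ H` changes a component by the action of `h`. -/
theorem component_mul {k g : G} {h τ τ' : H} (hg : conjIncl H (k * h) τ = g)
    (hg' : conjIncl H k τ' = g) (e : conjHom h τ = τ')
    (a : KGroup (Lam g) (MulAction.fixedBy (Induced H X) g) n) :
    KLam.map n (conjHom h) (translateMap X h) (translateMap_smul X h) e (component n hg' a) =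
      component n hg a := by
  refine KLam.map_map n _ _ _ _ _ _ _ _ _ ?_ ?_ _ _ _ a
  · ext γ
    change k * h * γ * (k * h)⁻¹ = k * (h * γ * (h : G)⁻¹) * k⁻¹
    group
  · ext x
    change translateIncl H X (k * h) x = translateIncl H X k (h • x)
    rw [translateIncl_apply, translateIncl_apply, Induced.mk_mul]

/-- A component depends only on the double coset. -/
theorem component_eq {k l c g : G} {h τ τ' : H} (hc : c ∈ Subgroup.centralizer ({g} : Set G))
    (hk : k = c * l * h) (hg : conjIncl H k τ = g) (hg' : conjIncl H l τ' = g) :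
    ∃ e : conjHom h τ = τ', ∀ a : KGroup (Lam g) (MulAction.fixedBy (Induced H X) g) n,
      component n hg a =
        KLam.map n (conjHom h) (translateMap X h) (translateMap_smul X h) e
          (component n hg' a) := by
  have hcg : conjHom c g = g :=
    mul_inv_eq_iff_eq_mul.2 (Subgroup.mem_centralizer_singleton_iff.1 hc)
  have hcl : conjIncl H (c * l) τ' = g := by
    have h₁ : conjIncl H (c * l) τ' = conjHom c (conjIncl H l τ') := by
      change c * l * τ' * (c * l)⁻¹ = c * (l * τ' * l⁻¹) * c⁻¹
      group
    rw [h₁, hg', hcg]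
  have e : conjHom h τ = τ' := by
    refine mul_inv_eq_iff_eq_mul.2 (Subtype.ext (mul_left_cancel (a := c * l) ?_))
    have h₁ := conjIncl_eq_iff.1 hg
    rw [hk] at h₁
    rw [Subgroup.coe_mul, Subgroup.coe_mul, ← mul_assoc, ← mul_assoc, h₁, conjIncl_eq_iff.1 hcl,
      mul_assoc g]
  refine ⟨e, fun a => ?_⟩
  subst hk
  rw [← component_mul n hg hcl e, ← component_conj n hg' hcl hcg, KLam.map_conj_self]

/-- By `G`-invariance, the class of `a` at any `g` conjugate to `τ` determines the class of its
image at `τ`, through conjugation by `k`. -/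
theorem changeOfGroup_apply (a : QEll n G (Induced H X)) (τ : {τ : H // IsOfFinOrder τ}) {k : G}
    (g : {g : G // IsOfFinOrder g}) (hg : conjIncl H k (τ : H) = g) :
    (changeOfGroup H X n a).1 τ = component n hg (a.1 g) := by
  have h₁ := a.2 k ⟨inclHom H (τ : H), (inclHom H).toMonoidHom.isOfFinOrder τ.2⟩ g hg
  have h₂ := KLam.map_map n (inclHom H) (ContinuousMap.id (Induced H X)) (fun _ _ => rfl)
    (ContinuousMonoidHom.id H) (Induced.incl H X) (Induced.incl_smul H X) (inclHom H)
    (Induced.incl H X) (Induced.incl_smul H X) rfl rfl rfl rfl rfl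
    (a.1 ⟨inclHom H (τ : H), (inclHom H).toMonoidHom.isOfFinOrder τ.2⟩)
  refine Eq.trans h₂ ?_
  rw [← h₁]
  exact KLam.map_map n _ _ _ _ _ _ _ _ _ rfl rfl _ _ _ _

/-- An invariant family on `G ×_H X` is determined by its components. Conversely, a class at `g` is
assembled from the classes at one `τ` for each double coset; it has the required components at all
the other `τ`, and is therefore `G`-invariant, because `b` is `H`-invariant. -/
theorem Rigid.bijective_changeOfGroup [CompactSpace G] [T2Space G] [SecondCountableTopology G]
    (hH : Rigid H) (hcl : IsClosed (H : Set G)) :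
    Function.Bijective (changeOfGroup H X n) := by
  have hbij := fun g : {g : G // IsOfFinOrder g} => hH.bijective_components hcl X n g.2
  have hord : ∀ {k g : G} {τ : H}, conjIncl H k τ = g → IsOfFinOrder g → IsOfFinOrder τ := by
    intro k g τ hg hfin
    have hinj : Function.Injective (conjIncl H k).toMonoidHom :=
      (MulAut.conj k).injective.comp Subtype.val_injective
    refine hinj.isOfFinOrder_iff.1 ?_
    change IsOfFinOrder (conjIncl H k τ)
    rwa [hg]
  constructor
  · intro a a' haa
    refine Subtype.ext (funext fun g => (hbij g).1 (funext fun i => ?_))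
    have h := hord (conjIncl_rep i) g.2
    have h₁ := changeOfGroup_apply n a ⟨_, h⟩ g (conjIncl_rep i)
    have h₂ := changeOfGroup_apply n a' ⟨_, h⟩ g (conjIncl_rep i)
    exact h₁.symm.trans ((congrArg (fun b : QEll n H X => b.1 ⟨_, h⟩) haa).trans h₂)
  · intro b
    choose a ha using fun g : {g : G // IsOfFinOrder g} => (hbij g).2 fun i =>
      b.1 ⟨repElem i, hord (conjIncl_rep i) g.2⟩
    -- The invariance of `b` under `H` determines the components for all `k`.
    have hcomp : ∀ (g : {g : G // IsOfFinOrder g}) (k : G) (τ : {τ : H // IsOfFinOrder τ})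
        (hg : conjIncl H k (τ : H) = g), component n hg (a g) = b.1 τ := by
      intro g k τ hg
      obtain ⟨i, c, hc, h, hk⟩ := exists_rep_eq hg
      obtain ⟨e, he⟩ := component_eq (X := X) n hc hk hg (conjIncl_rep i)
      rw [he]
      have h₁ : component n (conjIncl_rep i) (a g) = _ := congrFun (ha g) i
      rw [h₁]
      exact b.2 h τ ⟨repElem i, hord (conjIncl_rep i) g.2⟩ e
    refine ⟨⟨a, fun l g g' hl => (hbij g).1 (funext fun i => ?_)⟩, Subtype.ext (funext fun τ => ?_)⟩
    · have hg' : conjIncl H (l * rep i) (repElem i) = (g' : G) := by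
        refine Eq.trans ?_ ((congrArg (conjHom l) (conjIncl_rep i)).trans hl)
        change l * rep i * repElem i * (l * rep i)⁻¹ = l * (rep i * repElem i * (rep i)⁻¹) * l⁻¹
        group
      have hτ := hord (conjIncl_rep i) g.2
      exact ((component_conj n (conjIncl_rep i) hg' hl (a g')).trans
        (hcomp g' _ ⟨_, hτ⟩ hg')).trans (hcomp g _ ⟨_, hτ⟩ (conjIncl_rep i)).symm
    · have hg : conjIncl H 1 (τ : H) = (τ : H) := by
        rw [conjIncl_eq_iff, one_mul, mul_one]
      have hτ : IsOfFinOrder ((τ : H) : G) := (inclHom H).toMonoidHom.isOfFinOrder τ.2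
      exact (changeOfGroup_apply n _ τ ⟨_, hτ⟩ hg).trans (hcomp ⟨_, hτ⟩ 1 τ hg)

end ChangeOfGroup

theorem mainTheorem9 {E : Type*} [NormedAddCommGroup E] [NormedSpace ℝ E] [FiniteDimensional ℝ E]
    {G : Type*} [Group G] [TopologicalSpace G] [IsTopologicalGroup G] [CompactSpace G] [T2Space G]
    [ChartedSpace E G] [LieGroup 𝓘(ℝ, E) ∞ G]
    (H : Subgroup G) (hH : IsClosed (H : Set G))
    (X : Type*) [TopologicalSpace X] [MulAction H X] [ContinuousSMul H X] (n : ℤ) :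
    Function.Bijective (changeOfGroup H X n) := by
  obtain ⟨c⟩ := nonempty_groupChart E G
  have : SecondCountableTopology G := ChartedSpace.secondCountable_of_sigmaCompact E G
  have hrigid : Rigid H := fun σ hσ m hm hσm V hV => c.exists_nhds_conj_nhds hH hσ hm hσm hV
  exact hrigid.bijective_changeOfGroup n hH

end
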